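/- Let $n\ge 1$ and let $\mathbb{H}^n=\mathbb{C}^n\times\mathbb{R}$ be the Heisenberg group with multiplication $(w,s)(z,t)=(w+z,\,s+t+\tfrac12\operatorname{Im}(w\cdot\bar z))$, dilations $\delta_r(z,t)=(rz,r^2t)$, homogeneous dimension $Q=2n+2$, Lebesgue (Haar) measure, and left-invariant fields $X_j=\partial_{x_j}+\tfrac12y_j\partial_t$, $Y_j=\partial_{y_j}-\tfrac12x_j\partial_t$, $\mathcal{T}=\partial_t$. Write $\nabla_{(1)}\cdot A=\sum_{j=1}^n(X_jA_j+Y_jA_{n+j})$ and $\nabla_{(2)}=\mathcal{T}$. Convolution is $f*_{(1)}f'(g')=\int_{\mathbb{H}^n}f(g)f'(g^{-1}g')\,dg$, and for a function $c$ on the centre (identified with $\mathbb{R}$), $f*_{(2)}c(g')=\int_{\mathbb{R}}f(g'(0,v))\,c(-v)\,dv$. Put $B^{(1)}(o,r)=\{(z,t):(|z|^4+t^2)^{1/4}<r\}$ and $B^{(2)}(0,s)=\{(0,t):|t|<s\}$. For $g\in\mathbb{H}^n$ and $r,s>0$ the tube $T=T(g,r,s)$ is the set $g\,B^{(1)}(o,r)\,B^{(2)}(0,s)$;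 its centre is $g$, its width is $\mathrm{w}(T)=r$, its height is $\mathrm{h}(T)=r^2+s$, and $2T:=T(g,2r,4s)$. For tubes $T,S$ put $\rho(T,S)=\mathrm{w}(T)/\mathrm{w}(S)+\mathrm{h}(T)/\mathrm{h}(S)$. Fix a constant $C_0$. A particle associated to $T$ is a function $a\in L^2(\mathbb{H}^n)$ such that $a=\nabla_{(1)}\cdot\nabla_{(2)}A$ (in the sense of distributions) for some $A\in L^2(\mathbb{H}^n;\mathbb{C}^{2n})$ supported in $T$ that satisfies the precursor estimates $$\|(\nabla_{(1)}\cdot)^i\nabla_{(2)}^jA\|_{L^2}\le C_0\,\mathrm{w}(T)^{1-i}\,\mathrm{h}(T)^{1-j}\,\|a\|_{L^2}\qquad(i,j\in\{0,1\},\ (i,j)\ne(1,1)).$$ Let $\varphi^{(1)}\in C^\infty(\mathbb{H}^n)$ and $\varphi^{(2)}\in C^\infty(\mathbb{R})$ have integral $0$ and supports in $B^{(1)}(o,1)$ and $B^{(2)}(0,1)$ respectively, let $\varphi^{(1)}_s=s^{-Q}\varphi^{(1)}\circ\delta_{1/s}$ and $\varphi^{(2)}_t=t^{-1}\varphi^{(2)}(\cdot/t)$,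 and let $k$ be the flag singular integral kernel $$k=\int_0^\infty\!\!\int_0^\infty\varphi^{(1)}_s*_{(2)}\varphi^{(2)}_t\,\frac{ds}{s}\,\frac{dt}{t},$$ where $a*_{(1)}k$ means the limit in $L^2(\mathbb{H}^n)$ of $a*_{(1)}k_{\varepsilon,N,\delta,M}$ as $\varepsilon,\delta\to0^+$ and $N,M\to\infty$ independently, $k_{\varepsilon,N,\delta,M}$ being the same integral over $\varepsilon<s\le N$, $\delta<t\le M$. Then there is a constant $C$, depending only on $n$, $\varphi^{(1)}$, $\varphi^{(2)}$ and $C_0$, such that for each tube $T$ and each particle $a$ associated to $T$ the limit $a*_{(1)}k$ exists in $L^2(\mathbb{H}^n)$, and for each tube $S\supseteq2T$ with the same centre as $T$, $$\int_{S^c}|a*_{(1)}k(g)|\,dg\le C\,\rho(T,S)\,|T|^{1/2}\,\|a\|_{L^2(\mathbb{H}^n)},$$ while for each tube $S\supseteq2T$, whatever its centre, $$\int_{(2S)^c}|a*_{(1)}k(g)|\,dg\le C\,\rho(T,S)\,|T|^{1/2}\,\|a\|_{L^2(\mathbb{H}^n)}.$$ -/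

import Mathlib

open MeasureTheory Filter Topology
open scoped ContDiff ENNReal

noncomputable section

namespace FlagHeisenberg

/-- The underlying space `ℂⁿ × ℝ` of the Heisenberg group. Its `volume` is Lebesgue measure, which is
the Haar measure of the group. (The product topology and Lebesgue measure are used; the componentwise
ring operations are not the group operations, which are `hmul` and `hinv` below.) -/
abbrev Heis (n : ℕ) : Type := (Fin n → ℂ) × ℝ

/-- The group law `(w,s)(z,t) = (w + z, s + t + (1/2) Im (w · conj z))`. -/
def hmul {n : ℕ} (g g' : Heis n) : Heis n :=
  (g.1 + g'.1, g.2 + g'.2 + (1 / 2) * (∑ j, g.1 j * star (g'.1 j)).im)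

/-- The inverse in the Heisenberg group. -/
def hinv {n : ℕ} (g : Heis n) : Heis n := (-g.1, -g.2)

/-- The automorphic dilation `δ_r (z,t) = (r z, r² t)`. -/
def dil {n : ℕ} (r : ℝ) (g : Heis n) : Heis n := ((r : ℂ) • g.1, r ^ 2 * g.2)

/-- The element `(0, v)` of the centre. -/
def central {n : ℕ} (v : ℝ) : Heis n := (0, v)

/-- The Korányi gauge `(|z|⁴ + t²)^(1/4)`, with `|z|` the Euclidean norm on `ℂⁿ`. -/
def koranyi {n : ℕ} (g : Heis n) : ℝ :=
  ((∑ j, ‖g.1 j‖ ^ 2) ^ 2 + g.2 ^ 2) ^ (1 / 4 : ℝ)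

/-- The Korányi ball `B⁽¹⁾(o, r)`. -/
def ball₁ (n : ℕ) (r : ℝ) : Set (Heis n) := {g | koranyi g < r}

/-- The interval `B⁽²⁾(0, s)`; the centre is identified with `ℝ`. -/
def ball₂ (s : ℝ) : Set ℝ := {v | |v| < s}

/-- The data `(g, r, s)` of a tube `T(g, r, s)`. -/
structure Tube (n : ℕ) where
  center : Heis n
  r : ℝ
  s : ℝ
  r_pos : 0 < r
  s_pos : 0 < s

namespace Tube

variable {n : ℕ}

/-- The set `g B⁽¹⁾(o, r) B⁽²⁾(0, s)`. -/
def carrier (T : Tube n) : Set (Heis n) :=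
  {g | ∃ b ∈ ball₁ n T.r, ∃ v ∈ ball₂ T.s, g = hmul (hmul T.center b) (central v)}

/-- The width `r` of a tube. -/
def width (T : Tube n) : ℝ := T.r

/-- The height `r² + s` of a tube. -/
def height (T : Tube n) : ℝ := T.r ^ 2 + T.s

/-- The dilated tube `2T = g B⁽¹⁾(o, 2r) B⁽²⁾(0, 4s)`. -/
def double (T : Tube n) : Tube n where
  center := T.center
  r := 2 * T.r
  s := 4 * T.s
  r_pos := mul_pos two_pos T.r_pos
  s_pos := mul_pos four_pos T.s_pos

/-- `ρ(T, S) = w(T)/w(S) + h(T)/h(S)`. -/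
def rho (T S : Tube n) : ℝ := T.width / S.width + T.height / S.height

end Tube

/-- The left-invariant horizontal fields as vectors at the point `g = (x + iy, t)`:
`X_j = ∂_{x_j} + (1/2) y_j ∂_t` for the index `inl j` and `Y_j = ∂_{y_j} - (1/2) x_j ∂_t` for `inr j`.
They are the derivatives of `g · (ε e_j, 0)` and `g · (ε i e_j, 0)` in `ε` at `ε = 0`. -/
def horField {n : ℕ} : Fin n ⊕ Fin n → Heis n → Heis n
  | Sum.inl j, g => (Pi.single j 1, (1 / 2) * (g.1 j).im)
  | Sum.inr j, g => (Pi.single j Complex.I, -((1 / 2) * (g.1 j).re))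

/-- Horizontal vector fields (in terms of the frame `X_1, …, X_n, Y_1, …, Y_n`), with the
Euclidean norm in the fibres. -/
abbrev HorVec (n : ℕ) : Type := EuclideanSpace ℂ (Fin n ⊕ Fin n)

/-- Test functions: smooth, compactly supported, complex-valued. -/
def IsTest {n : ℕ} (ψ : Heis n → ℂ) : Prop := ContDiff ℝ ∞ ψ ∧ HasCompactSupport ψ

/-- `f = ∇₍₁₎ · A = ∑ X_j A_j + ∑ Y_j A_{n+j}` in the sense of distributions (the fields `X_j`, `Y_j`
are divergence free, so that their formal adjoints are `-X_j`, `-Y_j`). -/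
def IsHorDiv {n : ℕ} (A : Heis n → HorVec n) (f : Heis n → ℂ) : Prop :=
  ∀ ψ : Heis n → ℂ, IsTest ψ →
    ∫ g, ∑ i, A g i * fderiv ℝ ψ g (horField i g) = -∫ g, f g * ψ g

/-- `V = ∇₍₂₎ A = ∂_t A`, componentwise, in the sense of distributions. -/
def IsVertDeriv {n : ℕ} (A V : Heis n → HorVec n) : Prop :=
  ∀ ψ : Heis n → ℂ, IsTest ψ → ∀ i,
    ∫ g, A g i * fderiv ℝ ψ g (0, 1) = -∫ g, V g i * ψ g

/-- `a` is a particle associated to the tube `T`, with constant `C₀` in the precursor estimates: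
`a ∈ L²` and `a = ∇₍₁₎ · ∇₍₂₎ A` for a horizontal vector field `A` supported in `T` with
`‖(∇₍₁₎·)^i ∇₍₂₎^j A‖₂ ≤ C₀ w(T)^(1-i) h(T)^(1-j) ‖a‖₂` for `i, j ∈ {0, 1}` (for `i = j = 1` there is
nothing to require). Here `V` is `∇₍₂₎ A` and `D` is `∇₍₁₎ · A`. -/
def IsParticle {n : ℕ} (C₀ : ℝ) (T : Tube n) (a : Heis n → ℂ) : Prop :=
  MemLp a 2 volume ∧
  ∃ (A V : Heis n → HorVec n) (D : Heis n → ℂ),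
    MemLp A 2 volume ∧ MemLp V 2 volume ∧ MemLp D 2 volume ∧
    (∀ᵐ g, g ∉ T.carrier → A g = 0) ∧
    IsVertDeriv A V ∧ IsHorDiv A D ∧ IsHorDiv V a ∧
    eLpNorm A 2 volume ≤ ENNReal.ofReal (C₀ * T.width * T.height) * eLpNorm a 2 volume ∧
    eLpNorm D 2 volume ≤ ENNReal.ofReal (C₀ * T.height) * eLpNorm a 2 volume ∧
    eLpNorm V 2 volume ≤ ENNReal.ofReal (C₀ * T.width) * eLpNorm a 2 volume

/-- Convolution on the Heisenberg group: `(f ∗₍₁₎ f')(g') = ∫ f(g) f'(g⁻¹ g') dg`. -/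
def conv₁ {n : ℕ} (f f' : Heis n → ℂ) (g' : Heis n) : ℂ :=
  ∫ g, f g * f' (hmul (hinv g) g')

/-- Convolution with a function on the centre: `(f ∗₍₂₎ c)(g') = ∫ f(g' g₂) c(g₂⁻¹) dg₂`. -/
def conv₂ {n : ℕ} (f : Heis n → ℂ) (c : ℝ → ℂ) (g' : Heis n) : ℂ :=
  ∫ v : ℝ, f (hmul g' (central v)) * c (-v)

/-- The normalised dilate `φ_s(g) = s^(-Q) φ(δ_{1/s} g)`, with `Q = 2n + 2`. -/
def dilate₁ {n : ℕ} (φ : Heis n → ℂ) (s : ℝ) (g : Heis n) : ℂ :=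
  ((s ^ (2 * n + 2))⁻¹ : ℝ) * φ (dil s⁻¹ g)

/-- The normalised dilate `φ_t(v) = t⁻¹ φ(v/t)` on the centre. -/
def dilate₂ (φ : ℝ → ℂ) (t : ℝ) (v : ℝ) : ℂ := (t⁻¹ : ℝ) * φ (t⁻¹ * v)

/-- The truncated flag kernel
`∫_{ε < s ≤ N} ∫_{δ < t ≤ M} φ⁽¹⁾_s ∗₍₂₎ φ⁽²⁾_t dt/t ds/s`, a smooth compactly supported function. -/
def truncKernel {n : ℕ} (φ₁ : Heis n → ℂ) (φ₂ : ℝ → ℂ) (ε N δ M : ℝ) (g : Heis n) : ℂ :=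
  ∫ s in Set.Ioc ε N, ∫ t in Set.Ioc δ M,
    ((s⁻¹ * t⁻¹ : ℝ) : ℂ) * conv₂ (dilate₁ φ₁ s) (dilate₂ φ₂ t) g

/-- `F = a ∗₍₁₎ k`, where `k = ∬ φ⁽¹⁾_s ∗₍₂₎ φ⁽²⁾_t ds/s dt/t` over `(0,∞) × (0,∞)`. The double integral
does not converge absolutely; `a ∗₍₁₎ k` is the `L²` limit of the convolutions of `a` with the
truncated kernels, as the truncations are removed (all four independently of each other). -/
def IsFlagConv {n : ℕ} (φ₁ : Heis n → ℂ) (φ₂ : ℝ → ℂ) (a F : Heis n → ℂ) : Prop :=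
  MemLp F 2 volume ∧
  Tendsto
    (fun p : (ℝ × ℝ) × (ℝ × ℝ) =>
      eLpNorm (fun g => conv₁ a (truncKernel φ₁ φ₂ p.1.1 p.1.2 p.2.1 p.2.2) g - F g) 2 volume)
    ((𝓝[>] 0 ×ˢ atTop) ×ˢ (𝓝[>] 0 ×ˢ atTop)) (𝓝 0)

end FlagHeisenberg

end

open FlagHeisenberg

set_option linter.unusedSectionVars false

/-! Cut the double integral at a Heisenberg scale ρ and a central scale η, equal to 1/16 of the
width and of the height of `S`. The part with `s ≤ ρ`, `t ≤ η` has a kernel of small support, so its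
convolution with `a` lives in a slightly enlarged box that is still inside `S` (or `2S`) and
contributes nothing to the integral. The parts `s > ρ` (all `t`) and `s ≤ ρ`, `t > η` are bounded in
`L¹` of the whole group, each by moving a derivative from the particle to the kernel
(`Precursor.setLIntegral_flag_le`). Write `r`, `h` for the width and height of `T`, and `D = ∇₍₁₎ ·
A`, `V = ∇₍₂₎ A`.

Large `t` (`Precursor.lintegral_central_le`): since `a = ∂_t D`, the derivative moves to `φ₂` and
leaves a central kernel of `L¹` norm `O(1/η)`. What remains is the convolution of `D` with the
Heisenberg kernel. Scales `s ≤ r` keep it in a box comparable with `T`, where `L²` boundedness and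
Cauchy–Schwarz suffice; for `s > r` one uses `D = ∇₍₁₎ · A` and a kernel that converges absolutely
at infinity. The gain is `h/η`.

Large `s` (`Precursor.lintegral_dyadic_le`): a dyadic block `s ~ u` gains `r/u`, and the blocks sum
geometrically. For `t > max(h, u²)` both derivatives are moved and Young's inequality is enough. For
smaller `t` one writes `a = ∇₍₁₎ · V` and applies Cauchy–Schwarz on a box of width `~u` and height
`~max(h, u²)`, which is far larger than `T`. The loss is recovered by Schur's test restricted to the
support of `V`: a ball of radius `~u` meets the box of `T` in volume at most `~r^(2n) min(h, u²)`,
and `min(h, u²) · max(h, u²) = u² h`.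

For the `L²` limit, the truncated convolution is a product of two integrated unitary
representations, by right translations of the group and of its centre. Each factor is uniformly
bounded by Cotlar–Stein (`norm_sum_le_of_almost_orthogonal`). Small scales converge by density of
smoothed vectors; large scales converge on particles because a moved derivative gives decay `1/M`.
Uniform boundedness then makes the limit joint in all four truncations
(`Precursor.exists_isFlagConv`), and the `L¹` bounds, uniform in the truncations, pass to the limit
by Fatou. -/

noncomputable section

namespace FlagHeisenberg

/-! ### The Cotlar–Stein lemma. -/

section CotlarStein

variable {E : Type*} [NormedRing E]

/-- The product of the norms of the consecutive products of a list, times the norm of its last entry. -/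
def consecNorm : List E → ℝ
  | [] => 1
  | [x] => ‖x‖
  | x :: y :: l => ‖x * y‖ * consecNorm (y :: l)

/-- The product of the norms of the products of disjoint consecutive pairs of a list. -/
def pairNorm : List E → ℝ
  | [] => 1
  | [x] => ‖x‖
  | x :: y :: l => ‖x * y‖ * pairNorm l

lemma consecNorm_nonneg : ∀ l : List E, 0 ≤ consecNorm l
  | [] => zero_le_one
  | [x] => norm_nonneg x
  | _ :: y :: l => mul_nonneg (norm_nonneg _) (consecNorm_nonneg (y :: l))

lemma pairNorm_nonneg : ∀ l : List E, 0 ≤ pairNorm l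
  | [] => zero_le_one
  | [x] => norm_nonneg x
  | _ :: _ :: l => mul_nonneg (norm_nonneg _) (pairNorm_nonneg l)

lemma norm_prod_le_pairNorm [NormOneClass E] : ∀ l : List E, ‖l.prod‖ ≤ pairNorm l
  | [] => by simp [pairNorm]
  | [x] => by simp [pairNorm]
  | x :: y :: l => by
    rw [List.prod_cons, List.prod_cons, ← mul_assoc, pairNorm]
    exact (norm_mul_le _ _).trans
      (mul_le_mul_of_nonneg_left (norm_prod_le_pairNorm l) (norm_nonneg _))

/-- The pairings that start at the first and at the second entry together contain each consecutive
pair once, and exactly one of them leaves the last entry unpaired. -/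
lemma pairNorm_mul_pairNorm_tail : ∀ (x : E) (l : List E),
    pairNorm (x :: l) * pairNorm l = consecNorm (x :: l)
  | x, [] => by simp [pairNorm, consecNorm]
  | x, y :: l => by
    rw [consecNorm, pairNorm, ← pairNorm_mul_pairNorm_tail y l]; ring

lemma norm_prod_sq_le [NormOneClass E] (x : E) (l : List E) :
    ‖(x :: l).prod‖ ^ 2 ≤ ‖x‖ * consecNorm (x :: l) := by
  have h1 := norm_prod_le_pairNorm (x :: l)
  have h2 : ‖(x :: l).prod‖ ≤ ‖x‖ * pairNorm l := by
    rw [List.prod_cons]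
    exact (norm_mul_le _ _).trans
      (mul_le_mul_of_nonneg_left (norm_prod_le_pairNorm l) (norm_nonneg _))
  rw [sq, ← pairNorm_mul_pairNorm_tail]
  calc _ ≤ pairNorm (x :: l) * (‖x‖ * pairNorm l) :=
        mul_le_mul h1 h2 (norm_nonneg _) (pairNorm_nonneg _)
    _ = _ := by ring

/-- The alternating product `⋯ S_b S_{!b}` with `p` factors, the last one being of type `b`. -/
def altProd (S : Bool → E) : ℕ → Bool → E
  | 0, _ => 1
  | p + 1, b => altProd S p (!b) * S b

/-- Induction on `p`: the sum adjacent to the list is expanded and its summand becomes the new head.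
The root of `consecNorm` then acquires one factor √‖X (!b) i * X b j‖, whose sum over `i` costs Γ.
The factor √A comes from the bound of a product of operators by the geometric mean of its two
pairings. -/
lemma norm_altProd_mul_prod_le [NormOneClass E] {ι : Type*} (s : Finset ι) (X : Bool → ι → E)
    {A Γ : ℝ} (hΓ : 0 ≤ Γ) (hA : ∀ b, ∀ i ∈ s, ‖X b i‖ ≤ A)
    (hX : ∀ b, ∀ j ∈ s, ∑ i ∈ s, √‖X (!b) i * X b j‖ ≤ Γ) (p : ℕ) :
    ∀ b, ∀ j ∈ s, ∀ l : List E,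
      ‖altProd (fun b => ∑ i ∈ s, X b i) p (!b) * (X b j :: l).prod‖ ≤
        √A * Γ ^ p * √(consecNorm (X b j :: l)) := by
  induction p with
  | zero =>
    intro b j hj l
    rw [altProd, one_mul, pow_zero, mul_one, ← Real.sqrt_mul ((norm_nonneg _).trans (hA b j hj))]
    refine Real.le_sqrt_of_sq_le ((norm_prod_sq_le _ _).trans ?_)
    exact mul_le_mul_of_nonneg_right (hA b j hj) (consecNorm_nonneg _)
  | succ p ih =>
    intro b j hj l
    have e : altProd (fun b => ∑ i ∈ s, X b i) (p + 1) (!b) * (X b j :: l).prod =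
        ∑ i ∈ s, altProd (fun b => ∑ i ∈ s, X b i) p (!!b) * (X (!b) i :: X b j :: l).prod := by
      rw [altProd, mul_assoc, Finset.sum_mul, Finset.mul_sum]
      rfl
    rw [e]
    calc _ ≤ ∑ i ∈ s, √A * Γ ^ p * √(consecNorm (X (!b) i :: X b j :: l)) :=
          norm_sum_le_of_le _ fun i hi => ih (!b) i hi _
      _ = √A * Γ ^ p * √(consecNorm (X b j :: l)) * ∑ i ∈ s, √‖X (!b) i * X b j‖ := by
          rw [Finset.mul_sum]
          refine Finset.sum_congr rfl fun i _ => ?_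
          rw [consecNorm, Real.sqrt_mul (norm_nonneg _)]; ring
      _ ≤ √A * Γ ^ p * √(consecNorm (X b j :: l)) * Γ := by
          refine mul_le_mul_of_nonneg_left (hX b j hj) ?_
          positivity
      _ = _ := by ring

lemma altProd_two_mul (S : Bool → E) (m : ℕ) (b : Bool) :
    altProd S (2 * m) b = (S (!b) * S b) ^ m := by
  induction m with
  | zero => simp [altProd]
  | succ m ih =>
    rw [Nat.mul_succ, altProd, altProd, pow_succ, Bool.not_not, ih, mul_assoc]

/-- A real number whose powers are bounded by a fixed multiple of the powers of `Γ` is at most `Γ`. -/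
lemma le_of_forall_pow_two_pow_le {x Γ B : ℝ} (hΓ : 0 ≤ Γ)
    (h : ∀ k : ℕ, x ^ (2 ^ (k + 1)) ≤ B * Γ ^ (2 ^ (k + 1))) : x ≤ Γ := by
  by_contra! hlt
  rcases hΓ.eq_or_lt with rfl | hΓ
  · have := h 0
    have h2 : 0 < x ^ 2 := by positivity
    norm_num at this
    linarith
  · have h1 : 1 < x / Γ := (one_lt_div hΓ).2 hlt
    obtain ⟨m, hm⟩ := pow_unbounded_of_one_lt B h1
    have h2 := h m
    have h3 : (x / Γ) ^ m ≤ (x / Γ) ^ (2 ^ (m + 1)) :=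
      pow_le_pow_right₀ h1.le ((Nat.lt_two_pow_self (n := m)).le.trans
        (Nat.pow_le_pow_right two_pos (Nat.le_succ m)))
    rw [div_pow x Γ (2 ^ (m + 1))] at h3
    have h4 := hm.trans_le h3
    rw [lt_div_iff₀ (by positivity)] at h4
    linarith

/-- The Cotlar–Stein almost orthogonality lemma for a finite family. -/
theorem norm_sum_le_of_almost_orthogonal {F : Type*} [NormedRing F] [NormOneClass F] [StarRing F]
    [CStarRing F] {ι : Type*} (s : Finset ι) (T : ι → F) {Γ : ℝ} (hΓ : 0 ≤ Γ)
    (h₁ : ∀ j ∈ s, ∑ i ∈ s, √‖star (T i) * T j‖ ≤ Γ)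
    (h₂ : ∀ j ∈ s, ∑ i ∈ s, √‖T i * star (T j)‖ ≤ Γ) : ‖∑ i ∈ s, T i‖ ≤ Γ := by
  -- The main argument divides by Γ; for Γ = 0 the diagonal terms of `h₁` already annihilate every
  -- `T j`.
  rcases hΓ.eq_or_lt with rfl | hΓ'
  · have : ∀ j ∈ s, T j = 0 := fun j hj => by
      have h := (Finset.single_le_sum (f := fun i => √‖star (T i) * T j‖)
        (fun _ _ => Real.sqrt_nonneg _) hj).trans (h₁ j hj)
      have h := Real.sqrt_eq_zero'.1 (le_antisymm h (Real.sqrt_nonneg _))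
      rw [CStarRing.norm_star_mul_self] at h
      have h0 := norm_nonneg (T j)
      exact norm_eq_zero.1 (by nlinarith)
    rw [Finset.sum_eq_zero this, norm_zero]
  set X : Bool → ι → F := fun b i => if b then star (T i) else T i with hX
  set S := ∑ i ∈ s, T i with hS
  have hnorm : ∀ b i, ‖X b i‖ = ‖T i‖ := by intro b i; cases b <;> simp [hX]
  have hsum : (fun b => ∑ i ∈ s, X b i) = fun b => if b then star S else S := by
    funext b; cases b <;> simp [hX, hS]
  obtain ⟨A, hA⟩ : ∃ A, ∀ i ∈ s, ‖T i‖ ≤ A :=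
    ⟨∑ i ∈ s, ‖T i‖, fun i hi => Finset.single_le_sum (f := fun i => ‖T i‖)
      (fun _ _ => norm_nonneg _) hi⟩
  have hbd : ∀ b, ∀ j ∈ s, ∑ i ∈ s, √‖X (!b) i * X b j‖ ≤ Γ := by
    intro b j hj
    cases b
    · simpa [hX] using h₁ j hj
    · simpa [hX] using h₂ j hj
  have key := norm_altProd_mul_prod_le s X hΓ (fun b i hi => (hnorm b i).trans_le (hA i hi)) hbd
  -- By the C*-identity the powers of ‖S‖ are norms of alternating products. Of their `p + 1`
  -- factors, `p` yield Γ each; the last sum is estimated trivially, and this makes up `B`, which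
  -- does not depend on `k`.
  refine le_of_forall_pow_two_pow_le (B := ∑ i ∈ s, √A * Γ⁻¹ * √‖T i‖) hΓ fun k => ?_
  have e1 : ‖S‖ ^ 2 ^ (k + 1) = ‖(star S * S) ^ 2 ^ k‖ := by
    rw [(IsSelfAdjoint.star_mul_self S).norm_pow_two_pow k, CStarRing.norm_star_mul_self, ← sq, ← pow_mul, pow_succ']
  have e2 : (star S * S) ^ 2 ^ k = altProd (fun b => ∑ i ∈ s, X b i) (2 * 2 ^ k) false := by
    rw [hsum, altProd_two_mul]; rfl
  obtain ⟨p, hp⟩ : ∃ p, 2 * 2 ^ k = p + 1 := ⟨2 * 2 ^ k - 1, by have := Nat.two_pow_pos k; omega⟩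
  rw [e1, e2, pow_succ', hp, altProd, Finset.mul_sum, Finset.sum_mul]
  refine norm_sum_le_of_le _ fun i hi => ?_
  have := key p false i hi []
  rw [List.prod_singleton, consecNorm, hnorm] at this
  refine this.trans (le_of_eq ?_)
  rw [pow_succ]; field_simp

end CotlarStein

end FlagHeisenberg

end


/-! ### Homogeneous groups and superpositions of dilates. -/

noncomputable section

namespace FlagHeisenberg

/-- A homogeneous group whose underlying space is a normed space `G`, whose identity is `0`, whose
inversion is `x ↦ -x` and whose Haar measure is `volume`. The field `modulus` says that test
functions are Lipschitz continuous in `L¹` with respect to the gauge. -/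
structure HomogeneousGroup (G : Type*) [NormedAddCommGroup G] [NormedSpace ℝ G]
    [MeasureSpace G] where
  op : G → G → G
  dil : ℝ → G → G
  gauge : G → ℝ
  dim : ℕ
  op_assoc : ∀ x y z, op (op x y) z = op x (op y z)
  op_zero : ∀ x, op x 0 = x
  zero_op : ∀ x, op 0 x = x
  op_neg : ∀ x, op x (-x) = 0
  continuous_op : Continuous fun p : G × G => op p.1 p.2
  measurePreserving_op : ∀ h, MeasurePreserving (op h)
  continuous_dil : Continuous fun p : ℝ × G => dil p.1 p.2
  dil_neg : ∀ s x, dil s (-x) = -dil s x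
  dil_op : ∀ s x y, dil s (op x y) = op (dil s x) (dil s y)
  map_dil : ∀ s, 0 < s → Measure.map (dil s) volume = ENNReal.ofReal (s ^ dim)⁻¹ • volume
  continuous_gauge : Continuous gauge
  gauge_neg : ∀ x, gauge (-x) = gauge x
  gauge_nonneg : ∀ x, 0 ≤ gauge x
  gauge_dil : ∀ s, 0 < s → ∀ x, gauge (dil s x) = s * gauge x
  modulus : ∀ ψ : G → ℂ, ContDiff ℝ ∞ ψ → HasCompactSupport ψ →
    ∃ C : ℝ, 0 ≤ C ∧ ∀ h, ∫⁻ x, ‖ψ (op (-h) x) - ψ x‖ₑ ≤ ENNReal.ofReal (C * gauge h)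

namespace HomogeneousGroup

variable {G : Type*} [NormedAddCommGroup G] [NormedSpace ℝ G] [MeasureSpace G] [BorelSpace G]
  [SecondCountableTopology G] (𝔾 : HomogeneousGroup G)

/-- The normalised dilate of a function. -/
def dilate (ψ : G → ℂ) (s : ℝ) (x : G) : ℂ := ((s ^ 𝔾.dim)⁻¹ : ℝ) * ψ (𝔾.dil s⁻¹ x)

/-- The superposition `∫_E ψ_s s^(-m-1) ds` of the normalised dilates of a function. -/
def kerInt (ψ : G → ℂ) (m : ℕ) (E : Set ℝ) (x : G) : ℂ :=
  ∫ s in E, (((s ^ (m + 1))⁻¹ : ℝ) : ℂ) * 𝔾.dilate ψ s x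

lemma neg_op_cancel (h x : G) : 𝔾.op (-h) (𝔾.op h x) = x := by
  have := 𝔾.op_neg (-h)
  rw [neg_neg] at this
  rw [← 𝔾.op_assoc, this, 𝔾.zero_op]

lemma op_neg_cancel (h x : G) : 𝔾.op h (𝔾.op (-h) x) = x := by
  rw [← 𝔾.op_assoc, 𝔾.op_neg, 𝔾.zero_op]

lemma measurable_dil (s : ℝ) : Measurable (𝔾.dil s) :=
  (𝔾.continuous_dil.comp (Continuous.prodMk_right s)).measurable

lemma measurable_op (h : G) : Measurable (𝔾.op h) := (𝔾.measurePreserving_op h).measurable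

lemma lintegral_dil {s : ℝ} (hs : 0 < s) {f : G → ℝ≥0∞} (hf : Measurable f) :
    ∫⁻ x, f (𝔾.dil s⁻¹ x) = ENNReal.ofReal (s ^ 𝔾.dim) * ∫⁻ x, f x := by
  rw [← lintegral_map hf (𝔾.measurable_dil _), 𝔾.map_dil _ (inv_pos.2 hs), lintegral_smul_measure,
    inv_pow, inv_inv, smul_eq_mul]

lemma integral_dil {s : ℝ} (hs : 0 < s) {f : G → ℂ} (hf : Continuous f) :
    ∫ x, f (𝔾.dil s⁻¹ x) = (s ^ 𝔾.dim : ℝ) * ∫ x, f x := by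
  rw [← integral_map (𝔾.measurable_dil _).aemeasurable hf.aestronglyMeasurable,
    𝔾.map_dil _ (inv_pos.2 hs), integral_smul_measure, inv_pow, inv_inv,
    ENNReal.toReal_ofReal (by positivity), Complex.real_smul]

lemma measurable_dilate {ψ : G → ℂ} (hψ : Continuous ψ) :
    Measurable fun p : ℝ × G => 𝔾.dilate ψ p.1 p.2 := by
  unfold dilate
  have h1 : Measurable fun p : ℝ × G => 𝔾.dil p.1⁻¹ p.2 :=
    𝔾.continuous_dil.measurable.comp ((measurable_fst.inv).prodMk measurable_snd)
  have h2 : Measurable fun p : ℝ × G => (p.1 ^ 𝔾.dim)⁻¹ := (measurable_fst.pow_const _).inv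
  exact (Complex.measurable_ofReal.comp h2).mul (hψ.measurable.comp h1)

lemma measurable_integrand {ψ : G → ℂ} (hψ : Continuous ψ) (m : ℕ) :
    Measurable fun p : ℝ × G => (((p.1 ^ (m + 1))⁻¹ : ℝ) : ℂ) * 𝔾.dilate ψ p.1 p.2 :=
  (Complex.measurable_ofReal.comp (measurable_fst.pow_const _).inv).mul (𝔾.measurable_dilate hψ)

lemma continuous_dilate {ψ : G → ℂ} (hψ : Continuous ψ) (s : ℝ) : Continuous (𝔾.dilate ψ s) :=
  continuous_const.mul (hψ.comp (𝔾.continuous_dil.comp (Continuous.prodMk_right s⁻¹)))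

lemma norm_integrand_le {ψ : G → ℂ} {M : ℝ} (hM : ∀ x, ‖ψ x‖ ≤ M) (m : ℕ) {α s : ℝ} (hα : 0 < α)
    (hs : α ≤ s) (x : G) :
    ‖(((s ^ (m + 1))⁻¹ : ℝ) : ℂ) * 𝔾.dilate ψ s x‖ ≤ M * (α ^ (m + 1 + 𝔾.dim))⁻¹ := by
  have h0 : 0 < s := hα.trans_le hs
  rw [dilate, norm_mul, norm_mul, Complex.norm_real, Complex.norm_real,
    Real.norm_of_nonneg (by positivity), Real.norm_of_nonneg (by positivity), ← mul_assoc,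
    ← mul_inv, ← pow_add, mul_comm]
  refine mul_le_mul (hM _) ?_ (by positivity) ((norm_nonneg _).trans (hM x))
  gcongr

lemma dilate_eq_zero {ψ : G → ℂ} (hψ : ∀ x, 1 ≤ 𝔾.gauge x → ψ x = 0) {s : ℝ} (hs : 0 < s) {x : G}
    (hx : s ≤ 𝔾.gauge x) : 𝔾.dilate ψ s x = 0 := by
  rw [dilate, hψ, mul_zero]
  rw [𝔾.gauge_dil _ (inv_pos.2 hs), inv_mul_eq_div]
  exact (one_le_div hs).2 hx

lemma lintegral_enorm_dilate {ψ : G → ℂ} (hψ : Continuous ψ) {s : ℝ} (hs : 0 < s) :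
    ∫⁻ x, ‖𝔾.dilate ψ s x‖ₑ = ∫⁻ x, ‖ψ x‖ₑ := by
  simp only [dilate, enorm_mul]
  rw [lintegral_const_mul _ (by
    exact (hψ.measurable.comp (𝔾.measurable_dil _)).enorm),
    𝔾.lintegral_dil hs (f := fun x => ‖ψ x‖ₑ) hψ.measurable.enorm, ← mul_assoc,
    ← ofReal_norm, Complex.norm_real, Real.norm_of_nonneg (by positivity),
    ← ENNReal.ofReal_mul (by positivity), inv_mul_cancel₀ (by positivity), ENNReal.ofReal_one,
    one_mul]

/-- Rescaling turns translation by `h` into translation by the dilate of `h` by `s⁻¹`, whose gauge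
is smaller by the factor `s`. -/
lemma lintegral_enorm_dilate_sub {ψ : G → ℂ} (hψ : Continuous ψ) {C : ℝ}
    (hC : ∀ h, ∫⁻ x, ‖ψ (𝔾.op (-h) x) - ψ x‖ₑ ≤ ENNReal.ofReal (C * 𝔾.gauge h))
    {s : ℝ} (hs : 0 < s) (h : G) :
    ∫⁻ x, ‖𝔾.dilate ψ s (𝔾.op (-h) x) - 𝔾.dilate ψ s x‖ₑ ≤
      ENNReal.ofReal (C * 𝔾.gauge h * s⁻¹) := by
  simp only [dilate, ← mul_sub, enorm_mul, 𝔾.dil_op, 𝔾.dil_neg]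
  have hm : Measurable fun x => ‖ψ (𝔾.op (-𝔾.dil s⁻¹ h) x) - ψ x‖ₑ :=
    ((hψ.measurable.comp (𝔾.measurable_op _)).sub hψ.measurable).enorm
  have e := lintegral_const_mul (μ := volume) ‖(((s ^ 𝔾.dim)⁻¹ : ℝ) : ℂ)‖ₑ
    (hm.comp (𝔾.measurable_dil s⁻¹))
  simp only [Function.comp_apply] at e
  rw [e, 𝔾.lintegral_dil hs hm, ← mul_assoc,
    ← ofReal_norm, Complex.norm_real, Real.norm_of_nonneg (by positivity),
    ← ENNReal.ofReal_mul (by positivity), inv_mul_cancel₀ (by positivity), ENNReal.ofReal_one,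
    one_mul]
  refine (hC _).trans (le_of_eq ?_)
  rw [𝔾.gauge_dil _ (inv_pos.2 hs)]; ring_nf

section KerInt

variable {ψ : G → ℂ} (hψ : Continuous ψ) {E : Set ℝ} (hE : MeasurableSet E)

include hψ in
lemma measurable_kerInt (m : ℕ) (E : Set ℝ) : Measurable (𝔾.kerInt ψ m E) :=
  (StronglyMeasurable.integral_prod_left (μ := volume.restrict E)
    (𝔾.measurable_integrand hψ m).stronglyMeasurable).measurable

include hψ hE in
lemma integrableOn_integrand {M : ℝ} (hM : ∀ x, ‖ψ x‖ ≤ M) (m : ℕ) {α β : ℝ} (hα : 0 < α)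
    (hEs : E ⊆ Set.Ioc α β) (x : G) :
    IntegrableOn (fun s => (((s ^ (m + 1))⁻¹ : ℝ) : ℂ) * 𝔾.dilate ψ s x) E := by
  refine Measure.integrableOn_of_bounded (M := M * (α ^ (m + 1 + 𝔾.dim))⁻¹)
    ((measure_mono hEs).trans_lt measure_Ioc_lt_top).ne
    ((𝔾.measurable_integrand hψ m).comp (measurable_id.prodMk measurable_const)).aestronglyMeasurable
    ?_
  filter_upwards [ae_restrict_mem hE] with s hs
  exact 𝔾.norm_integrand_le hM m hα (hEs hs).1.le x

include hE in
lemma norm_kerInt_le {M : ℝ} (hM : ∀ x, ‖ψ x‖ ≤ M) (m : ℕ) {α β : ℝ} (hα : 0 < α)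
    (hαβ : α ≤ β) (hEs : E ⊆ Set.Ioc α β) (x : G) :
    ‖𝔾.kerInt ψ m E x‖ ≤ M * (α ^ (m + 1 + 𝔾.dim))⁻¹ * (β - α) := by
  have hM0 : 0 ≤ M := (norm_nonneg _).trans (hM x)
  have h := norm_setIntegral_le_of_norm_le_const_ae' (μ := volume)
    (f := fun s => (((s ^ (m + 1))⁻¹ : ℝ) : ℂ) * 𝔾.dilate ψ s x)
    ((measure_mono hEs).trans_lt measure_Ioc_lt_top)
    (C := M * (α ^ (m + 1 + 𝔾.dim))⁻¹)
    (Eventually.of_forall fun s hs => 𝔾.norm_integrand_le hM m hα (hEs hs).1.le x)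
  refine h.trans (mul_le_mul_of_nonneg_left ?_ (by positivity))
  have h2 := measureReal_mono (μ := volume) hEs measure_Ioc_lt_top.ne
  rwa [Real.volume_real_Ioc_of_le hαβ] at h2

include hE in
lemma kerInt_eq_zero (hs : ∀ x, 1 ≤ 𝔾.gauge x → ψ x = 0) (m : ℕ) {α β : ℝ} (hα : 0 < α)
    (hEs : E ⊆ Set.Ioc α β) {x : G} (hx : β ≤ 𝔾.gauge x) : 𝔾.kerInt ψ m E x = 0 := by
  refine setIntegral_eq_zero_of_forall_eq_zero fun s h => ?_
  rw [𝔾.dilate_eq_zero hs (hα.trans (hEs h).1) ((hEs h).2.trans hx), mul_zero]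

end KerInt

end HomogeneousGroup

end FlagHeisenberg

end

/-! ### Integral estimates for superposed dilates. -/

noncomputable section

namespace FlagHeisenberg

namespace HomogeneousGroup

variable {G : Type*} [NormedAddCommGroup G] [NormedSpace ℝ G] [MeasureSpace G] [BorelSpace G]
  [SecondCountableTopology G] [SFinite (volume : Measure G)] (𝔾 : HomogeneousGroup G)
  {ψ : G → ℂ} (hψ : Continuous ψ) {E : Set ℝ} (hE : MeasurableSet E)

include hψ hE in
-- This is the hypothesis of Fubini's theorem: away from `s = 0` the dilates are uniformly bounded,
-- and the scales range over a set of finite measure.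
lemma integrable_prod_mul_integrand {Y : Type*} [MeasurableSpace Y] {ν : Measure Y}
    {M : ℝ} (hM : ∀ x, ‖ψ x‖ ≤ M) (m : ℕ) {α β : ℝ} (hα : 0 < α) (hEs : E ⊆ Set.Ioc α β)
    {W : Y → ℂ} (hW : Integrable W ν) {ζ : Y → G} (hζ : Measurable ζ) :
    Integrable (fun p : Y × ℝ => W p.1 *
      ((((p.2 ^ (m + 1))⁻¹ : ℝ) : ℂ) * 𝔾.dilate ψ p.2 (ζ p.1))) (ν.prod (volume.restrict E)) := by
  have hfin : IsFiniteMeasure (volume.restrict E) :=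
    ⟨by rw [Measure.restrict_apply_univ]; exact (measure_mono hEs).trans_lt measure_Ioc_lt_top⟩
  refine (hW.comp_fst (volume.restrict E)).mul_bdd (c := M * (α ^ (m + 1 + 𝔾.dim))⁻¹) ?_ ?_
  · exact ((𝔾.measurable_integrand hψ m).comp
      (measurable_snd.prodMk (hζ.comp measurable_fst))).aestronglyMeasurable
  · have h1 : ∀ᵐ p : Y × ℝ ∂(ν.prod (volume.restrict E)), p.2 ∈ E :=
      Measure.quasiMeasurePreserving_snd.ae (ae_restrict_mem hE)
    filter_upwards [h1] with p hp
    exact 𝔾.norm_integrand_le hM m hα (hEs hp).1.le _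

include hψ hE in
lemma integrableOn_integral_mul_dilate {Y : Type*} [MeasurableSpace Y] {ν : Measure Y} [SFinite ν]
    {M : ℝ} (hM : ∀ x, ‖ψ x‖ ≤ M) (m : ℕ) {α β : ℝ} (hα : 0 < α) (hEs : E ⊆ Set.Ioc α β)
    {W : Y → ℂ} (hW : Integrable W ν) {ζ : Y → G} (hζ : Measurable ζ) :
    IntegrableOn (fun s => (((s ^ (m + 1))⁻¹ : ℝ) : ℂ) *
      ∫ y, W y * 𝔾.dilate ψ s (ζ y) ∂ν) E := by
  have h := (𝔾.integrable_prod_mul_integrand hψ hE hM m hα hEs hW hζ).integral_prod_right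
  refine h.congr (Eventually.of_forall fun s => ?_)
  simp only [mul_left_comm (W _), integral_const_mul]

include hψ hE in
/-- Fubini's theorem for pairings with a superposition of dilates. -/
lemma integral_mul_kerInt {Y : Type*} [MeasurableSpace Y] {ν : Measure Y} [SFinite ν]
    {M : ℝ} (hM : ∀ x, ‖ψ x‖ ≤ M) (m : ℕ) {α β : ℝ} (hα : 0 < α) (hEs : E ⊆ Set.Ioc α β)
    {W : Y → ℂ} (hW : Integrable W ν) {ζ : Y → G} (hζ : Measurable ζ) :
    ∫ y, W y * 𝔾.kerInt ψ m E (ζ y) ∂ν =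
      ∫ s in E, (((s ^ (m + 1))⁻¹ : ℝ) : ℂ) * ∫ y, W y * 𝔾.dilate ψ s (ζ y) ∂ν := by
  simp only [kerInt, ← integral_const_mul]
  rw [integral_integral_swap (f := fun y s => W y *
    ((((s ^ (m + 1))⁻¹ : ℝ) : ℂ) * 𝔾.dilate ψ s (ζ y)))
    (𝔾.integrable_prod_mul_integrand hψ hE hM m hα hEs hW hζ)]
  congr! 4
  ring

include hψ in
lemma lintegral_enorm_kerInt_le (m : ℕ) (hE0 : E ⊆ Set.Ioi 0) (hE : MeasurableSet E) :
    ∫⁻ x, ‖𝔾.kerInt ψ m E x‖ₑ ≤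
      (∫⁻ s in E, ENNReal.ofReal (s ^ (m + 1))⁻¹) * ∫⁻ x, ‖ψ x‖ₑ := by
  calc ∫⁻ x, ‖𝔾.kerInt ψ m E x‖ₑ
      ≤ ∫⁻ x, ∫⁻ s in E, ‖(((s ^ (m + 1))⁻¹ : ℝ) : ℂ) * 𝔾.dilate ψ s x‖ₑ :=
        lintegral_mono fun x => enorm_integral_le_lintegral_enorm _
    _ = ∫⁻ s in E, ∫⁻ x, ‖(((s ^ (m + 1))⁻¹ : ℝ) : ℂ) * 𝔾.dilate ψ s x‖ₑ :=
        lintegral_lintegral_swap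
          (((𝔾.measurable_integrand hψ m).comp measurable_swap).enorm.aemeasurable)
    _ = ∫⁻ s in E, ENNReal.ofReal (s ^ (m + 1))⁻¹ * ∫⁻ x, ‖ψ x‖ₑ := by
        refine setLIntegral_congr_fun hE fun s hs => ?_
        have hs0 : 0 < s := hE0 hs
        simp only [enorm_mul]
        rw [lintegral_const_mul _ (𝔾.continuous_dilate hψ s).measurable.enorm,
          𝔾.lintegral_enorm_dilate hψ hs0, ← ofReal_norm, Complex.norm_real,
          Real.norm_of_nonneg (by positivity)]
    _ = _ := lintegral_mul_const _ (by fun_prop)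

include hψ in
-- At scale `s` the translation error is `C · gauge h / s`; with the weight `1/s` of the
-- superposition this gives `s⁻²`.
lemma lintegral_enorm_kerInt_sub_le {C : ℝ}
    (hC : ∀ h, ∫⁻ x, ‖ψ (𝔾.op (-h) x) - ψ x‖ₑ ≤ ENNReal.ofReal (C * 𝔾.gauge h))
    (hE : MeasurableSet E) {M : ℝ} (hM : ∀ x, ‖ψ x‖ ≤ M)
    {α β : ℝ} (hα : 0 < α) (hEs : E ⊆ Set.Ioc α β) (h : G) :
    ∫⁻ x, ‖𝔾.kerInt ψ 0 E (𝔾.op (-h) x) - 𝔾.kerInt ψ 0 E x‖ₑ ≤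
      (∫⁻ s in E, ENNReal.ofReal (s ^ 2)⁻¹) * ENNReal.ofReal (C * 𝔾.gauge h) := by
  have hm : Measurable fun p : G × ℝ => (((p.2 ^ (0 + 1))⁻¹ : ℝ) : ℂ) *
      (𝔾.dilate ψ p.2 (𝔾.op (-h) p.1) - 𝔾.dilate ψ p.2 p.1) := by
    refine (Complex.measurable_ofReal.comp (measurable_snd.pow_const _).inv).mul
      (Measurable.sub ?_ ((𝔾.measurable_dilate hψ).comp measurable_swap))
    exact (𝔾.measurable_dilate hψ).comp
      (measurable_snd.prodMk ((𝔾.measurable_op _).comp measurable_fst))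
  calc _ = ∫⁻ x, ‖∫ s in E, (((s ^ (0 + 1))⁻¹ : ℝ) : ℂ) *
          (𝔾.dilate ψ s (𝔾.op (-h) x) - 𝔾.dilate ψ s x)‖ₑ := by
        congr! 3 with x
        simp only [kerInt, mul_sub]
        rw [integral_sub (𝔾.integrableOn_integrand hψ hE hM 0 hα hEs _)
          (𝔾.integrableOn_integrand hψ hE hM 0 hα hEs _)]
    _ ≤ ∫⁻ x, ∫⁻ s in E, ‖(((s ^ (0 + 1))⁻¹ : ℝ) : ℂ) *
          (𝔾.dilate ψ s (𝔾.op (-h) x) - 𝔾.dilate ψ s x)‖ₑ :=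
        lintegral_mono fun x => enorm_integral_le_lintegral_enorm _
    _ = ∫⁻ s in E, ∫⁻ x, ‖(((s ^ (0 + 1))⁻¹ : ℝ) : ℂ) *
          (𝔾.dilate ψ s (𝔾.op (-h) x) - 𝔾.dilate ψ s x)‖ₑ :=
        lintegral_lintegral_swap hm.enorm.aemeasurable
    _ ≤ ∫⁻ s in E, ENNReal.ofReal (s ^ 2)⁻¹ * ENNReal.ofReal (C * 𝔾.gauge h) := by
        refine setLIntegral_mono' hE fun s hs => ?_
        have hs0 : 0 < s := hα.trans (hEs hs).1
        simp only [enorm_mul]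
        have hd := (𝔾.continuous_dilate hψ s).measurable
        have hd' : Measurable fun x => 𝔾.dilate ψ s (𝔾.op (-h) x) - 𝔾.dilate ψ s x :=
          (hd.comp (𝔾.measurable_op _)).sub hd
        rw [lintegral_const_mul _ hd'.enorm]
        refine (mul_le_mul_right (𝔾.lintegral_enorm_dilate_sub hψ hC hs0 h) _).trans
          (le_of_eq ?_)
        have := 𝔾.gauge_nonneg h
        rw [← ofReal_norm, Complex.norm_real, Real.norm_of_nonneg (by positivity),
          ← ENNReal.ofReal_mul (by positivity), ← ENNReal.ofReal_mul (by positivity)]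
        congr 1
        field_simp
        ring
    _ = _ := lintegral_mul_const _ (by fun_prop)

include hψ in
-- On the support of the dilate the gauge is less than `s`, which cancels the weight `1/s`; only the
-- length of the range of scales is left.
lemma lintegral_enorm_kerInt_mul_gauge_le (hs : ∀ x, 1 ≤ 𝔾.gauge x → ψ x = 0)
    (hE : MeasurableSet E) {α β : ℝ} (hα : 0 < α) (hEs : E ⊆ Set.Ioc α β) :
    ∫⁻ x, ‖𝔾.kerInt ψ 0 E x‖ₑ * ENNReal.ofReal (𝔾.gauge x) ≤
      ENNReal.ofReal (β - α) * ∫⁻ x, ‖ψ x‖ₑ := by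
  have hmg : Measurable fun x => ENNReal.ofReal (𝔾.gauge x) :=
    𝔾.continuous_gauge.measurable.ennreal_ofReal
  calc ∫⁻ x, ‖𝔾.kerInt ψ 0 E x‖ₑ * ENNReal.ofReal (𝔾.gauge x)
      ≤ ∫⁻ x, ∫⁻ s in E, ‖(((s ^ (0 + 1))⁻¹ : ℝ) : ℂ) * 𝔾.dilate ψ s x‖ₑ *
          ENNReal.ofReal (𝔾.gauge x) := by
        refine lintegral_mono fun x => ?_
        have hi : Measurable fun s : ℝ => (((s ^ (0 + 1))⁻¹ : ℝ) : ℂ) * 𝔾.dilate ψ s x :=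
          (𝔾.measurable_integrand hψ 0).comp (measurable_id.prodMk measurable_const)
        rw [lintegral_mul_const _ hi.enorm]
        exact mul_le_mul_left (enorm_integral_le_lintegral_enorm _) _
    _ = ∫⁻ s in E, ∫⁻ x, ‖(((s ^ (0 + 1))⁻¹ : ℝ) : ℂ) * 𝔾.dilate ψ s x‖ₑ *
          ENNReal.ofReal (𝔾.gauge x) :=
        lintegral_lintegral_swap
          ((((𝔾.measurable_integrand hψ 0).comp measurable_swap).enorm.mul
            (hmg.comp measurable_fst)).aemeasurable)
    _ ≤ ∫⁻ _ in E, ∫⁻ x, ‖ψ x‖ₑ := by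
        refine setLIntegral_mono' hE fun s hs' => ?_
        have hs0 : 0 < s := hα.trans (hEs hs').1
        rw [← 𝔾.lintegral_enorm_dilate hψ hs0]
        refine lintegral_mono fun x => ?_
        rcases le_or_gt s (𝔾.gauge x) with h | h
        · simp [𝔾.dilate_eq_zero hs hs0 h]
        · rw [enorm_mul, mul_right_comm, ← ofReal_norm (_ : ℂ), Complex.norm_real,
            Real.norm_of_nonneg (by positivity), ← ENNReal.ofReal_mul (by positivity)]
          refine mul_le_of_le_one_left zero_le (ENNReal.ofReal_le_one.2 ?_)
          rw [zero_add, pow_one, inv_mul_eq_div]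
          exact (div_le_one hs0).2 h.le
    _ ≤ _ := by
        rw [setLIntegral_const, mul_comm, ← Real.volume_Ioc]
        gcongr

lemma setLIntegral_inv_pow_le (m : ℕ) (hE : MeasurableSet E) {α β : ℝ} (hα : 0 < α)
    (hEs : E ⊆ Set.Ioc α β) :
    ∫⁻ s in E, ENNReal.ofReal (s ^ m)⁻¹ ≤ ENNReal.ofReal ((α ^ m)⁻¹ * (β - α)) := by
  calc _ ≤ ∫⁻ _ in E, ENNReal.ofReal (α ^ m)⁻¹ := by
        refine setLIntegral_mono' hE fun s hs => ENNReal.ofReal_le_ofReal ?_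
        have := (hEs hs).1
        gcongr
    _ ≤ ENNReal.ofReal (α ^ m)⁻¹ * volume (Set.Ioc α β) := by
        rw [setLIntegral_const]; gcongr
    _ = _ := by rw [Real.volume_Ioc, ← ENNReal.ofReal_mul (by positivity)]

/-- Each derivative moved to the kernel adds a power of `1/s` to the weight `1/s`. The resulting
`s⁻²` is integrable at infinity, and this is the source of every gain `1/α` that is uniform in the
upper truncation. -/
lemma setLIntegral_inv_sq_le {α : ℝ} (hα : 0 < α) (hEs : E ⊆ Set.Ioi α) :
    ∫⁻ s in E, ENNReal.ofReal (s ^ 2)⁻¹ ≤ ENNReal.ofReal α⁻¹ := by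
  refine (lintegral_mono_set hEs).trans ?_
  have h1 : ∀ s ∈ Set.Ioi α, (s ^ 2)⁻¹ = s ^ (-2 : ℝ) := fun s hs => by
    rw [Real.rpow_neg (hα.le.trans (le_of_lt hs))]; norm_cast
  have h2 := integrableOn_Ioi_rpow_of_lt (a := -2) (by norm_num) hα
  have h3 := integral_Ioi_rpow_of_lt (a := -2) (by norm_num) hα
  rw [setLIntegral_congr_fun measurableSet_Ioi fun s hs => by rw [h1 s hs],
    ← ofReal_integral_eq_lintegral_ofReal h2, h3]
  · refine ENNReal.ofReal_le_ofReal (le_of_eq ?_)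
    norm_num
    rw [Real.rpow_neg_one]
  · filter_upwards [ae_restrict_mem measurableSet_Ioi] with s hs
    have : 0 < s := hα.trans hs
    positivity

include hψ in
lemma integrable_kerInt (hψi : Integrable ψ) (m : ℕ) (hE : MeasurableSet E) {α β : ℝ} (hα : 0 < α)
    (hEs : E ⊆ Set.Ioc α β) : Integrable (𝔾.kerInt ψ m E) := by
  refine ⟨(𝔾.measurable_kerInt hψ m E).aestronglyMeasurable, ?_⟩
  refine (𝔾.lintegral_enorm_kerInt_le hψ m (fun s hs => hα.trans (hEs hs).1) hE).trans_lt ?_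
  exact ENNReal.mul_lt_top ((setLIntegral_inv_pow_le _ hE hα hEs).trans_lt ENNReal.ofReal_lt_top)
    hψi.2

include hψ in
lemma integral_kerInt_eq_zero (hψi : Integrable ψ) (h0 : ∫ x, ψ x = 0) (m : ℕ)
    (hE : MeasurableSet E) {α β : ℝ} (hα : 0 < α)
    (hEs : E ⊆ Set.Ioc α β) : ∫ x, 𝔾.kerInt ψ m E x = 0 := by
  have hm : Measurable (Function.uncurry fun (x : G) (s : ℝ) =>
      (((s ^ (m + 1))⁻¹ : ℝ) : ℂ) * 𝔾.dilate ψ s x) :=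
    (𝔾.measurable_integrand hψ m).comp (measurable_swap (α := G) (β := ℝ))
  have hint : Integrable (Function.uncurry fun (x : G) (s : ℝ) =>
      (((s ^ (m + 1))⁻¹ : ℝ) : ℂ) * 𝔾.dilate ψ s x) (volume.prod (volume.restrict E)) := by
    refine ⟨hm.aestronglyMeasurable, ?_⟩
    rw [hasFiniteIntegral_iff_enorm, lintegral_prod_symm _ hm.enorm.aemeasurable]
    calc _ = ∫⁻ s in E, ENNReal.ofReal (s ^ (m + 1))⁻¹ * ∫⁻ x, ‖ψ x‖ₑ := by
          refine setLIntegral_congr_fun hE fun s hs => ?_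
          have hs0 : 0 < s := hα.trans (hEs hs).1
          simp only [Function.uncurry, enorm_mul]
          rw [lintegral_const_mul _ (𝔾.continuous_dilate hψ s).measurable.enorm,
            𝔾.lintegral_enorm_dilate hψ hs0, ← ofReal_norm, Complex.norm_real,
            Real.norm_of_nonneg (by positivity)]
      _ = (∫⁻ s in E, ENNReal.ofReal (s ^ (m + 1))⁻¹) * ∫⁻ x, ‖ψ x‖ₑ :=
          lintegral_mul_const _ (by fun_prop)
      _ < ⊤ := ENNReal.mul_lt_top
          ((setLIntegral_inv_pow_le _ hE hα hEs).trans_lt ENNReal.ofReal_lt_top) hψi.2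
  simp only [kerInt]
  rw [integral_integral_swap hint]
  refine setIntegral_eq_zero_of_forall_eq_zero fun s hs => ?_
  simp only [dilate]
  rw [integral_const_mul, integral_const_mul, 𝔾.integral_dil (hα.trans (hEs hs).1) hψ, h0]
  simp

include hψ in
lemma kerInt_union {M : ℝ} (hM : ∀ x, ‖ψ x‖ ≤ M) (m : ℕ) {E' : Set ℝ} (hE : MeasurableSet E)
    (hE' : MeasurableSet E') (hd : Disjoint E E') {α β : ℝ} (hα : 0 < α)
    (hEs : E ⊆ Set.Ioc α β) (hEs' : E' ⊆ Set.Ioc α β) (x : G) :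
    𝔾.kerInt ψ m (E ∪ E') x = 𝔾.kerInt ψ m E x + 𝔾.kerInt ψ m E' x :=
  setIntegral_union hd hE' (𝔾.integrableOn_integrand hψ hE hM m hα hEs x)
    (𝔾.integrableOn_integrand hψ hE' hM m hα hEs' x)

lemma kerInt_empty (ψ : G → ℂ) (m : ℕ) : 𝔾.kerInt ψ m ∅ = 0 := by
  funext x; simp [kerInt]

lemma kerInt_neg (ψ : G → ℂ) (m : ℕ) (E : Set ℝ) (x : G) :
    𝔾.kerInt ψ m E (-x) = 𝔾.kerInt (fun x => ψ (-x)) m E x := by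
  simp only [kerInt, dilate, 𝔾.dil_neg]

lemma star_kerInt (ψ : G → ℂ) (m : ℕ) (E : Set ℝ) (x : G) :
    star (𝔾.kerInt ψ m E x) = 𝔾.kerInt (fun x => star (ψ x)) m E x := by
  simp only [kerInt, dilate]
  rw [← starRingEnd_apply, ← integral_conj]
  simp

end HomogeneousGroup

end FlagHeisenberg

end

/-! ### Integrated unitary representations. -/

noncomputable section

namespace FlagHeisenberg

/-- A strongly continuous unitary representation. -/
structure UnitaryRep {G : Type*} [NormedAddCommGroup G] [NormedSpace ℝ G] [MeasureSpace G]
    (𝔾 : HomogeneousGroup G) (H : Type*) [NormedAddCommGroup H] [InnerProductSpace ℂ H] where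
  U : G → H →ₗᵢ[ℂ] H
  op : ∀ h h' x, U h (U h' x) = U (𝔾.op h h') x
  zero : ∀ x, U 0 x = x
  cont : ∀ x, Continuous fun h => U h x

namespace UnitaryRep

variable {G : Type*} [NormedAddCommGroup G] [NormedSpace ℝ G] [MeasureSpace G] [BorelSpace G]
  [SecondCountableTopology G] {𝔾 : HomogeneousGroup G}
  {H : Type*} [NormedAddCommGroup H] [InnerProductSpace ℂ H] (ρ : UnitaryRep 𝔾 H)
  {κ η : G → ℂ}

lemma integrable_smul (hκ : Integrable κ) (x : H) : Integrable fun h => κ h • ρ.U h x := by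
  refine Integrable.mono' (hκ.norm.mul_const ‖x‖)
    (hκ.1.smul (ρ.cont x).aestronglyMeasurable) (Eventually.of_forall fun h => ?_)
  rw [norm_smul, LinearIsometry.norm_map]

open Classical in
/-- The operator `∫ κ(h) U(h) dh`. -/
def opr (κ : G → ℂ) : H →L[ℂ] H :=
  if hκ : Integrable κ then
    LinearMap.mkContinuous
      { toFun := fun x => ∫ h, κ h • ρ.U h x
        map_add' := fun x y => by
          simp only [map_add, smul_add]
          exact integral_add (ρ.integrable_smul hκ x) (ρ.integrable_smul hκ y)
        map_smul' := fun c x => by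
          simp only [map_smul, smul_comm _ c, integral_smul, RingHom.id_apply] }
      (∫ h, ‖κ h‖) fun x => by
        refine (norm_integral_le_integral_norm _).trans (le_of_eq ?_)
        simp only [norm_smul, LinearIsometry.norm_map, integral_mul_const]
  -- With this default value the bound by the `L¹` norm needs no integrability, as its right-hand
  -- side is nonnegative in any case.
  else 0

lemma opr_apply (hκ : Integrable κ) (x : H) : ρ.opr κ x = ∫ h, κ h • ρ.U h x := by
  rw [opr, dif_pos hκ]; rfl

lemma norm_opr_le (κ : G → ℂ) : ‖ρ.opr κ‖ ≤ ∫ h, ‖κ h‖ := by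
  unfold opr
  split_ifs with hκ
  · exact LinearMap.mkContinuous_norm_le _ (integral_nonneg fun _ => norm_nonneg _) _
  · rw [norm_zero]; exact integral_nonneg fun _ => norm_nonneg _

lemma opr_add (hκ : Integrable κ) (hη : Integrable η) :
    ρ.opr (fun h => κ h + η h) = ρ.opr κ + ρ.opr η := by
  ext x
  rw [_root_.add_apply, ρ.opr_apply hκ, ρ.opr_apply hη, ρ.opr_apply (κ := fun h => κ h + η h) (hκ.add hη),
    ← integral_add (ρ.integrable_smul hκ x) (ρ.integrable_smul hη x)]
  simp only [add_smul]

lemma inner_U (h : G) (x y : H) : inner ℂ (ρ.U h x) y = inner ℂ x (ρ.U (-h) y) := by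
  have h1 : ρ.U h (ρ.U (-h) y) = y := by rw [ρ.op, 𝔾.op_neg, ρ.zero]
  conv_lhs => rw [← h1]
  exact (ρ.U h).inner_map_map _ _

lemma adjoint_opr [CompleteSpace H] [(volume : Measure G).IsNegInvariant]
    [MeasurableNeg G] (hκ : Integrable κ) :
    ContinuousLinearMap.adjoint (ρ.opr κ) = ρ.opr fun h => star (κ (-h)) := by
  have hκ' : Integrable fun h => star (κ (-h)) := by
    exact (RCLike.conjLIE (K := ℂ)).integrable_comp_iff.2 hκ.comp_neg
  symm
  rw [ContinuousLinearMap.eq_adjoint_iff]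
  intro x y
  rw [ρ.opr_apply hκ', ρ.opr_apply hκ, ← inner_conj_symm,
    ← integral_inner (ρ.integrable_smul hκ' x), ← integral_inner (ρ.integrable_smul hκ y),
    ← integral_conj, ← integral_neg_eq_self]
  refine integral_congr_ae (Eventually.of_forall fun h => ?_)
  simp only [inner_smul_right, map_mul, neg_neg, inner_conj_symm, ρ.inner_U (-h)]
  simp

lemma U_opr [CompleteSpace H] (hη : Integrable η) (h : G) (x : H) :
    ρ.U h (ρ.opr η x) = ρ.opr (fun h' => η (𝔾.op (-h) h')) x := by
  have hmp := 𝔾.measurePreserving_op (-h)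
  have hη' : Integrable fun h' => η (𝔾.op (-h) h') := hmp.integrable_comp_of_integrable hη
  rw [ρ.opr_apply hη, ρ.opr_apply hη']
  have h1 := (ρ.U h).toContinuousLinearMap.integral_comp_comm (ρ.integrable_smul hη x)
  simp only [LinearIsometry.coe_toContinuousLinearMap, map_smul, ρ.op] at h1
  rw [← h1]
  have e : MeasurableEmbedding (𝔾.op h) :=
    (MeasurableEquiv.mk ⟨𝔾.op h, 𝔾.op (-h), 𝔾.neg_op_cancel h, 𝔾.op_neg_cancel h⟩
      (𝔾.measurable_op h) (𝔾.measurable_op (-h))).measurableEmbedding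
  rw [← (𝔾.measurePreserving_op h).integral_comp e fun a => η (𝔾.op (-h) a) • ρ.U a x]
  simp only [𝔾.neg_op_cancel]

/-- Almost orthogonality of an operator with a mean zero kernel of small first moment and an operator
with an `L¹`-Lipschitz kernel. -/
lemma norm_opr_mul_opr_le [CompleteSpace H] (hκ : Integrable κ) (hη : Integrable η)
    (h0 : ∫ h, κ h = 0) {B L : ℝ} (hB0 : 0 ≤ B) (hL0 : 0 ≤ L)
    (hB : ∫⁻ h, ‖κ h‖ₑ * ENNReal.ofReal (𝔾.gauge h) ≤ ENNReal.ofReal B)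
    (hL : ∀ h, ∫⁻ x, ‖η (𝔾.op (-h) x) - η x‖ₑ ≤ ENNReal.ofReal (L * 𝔾.gauge h)) :
    ‖ρ.opr κ * ρ.opr η‖ ≤ B * L := by
  have hm : AEStronglyMeasurable (fun h => ‖κ h‖ * 𝔾.gauge h) :=
    hκ.1.norm.mul 𝔾.continuous_gauge.aestronglyMeasurable
  have hnn : 0 ≤ᵐ[volume] fun h => ‖κ h‖ * 𝔾.gauge h :=
    Eventually.of_forall fun h => mul_nonneg (norm_nonneg _) (𝔾.gauge_nonneg h)
  have e0 : ∫⁻ h, ENNReal.ofReal (‖κ h‖ * 𝔾.gauge h) ≤ ENNReal.ofReal B := by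
    refine (lintegral_congr fun h => ?_).trans_le hB
    rw [ENNReal.ofReal_mul (norm_nonneg _), ofReal_norm]
  have hB' : ∫ h, ‖κ h‖ * 𝔾.gauge h ≤ B := by
    rw [integral_eq_lintegral_of_nonneg_ae hnn hm]
    exact ENNReal.toReal_le_of_le_ofReal hB0 e0
  have hi : Integrable fun h => ‖κ h‖ * 𝔾.gauge h := by
    refine ⟨hm, ?_⟩
    rw [hasFiniteIntegral_iff_ofReal hnn]
    exact e0.trans_lt ENNReal.ofReal_lt_top
  refine ContinuousLinearMap.opNorm_le_bound _ (by positivity) fun x => ?_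
  rw [mul_apply_eq_comp, ρ.opr_apply hκ]
  -- Mean zero of κ allows the identity to be subtracted from `U h`. The difference acts on η as a
  -- translation minus the identity, of `L¹` size `L · gauge h`, and is integrated against the first
  -- moment of κ.
  have e : ∫ h, κ h • ρ.U h (ρ.opr η x) = ∫ h, κ h • (ρ.U h (ρ.opr η x) - ρ.opr η x) := by
    simp only [smul_sub]
    rw [integral_sub (ρ.integrable_smul hκ _) (hκ.smul_const _), integral_smul_const, h0, zero_smul,
      sub_zero]
  rw [e]
  have hb : ∀ h, ‖ρ.U h (ρ.opr η x) - ρ.opr η x‖ ≤ L * 𝔾.gauge h * ‖x‖ := fun h => by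
    have hη' : Integrable fun h' => η (𝔾.op (-h) h') :=
      (𝔾.measurePreserving_op (-h)).integrable_comp_of_integrable hη
    have hd : Integrable fun h' => η (𝔾.op (-h) h') - η h' := hη'.sub hη
    have e2 : ρ.U h (ρ.opr η x) - ρ.opr η x = ρ.opr (fun h' => η (𝔾.op (-h) h') - η h') x := by
      rw [ρ.U_opr hη, ρ.opr_apply hη, ρ.opr_apply hη', ρ.opr_apply hd,
        ← integral_sub (ρ.integrable_smul hη' x) (ρ.integrable_smul hη x)]
      simp only [sub_smul]
    rw [e2]
    refine (ContinuousLinearMap.le_opNorm _ _).trans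
      (mul_le_mul_of_nonneg_right ((ρ.norm_opr_le _).trans ?_) (norm_nonneg _))
    rw [integral_norm_eq_lintegral_enorm hd.1]
    exact ENNReal.toReal_le_of_le_ofReal (mul_nonneg hL0 (𝔾.gauge_nonneg h)) (hL h)
  calc _ ≤ ∫ h, ‖κ h‖ * 𝔾.gauge h * (L * ‖x‖) := by
        refine norm_integral_le_of_norm_le (hi.mul_const _) (Eventually.of_forall fun h => ?_)
        rw [norm_smul, mul_assoc]
        refine mul_le_mul_of_nonneg_left ((hb h).trans (le_of_eq (by ring))) (norm_nonneg _)
    _ = (∫ h, ‖κ h‖ * 𝔾.gauge h) * (L * ‖x‖) := integral_mul_const _ _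
    _ ≤ B * (L * ‖x‖) := by gcongr
    _ = _ := by ring

end UnitaryRep

end FlagHeisenberg

end

/-! ### Convergence criteria and almost orthogonality of scales. -/

noncomputable section

namespace FlagHeisenberg

/-- Geometric sums over the distance to a fixed index are bounded. -/
lemma sum_pow_dist_le {q : ℝ} (hq0 : 0 ≤ q) (hq1 : q < 1) (J j : ℕ) :
    ∑ i ∈ Finset.range J, q ^ ((i - j) + (j - i)) ≤ 2 * (1 - q)⁻¹ := by
  have hs := summable_geometric_of_lt_one hq0 hq1
  have h1 : ∑ i ∈ (Finset.range J).filter (· ≤ j), q ^ ((i - j) + (j - i)) ≤ (1 - q)⁻¹ := by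
    have hinj : Set.InjOn (fun i => j - i) ((Finset.range J).filter (· ≤ j) : Finset ℕ) := by
      intro a ha b hb hab
      simp only [Finset.coe_filter, Set.mem_ofPred_eq] at ha hb
      simp only at hab
      omega
    rw [← tsum_geometric_of_lt_one hq0 hq1]
    refine le_trans (le_of_eq ?_) (hs.sum_le_tsum
      (((Finset.range J).filter (· ≤ j)).image fun i => j - i) fun _ _ => by positivity)
    rw [Finset.sum_image hinj]
    refine Finset.sum_congr rfl fun i hi => ?_
    rw [Finset.mem_filter] at hi
    congr 1; omega
  have h2 : ∑ i ∈ (Finset.range J).filter (¬ · ≤ j), q ^ ((i - j) + (j - i)) ≤ (1 - q)⁻¹ := by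
    have hinj : Set.InjOn (fun i => i - j) ((Finset.range J).filter (¬ · ≤ j) : Finset ℕ) := by
      intro a ha b hb hab
      simp only [Finset.coe_filter, Set.mem_ofPred_eq] at ha hb
      simp only at hab
      omega
    rw [← tsum_geometric_of_lt_one hq0 hq1]
    refine le_trans (le_of_eq ?_) (hs.sum_le_tsum
      (((Finset.range J).filter (¬ · ≤ j)).image fun i => i - j) fun _ _ => by positivity)
    rw [Finset.sum_image hinj]
    refine Finset.sum_congr rfl fun i hi => ?_
    rw [Finset.mem_filter] at hi
    congr 1; omega
  rw [← Finset.sum_filter_add_sum_filter_not (Finset.range J) (· ≤ j)]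
  linarith

/-- The set of points of convergence of a uniformly bounded family of operators is closed. -/
lemma exists_tendsto_of_approx {𝕜 H ι : Type*} [NontriviallyNormedField 𝕜] [NormedAddCommGroup H]
    [NormedSpace 𝕜 H] [CompleteSpace H]
    {l : Filter ι} [l.NeBot] {T : ι → H →L[𝕜] H} {C : ℝ} (hT : ∀ᶠ i in l, ‖T i‖ ≤ C) {x : H}
    (hx : ∀ δ > 0, ∃ y, ‖x - y‖ < δ ∧ ∃ z, Tendsto (fun i => T i y) l (𝓝 z)) :
    ∃ z, Tendsto (fun i => T i x) l (𝓝 z) := by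
  have hC : 0 ≤ C := by
    obtain ⟨i, hi⟩ := hT.exists
    exact (norm_nonneg _).trans hi
  rw [← cauchy_map_iff_exists_tendsto, Metric.cauchy_iff]
  refine ⟨inferInstance, fun ε hε => ?_⟩
  obtain ⟨y, hxy, z, hz⟩ := hx (ε / (4 * (C + 1))) (by positivity)
  have hz' := Metric.tendsto_nhds.1 hz (ε / 4) (by positivity)
  have key : ∀ᶠ i in l, dist (T i x) z < ε / 2 := by
    filter_upwards [hT, hz'] with i h1 h2
    have h3 : ‖T i x - T i y‖ ≤ ε / 4 := by
      rw [← map_sub]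
      refine ((T i).le_of_opNorm_le h1 _).trans ?_
      calc C * ‖x - y‖ ≤ (C + 1) * (ε / (4 * (C + 1))) := by gcongr; linarith
        _ = ε / 4 := by field_simp
    rw [← dist_eq_norm] at h3
    linarith [dist_triangle (T i x) (T i y) z]
  refine ⟨(fun i => T i x) '' {i | dist (T i x) z < ε / 2}, image_mem_map key, ?_⟩
  rintro _ ⟨i, hi, rfl⟩ _ ⟨j, hj, rfl⟩
  have := dist_triangle_right (T i x) (T j x) z
  simp only [Set.mem_ofPred_eq] at hi hj
  linarith

/-- Joint convergence of a product of two uniformly bounded families of operators. -/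
lemma tendsto_comp_of_tendsto {𝕜 H ι ι' : Type*} [NontriviallyNormedField 𝕜] [NormedAddCommGroup H]
    [NormedSpace 𝕜 H] [CompleteSpace H] {l : Filter ι} {l' : Filter ι'} [l.NeBot] [l'.NeBot]
    {R : ι' → H →L[𝕜] H} {C : ℝ} (hR : ∀ᶠ j in l', ‖R j‖ ≤ C) {u : ι → H} {b : H}
    (hu : Tendsto u l (𝓝 b))
    (hc : ∀ᶠ i in l, ∃ z, Tendsto (fun j => R j (u i)) l' (𝓝 z)) :
    ∃ z, Tendsto (fun p : ι × ι' => R p.2 (u p.1)) (l ×ˢ l') (𝓝 z) := by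
  have hC : 0 ≤ C := by
    obtain ⟨i, hi⟩ := hR.exists
    exact (norm_nonneg _).trans hi
  -- The vectors `u i`, at which `R` converges, approach `b`; hence `R` converges at `b`. The error
  -- `R j (u i - b)` is small uniformly in `j`, so the convergence is joint.
  obtain ⟨z, hz⟩ := exists_tendsto_of_approx hR (x := b) fun δ hδ => by
    obtain ⟨i, hi, hi'⟩ := (hc.and (Metric.tendsto_nhds.1 hu δ hδ)).exists
    refine ⟨u i, ?_, hi⟩
    rwa [dist_comm, dist_eq_norm] at hi'
  refine ⟨z, ?_⟩
  have h1 : Tendsto (fun p : ι × ι' => R p.2 (u p.1 - b)) (l ×ˢ l') (𝓝 0) := by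
    refine squeeze_zero_norm' (a := fun p => C * ‖u p.1 - b‖) ?_ ?_
    · filter_upwards [tendsto_snd.eventually hR] with p hp
      exact (R p.2).le_of_opNorm_le hp _
    · have h2 : Tendsto (fun i => C * ‖u i - b‖) l (𝓝 (C * ‖b - b‖)) :=
        ((hu.sub_const b).norm).const_mul C
      rw [sub_self, norm_zero, mul_zero] at h2
      exact h2.comp tendsto_fst
  have h2 := h1.add (hz.comp (tendsto_snd (f := l)))
  simpa using h2

namespace UnitaryRep

variable {G : Type*} [NormedAddCommGroup G] [NormedSpace ℝ G] [FiniteDimensional ℝ G]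
  [MeasureSpace G] [BorelSpace G]
  [SecondCountableTopology G] [(volume : Measure G).IsAddHaarMeasure] {𝔾 : HomogeneousGroup G}
  {H : Type*} [NormedAddCommGroup H] [InnerProductSpace ℂ H] [CompleteSpace H]
  (ρ : UnitaryRep 𝔾 H)

/-- The product of two operators with superposed kernels, the first at a small scale and
the second at a large scale. -/
lemma norm_opr_kerInt_mul_le {ψ η : G → ℂ} (hψ : Continuous ψ) (hψc : HasCompactSupport ψ)
    (h0 : ∫ x, ψ x = 0) (hs : ∀ x, 1 ≤ 𝔾.gauge x → ψ x = 0)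
    (hη : Continuous η) (hηc : HasCompactSupport η) {A L : ℝ} (hA : 0 ≤ A) (hL : 0 ≤ L)
    (hψA : ∫⁻ x, ‖ψ x‖ₑ ≤ ENNReal.ofReal A)
    (hηL : ∀ h, ∫⁻ x, ‖η (𝔾.op (-h) x) - η x‖ₑ ≤ ENNReal.ofReal (L * 𝔾.gauge h))
    {E E' : Set ℝ} (hE : MeasurableSet E) (hE' : MeasurableSet E') {α α' : ℝ} (hα : 0 < α)
    (hα' : 0 < α') (hEs : E ⊆ Set.Ioc α (2 * α)) (hEs' : E' ⊆ Set.Ioc α' (2 * α')) :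
    ‖ρ.opr (𝔾.kerInt ψ 0 E) * ρ.opr (𝔾.kerInt η 0 E')‖ ≤ A * L * (α / α') := by
  have hψi := hψ.integrable_of_hasCompactSupport hψc (μ := volume)
  have hηi := hη.integrable_of_hasCompactSupport hηc (μ := volume)
  obtain ⟨M, hM⟩ := hη.bounded_above_of_compact_support hηc
  -- Scales in `(α, 2α]` give first moment at most `α A`, and scales in `(α', 2α']` give Lipschitz
  -- constant at most `L/α'`.
  refine (ρ.norm_opr_mul_opr_le (𝔾.integrable_kerInt hψ hψi 0 hE hα hEs)
    (𝔾.integrable_kerInt hη hηi 0 hE' hα' hEs')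
    (𝔾.integral_kerInt_eq_zero hψ hψi h0 0 hE hα hEs) (B := α * A) (L := α'⁻¹ * L)
    (by positivity) (by positivity) ?_ fun h => ?_).trans (le_of_eq (by field_simp))
  · refine (𝔾.lintegral_enorm_kerInt_mul_gauge_le hψ hs hE hα hEs).trans ?_
    rw [ENNReal.ofReal_mul hα.le, two_mul, add_sub_cancel_right]
    exact mul_le_mul_right hψA _
  · refine (𝔾.lintegral_enorm_kerInt_sub_le hη hηL hE' hM hα' hEs' h).trans ?_
    rw [mul_assoc, ENNReal.ofReal_mul (p := α'⁻¹) (by positivity)]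
    refine mul_le_mul_left ?_ _
    exact HomogeneousGroup.setLIntegral_inv_sq_le hα' fun s hs => (hEs' hs).1

/-- The function `x ↦ conj (ψ (x⁻¹))`. -/
def flip (ψ : G → ℂ) (x : G) : ℂ := star (ψ (-x))

omit [FiniteDimensional ℝ G] [MeasureSpace G] [BorelSpace G] [SecondCountableTopology G]
  [(volume : Measure G).IsAddHaarMeasure] in
lemma contDiff_flip {ψ : G → ℂ} (hψ : ContDiff ℝ ∞ ψ) : ContDiff ℝ ∞ (flip ψ) :=
  Complex.conjCLE.contDiff.comp (hψ.comp contDiff_neg)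

lemma hasCompactSupport_flip {ψ : G → ℂ} (hψ : HasCompactSupport ψ) :
    HasCompactSupport (flip ψ) :=
  (hψ.comp_homeomorph (Homeomorph.neg G)).comp_left (g := star) (star_zero ℂ)

lemma adjoint_opr_kerInt {ψ : G → ℂ} (hψ : Continuous ψ) (hψi : Integrable ψ) {E : Set ℝ}
    (hE : MeasurableSet E) {α β : ℝ} (hα : 0 < α) (hEs : E ⊆ Set.Ioc α β) :
    star (ρ.opr (𝔾.kerInt ψ 0 E)) = ρ.opr (𝔾.kerInt (flip ψ) 0 E) := by
  rw [ContinuousLinearMap.star_eq_adjoint, ρ.adjoint_opr (𝔾.integrable_kerInt hψ hψi 0 hE hα hEs)]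
  congr 1
  funext h
  rw [𝔾.kerInt_neg, 𝔾.star_kerInt]; rfl

end UnitaryRep

end FlagHeisenberg

end

/-! ### Truncated singular integrals: uniform bounds and small scales. -/

noncomputable section

namespace FlagHeisenberg

namespace UnitaryRep

variable {G : Type*} [NormedAddCommGroup G] [NormedSpace ℝ G] [FiniteDimensional ℝ G]
  [MeasureSpace G] [BorelSpace G]
  [SecondCountableTopology G] [(volume : Measure G).IsAddHaarMeasure] {𝔾 : HomogeneousGroup G}
  {H : Type*} [NormedAddCommGroup H] [InnerProductSpace ℂ H] [CompleteSpace H]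
  (ρ : UnitaryRep 𝔾 H)

lemma opr_zero : ρ.opr (fun _ => 0) = 0 := by
  ext x
  rw [ρ.opr_apply (κ := fun _ => 0) (integrable_zero _ _ _)]
  simp

lemma opr_kerInt_union {ψ : G → ℂ} (hψ : Continuous ψ) (hψc : HasCompactSupport ψ)
    {E E' : Set ℝ} (hE : MeasurableSet E) (hE' : MeasurableSet E') (hd : Disjoint E E') {α β : ℝ}
    (hα : 0 < α) (hEs : E ⊆ Set.Ioc α β) (hEs' : E' ⊆ Set.Ioc α β) :
    ρ.opr (𝔾.kerInt ψ 0 (E ∪ E')) = ρ.opr (𝔾.kerInt ψ 0 E) + ρ.opr (𝔾.kerInt ψ 0 E') := by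
  have hψi := hψ.integrable_of_hasCompactSupport hψc (μ := volume)
  obtain ⟨M, hM⟩ := hψ.bounded_above_of_compact_support hψc
  rw [← ρ.opr_add (𝔾.integrable_kerInt hψ hψi 0 hE hα hEs)
    (𝔾.integrable_kerInt hψ hψi 0 hE' hα hEs')]
  congr 1
  funext x
  exact 𝔾.kerInt_union hψ hM 0 hE hE' hd hα hEs hEs' x

/-- Intersecting fixed dyadic blocks with `(ε, N]` takes care of an incomplete last block: it still
lies in a dyadic interval, which is all that the norm estimates need. -/
lemma opr_kerInt_dyadic {ψ : G → ℂ} (hψ : Continuous ψ) (hψc : HasCompactSupport ψ)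
    {ε N : ℝ} (hε : 0 < ε) (J : ℕ) :
    ρ.opr (𝔾.kerInt ψ 0 (Set.Ioc ε N ∩ Set.Ioc ε (2 ^ J * ε))) =
      ∑ j ∈ Finset.range J, ρ.opr (𝔾.kerInt ψ 0
        (Set.Ioc ε N ∩ Set.Ioc (2 ^ j * ε) (2 * (2 ^ j * ε)))) := by
  induction J with
  | zero =>
    simp only [pow_zero, one_mul, Set.Ioc_self, Set.inter_empty, Finset.range_zero,
      Finset.sum_empty, 𝔾.kerInt_empty]
    exact ρ.opr_zero
  | succ J ih =>
    have h1 : ε ≤ 2 ^ J * ε := le_mul_of_one_le_left hε.le (one_le_pow₀ one_le_two)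
    have h2 : 2 ^ J * ε ≤ 2 ^ (J + 1) * ε := by rw [pow_succ]; nlinarith
    rw [Finset.sum_range_succ, ← ih, ← Set.Ioc_union_Ioc_eq_Ioc h1 h2, Set.inter_union_distrib_left,
      ρ.opr_kerInt_union hψ hψc (by measurability) (by measurability) _ hε
        Set.inter_subset_left Set.inter_subset_left, pow_succ, mul_comm _ (2 : ℝ), mul_assoc]
    refine Set.disjoint_left.2 fun s hs hs' => ?_
    exact absurd hs.2.2 (not_le.2 hs'.2.1)

/-- Uniform boundedness of the truncated singular integral operators. -/
theorem exists_norm_opr_kerInt_le {ψ : G → ℂ} (hψ : ContDiff ℝ ∞ ψ) (hψc : HasCompactSupport ψ)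
    (h0 : ∫ x, ψ x = 0) (hs : ∀ x, 1 ≤ 𝔾.gauge x → ψ x = 0) :
    ∃ C : ℝ, 0 ≤ C ∧ ∀ ε N : ℝ, 0 < ε → ‖ρ.opr (𝔾.kerInt ψ 0 (Set.Ioc ε N))‖ ≤ C := by
  -- Cotlar–Stein needs the identity operator to have norm 1, which fails on the zero space.
  rcases subsingleton_or_nontrivial H with hH | hH
  · exact ⟨0, le_rfl, fun ε N _ => by rw [Subsingleton.elim (ρ.opr _) 0, norm_zero]⟩
  have hf := contDiff_flip hψ
  have hfc := hasCompactSupport_flip hψc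
  have hψi := hψ.continuous.integrable_of_hasCompactSupport hψc (μ := volume)
  have hf0 : ∫ x, flip ψ x = 0 := by
    have : ∫ x, ψ (-x) = 0 := by rw [integral_neg_eq_self ψ, h0]
    simp only [flip, ← starRingEnd_apply]
    rw [integral_conj, this, map_zero]
  have hfs : ∀ x, 1 ≤ 𝔾.gauge x → flip ψ x = 0 := fun x hx => by
    rw [flip, hs _ (by rwa [𝔾.gauge_neg]), star_zero]
  have hff : flip (flip ψ) = ψ := by funext x; simp [flip]
  obtain ⟨L₁, hL₁0, hL₁⟩ := 𝔾.modulus ψ hψ hψc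
  obtain ⟨L₂, hL₂0, hL₂⟩ := 𝔾.modulus _ hf hfc
  have hA : ∫⁻ x, ‖ψ x‖ₑ ≤ ENNReal.ofReal (∫ x, ‖ψ x‖) := by
    rw [integral_norm_eq_lintegral_enorm hψi.1, ENNReal.ofReal_toReal hψi.2.ne]
  have hfA : ∫⁻ x, ‖flip ψ x‖ₑ ≤ ENNReal.ofReal (∫ x, ‖ψ x‖) := by
    refine le_trans (le_of_eq ?_) hA
    rw [← lintegral_neg_eq_self (fun x => ‖ψ x‖ₑ)]
    refine lintegral_congr fun x => ?_
    rw [flip, ← ofReal_norm, norm_star, ofReal_norm]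
  set A := ∫ x, ‖ψ x‖
  have hA0 : 0 ≤ A := integral_nonneg fun _ => norm_nonneg _
  set B := A * (L₁ + L₂) with hB
  have hB0 : 0 ≤ B := by positivity
  -- Products of blocks `i` and `j` decay like `2^(-|i-j|)`, and Cotlar–Stein sums the square roots.
  -- In truncated subtraction `(i - j) + (j - i)` is the distance `|i - j|`.
  set q : ℝ := √(1 / 2) with hq
  have hq0 : 0 ≤ q := Real.sqrt_nonneg _
  have hq1 : q < 1 := by rw [hq, Real.sqrt_lt' one_pos]; norm_num
  refine ⟨√B * (2 * (1 - q)⁻¹), by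
    have : 0 < 1 - q := by linarith
    positivity, fun ε N hε => ?_⟩
  obtain ⟨J, hJ⟩ : ∃ J : ℕ, N ≤ 2 ^ J * ε := by
    obtain ⟨J, hJ⟩ := pow_unbounded_of_one_lt (N / ε) one_lt_two
    exact ⟨J, ((div_lt_iff₀ hε).1 hJ).le⟩
  have e1 : Set.Ioc ε N = Set.Ioc ε N ∩ Set.Ioc ε (2 ^ J * ε) :=
    (Set.inter_eq_left.2 (Set.Ioc_subset_Ioc_right hJ)).symm
  rw [e1, ρ.opr_kerInt_dyadic hψ.continuous hψc hε]
  set E : ℕ → Set ℝ := fun j => Set.Ioc ε N ∩ Set.Ioc (2 ^ j * ε) (2 * (2 ^ j * ε)) with hE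
  have hEm : ∀ j, MeasurableSet (E j) := fun j => measurableSet_Ioc.inter measurableSet_Ioc
  have hpos : ∀ j : ℕ, 0 < 2 ^ j * ε := fun j => by positivity
  have hEs : ∀ j, E j ⊆ Set.Ioc (2 ^ j * ε) (2 * (2 ^ j * ε)) := fun j => Set.inter_subset_right
  have hstar : ∀ j, star (ρ.opr (𝔾.kerInt ψ 0 (E j))) = ρ.opr (𝔾.kerInt (flip ψ) 0 (E j)) :=
    fun j => ρ.adjoint_opr_kerInt hψ.continuous hψi (hEm j) (hpos j) (hEs j)
  have hpow : ∀ i j : ℕ, i ≤ j → 2 ^ i * ε / (2 ^ j * ε) = (1 / 2 : ℝ) ^ ((i - j) + (j - i)) := by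
    intro i j hij
    rw [Nat.sub_eq_zero_of_le hij, zero_add, mul_div_mul_right _ _ hε.ne', one_div, inv_pow,
      pow_sub₀ _ two_ne_zero hij, mul_inv, inv_inv, mul_comm, div_eq_mul_inv, mul_comm]
  have hconst : ∀ {L : ℝ}, 0 ≤ L → L ≤ L₁ + L₂ → ∀ {c : ℝ}, 0 ≤ c → A * L * c ≤ B * c := by
    intro L hL hL' c hc
    rw [hB]; gcongr
  have key₁ : ∀ i j, ‖star (ρ.opr (𝔾.kerInt ψ 0 (E i))) * ρ.opr (𝔾.kerInt ψ 0 (E j))‖ ≤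
      B * (1 / 2 : ℝ) ^ ((i - j) + (j - i)) := by
    have aux : ∀ i j, i ≤ j → ‖star (ρ.opr (𝔾.kerInt ψ 0 (E i))) * ρ.opr (𝔾.kerInt ψ 0 (E j))‖ ≤
        B * (1 / 2 : ℝ) ^ ((i - j) + (j - i)) := fun i j hij => by
      rw [hstar, ← hpow i j hij]
      exact (ρ.norm_opr_kerInt_mul_le hf.continuous hfc hf0 hfs hψ.continuous hψc hA0 hL₁0 hfA hL₁
        (hEm i) (hEm j) (hpos i) (hpos j) (hEs i) (hEs j)).trans
        (hconst hL₁0 (by linarith) (by positivity))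
    intro i j
    rcases le_total i j with hij | hij
    · exact aux i j hij
    -- The adjoint exchanges the two factors, so the kernel of smaller scale can always be taken to
    -- stand on the left, where its mean zero is used.
    · rw [← norm_star, star_mul, star_star, add_comm]
      exact aux j i hij
  have key₂ : ∀ i j, ‖ρ.opr (𝔾.kerInt ψ 0 (E i)) * star (ρ.opr (𝔾.kerInt ψ 0 (E j)))‖ ≤
      B * (1 / 2 : ℝ) ^ ((i - j) + (j - i)) := by
    have aux : ∀ i j, i ≤ j → ‖ρ.opr (𝔾.kerInt ψ 0 (E i)) * star (ρ.opr (𝔾.kerInt ψ 0 (E j)))‖ ≤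
        B * (1 / 2 : ℝ) ^ ((i - j) + (j - i)) := fun i j hij => by
      rw [hstar, ← hpow i j hij]
      exact (ρ.norm_opr_kerInt_mul_le hψ.continuous hψc h0 hs hf.continuous hfc hA0 hL₂0 hA hL₂
        (hEm i) (hEm j) (hpos i) (hpos j) (hEs i) (hEs j)).trans
        (hconst hL₂0 (by linarith) (by positivity))
    intro i j
    rcases le_total i j with hij | hij
    · exact aux i j hij
    · rw [← norm_star, star_mul, star_star, add_comm]
      exact aux j i hij
  have hsum : ∀ {a : ℕ → ℕ → ℝ}, (∀ i j, a i j ≤ B * (1 / 2 : ℝ) ^ ((i - j) + (j - i))) →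
      ∀ j, ∑ i ∈ Finset.range J, √(a i j) ≤ √B * (2 * (1 - q)⁻¹) := by
    intro a ha j
    refine le_trans (Finset.sum_le_sum (g := fun i => √B * q ^ ((i - j) + (j - i))) fun i _ => ?_) ?_
    · refine (Real.sqrt_le_sqrt (ha i j)).trans (le_of_eq ?_)
      rw [Real.sqrt_mul hB0, hq]
      congr 1
      rw [Real.sqrt_eq_iff_mul_self_eq (by positivity) (by positivity), ← mul_pow,
        Real.mul_self_sqrt (by norm_num)]
    · rw [← Finset.mul_sum]
      exact mul_le_mul_of_nonneg_left (sum_pow_dist_le hq0 hq1 J j) (Real.sqrt_nonneg _)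
  refine norm_sum_le_of_almost_orthogonal _ _ ?_ (fun j _ => hsum key₁ j) (fun j _ => hsum key₂ j)
  have : 0 < 1 - q := by linarith
  positivity

/-- The operators with kernels a small bump function approximate the identity. -/
lemma exists_norm_sub_opr_lt (x : H) {δ : ℝ} (hδ : 0 < δ) :
    ∃ χ : G → ℂ, ContDiff ℝ ∞ χ ∧ HasCompactSupport χ ∧ ‖x - ρ.opr χ x‖ < δ := by
  have h1 : ∀ᶠ h in 𝓝 (0 : G), ‖ρ.U h x - x‖ < δ / 2 := by
    have := Metric.tendsto_nhds.1 ((ρ.cont x).tendsto 0) (δ / 2) (by positivity)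
    simpa only [dist_eq_norm, ρ.zero] using this
  obtain ⟨r, hr, hr'⟩ := Metric.eventually_nhds_iff_ball.1 h1
  let b : ContDiffBump (0 : G) := ⟨r / 2, r, by positivity, by linarith⟩
  have hbc : HasCompactSupport (b.normed volume) := b.hasCompactSupport_normed
  have hbi : Integrable (b.normed volume) :=
    b.continuous_normed.integrable_of_hasCompactSupport hbc
  refine ⟨fun h => ((b.normed volume h : ℝ) : ℂ),
    Complex.ofRealCLM.contDiff.comp b.contDiff_normed,
    hbc.comp_left (g := Complex.ofReal) Complex.ofReal_zero, ?_⟩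
  have hbi' : Integrable fun h => ((b.normed volume h : ℝ) : ℂ) := hbi.ofReal
  have hi := ρ.integrable_smul hbi' x
  rw [ρ.opr_apply hbi']
  have e : x = ∫ h, ((b.normed volume h : ℝ) : ℂ) • x := by
    rw [integral_smul_const, integral_complex_ofReal, b.integral_normed]; simp
  conv_lhs => enter [1, 1]; rw [e]
  rw [← integral_sub (hbi'.smul_const x) hi]
  refine lt_of_le_of_lt ?_ (half_lt_self hδ)
  calc _ ≤ ∫ h, b.normed volume h * (δ / 2) := by
        refine norm_integral_le_of_norm_le (hbi.mul_const _) (Eventually.of_forall fun h => ?_)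
        rw [← smul_sub, norm_smul, Complex.norm_real, Real.norm_of_nonneg (b.nonneg_normed h)]
        by_cases hh : h ∈ Metric.ball (0 : G) r
        · rw [norm_sub_rev]
          exact mul_le_mul_of_nonneg_left (hr' h hh).le (b.nonneg_normed h)
        · have : b.normed volume h = 0 := by
            rw [← Function.notMem_support, b.support_normed_eq]; exact hh
          rw [this]; simp
    _ = _ := by rw [integral_mul_const, b.integral_normed, one_mul]

/-- The truncated singular integral operators converge strongly as the truncation at small scales is
removed. -/
theorem exists_tendsto_opr_kerInt {ψ : G → ℂ} (hψ : ContDiff ℝ ∞ ψ) (hψc : HasCompactSupport ψ)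
    (h0 : ∫ x, ψ x = 0) (hs : ∀ x, 1 ≤ 𝔾.gauge x → ψ x = 0) (x : H) :
    ∃ z, Tendsto (fun ε => ρ.opr (𝔾.kerInt ψ 0 (Set.Ioc ε 1)) x) (𝓝[>] 0) (𝓝 z) := by
  obtain ⟨C, hC0, hC⟩ := ρ.exists_norm_opr_kerInt_le hψ hψc h0 hs
  have hψi := hψ.continuous.integrable_of_hasCompactSupport hψc (μ := volume)
  refine exists_tendsto_of_approx (C := C) ?_ fun δ hδ => ?_
  · filter_upwards [self_mem_nhdsWithin] with ε hε using hC ε 1 hε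
  obtain ⟨χ, hχ, hχc, hχx⟩ := ρ.exists_norm_sub_opr_lt x hδ
  refine ⟨ρ.opr χ x, hχx, ?_⟩
  have hχi := hχ.continuous.integrable_of_hasCompactSupport hχc (μ := volume)
  obtain ⟨L, hL0, hL⟩ := 𝔾.modulus χ hχ hχc
  have hA : ∫⁻ x, ‖ψ x‖ₑ ≤ ENNReal.ofReal (∫ x, ‖ψ x‖) := by
    rw [integral_norm_eq_lintegral_enorm hψi.1, ENNReal.ofReal_toReal hψi.2.ne]
  set A := ∫ x, ‖ψ x‖
  have hA0 : 0 ≤ A := integral_nonneg fun _ => norm_nonneg _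
  -- On a smoothed vector the bump χ supplies the Lipschitz kernel, and the scales between ε' and ε
  -- have first moment at most `A (ε - ε')`; hence the Cauchy property as ε → 0.
  have key : ∀ ε ε' : ℝ, 0 < ε' → ε' ≤ ε → ε ≤ 1 →
      ‖ρ.opr (𝔾.kerInt ψ 0 (Set.Ioc ε' 1)) (ρ.opr χ x) -
        ρ.opr (𝔾.kerInt ψ 0 (Set.Ioc ε 1)) (ρ.opr χ x)‖ ≤ A * L * ‖x‖ * ε := by
    intro ε ε' h1 h2 h3
    rw [← Set.Ioc_union_Ioc_eq_Ioc h2 h3, ρ.opr_kerInt_union hψ.continuous hψc measurableSet_Ioc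
      measurableSet_Ioc (Set.Ioc_disjoint_Ioc_of_le le_rfl) h1 (Set.Ioc_subset_Ioc_right h3)
      (Set.Ioc_subset_Ioc_left h2), _root_.add_apply, add_sub_cancel_right, ← mul_apply_eq_comp]
    have h4 := ρ.norm_opr_mul_opr_le (𝔾.integrable_kerInt hψ.continuous hψi 0 measurableSet_Ioc h1
      subset_rfl) hχi (𝔾.integral_kerInt_eq_zero hψ.continuous hψi h0 0 measurableSet_Ioc h1
      (subset_refl (Set.Ioc ε' ε))) (B := (ε - ε') * A) (mul_nonneg (by linarith) hA0) hL0 (by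
        refine (𝔾.lintegral_enorm_kerInt_mul_gauge_le hψ.continuous hs measurableSet_Ioc h1
          subset_rfl).trans ?_
        rw [ENNReal.ofReal_mul (by linarith)]
        exact mul_le_mul_right hA _) hL
    refine (ContinuousLinearMap.le_of_opNorm_le _ h4 x).trans ?_
    have : (ε - ε') * A * L * ‖x‖ ≤ ε * A * L * ‖x‖ := by gcongr; linarith
    linarith
  rw [← cauchy_map_iff_exists_tendsto, Metric.cauchy_iff]
  refine ⟨inferInstance, fun η hη => ?_⟩
  set K := A * L * ‖x‖
  have hK : 0 ≤ K := by positivity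
  have hpos : 0 < min 1 (η / (2 * (K + 1))) := lt_min one_pos (by positivity)
  refine ⟨_, image_mem_map (Ioc_mem_nhdsGT hpos), ?_⟩
  have main : ∀ ε ε' : ℝ, 0 < ε' → ε' ≤ ε → ε ≤ min 1 (η / (2 * (K + 1))) →
      ‖ρ.opr (𝔾.kerInt ψ 0 (Set.Ioc ε' 1)) (ρ.opr χ x) -
        ρ.opr (𝔾.kerInt ψ 0 (Set.Ioc ε 1)) (ρ.opr χ x)‖ < η := by
    intro ε ε' h1 h2 h3
    refine (key ε ε' h1 h2 (h3.trans (min_le_left _ _))).trans_lt ?_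
    have h4 : ε ≤ η / (2 * (K + 1)) := h3.trans (min_le_right _ _)
    calc K * ε ≤ (K + 1) * (η / (2 * (K + 1))) :=
          mul_le_mul (le_add_of_nonneg_right zero_le_one) h4 (h1.le.trans h2) (by positivity)
      _ = η / 2 := by field_simp
      _ < η := half_lt_self hη
  rintro _ ⟨ε, hε, rfl⟩ _ ⟨ε', hε', rfl⟩
  rcases le_total ε ε' with h | h
  · rw [dist_eq_norm]; exact main ε' ε hε.1 h hε'.2
  · rw [dist_comm, dist_eq_norm]; exact main ε ε' hε'.1 h hε.2

end UnitaryRep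

end FlagHeisenberg

end

/-! ### The line and the Heisenberg group as homogeneous groups. -/

noncomputable section

namespace FlagHeisenberg

/-- Test functions are Lipschitz continuous in `L¹` along translations which move points of bounded sets
by at most a multiple of the gauge. -/
lemma exists_lintegral_sub_le {G : Type*} [NormedAddCommGroup G] [NormedSpace ℝ G]
    [FiniteDimensional ℝ G] [MeasureSpace G] [BorelSpace G] [SecondCountableTopology G]
    [(volume : Measure G).IsAddHaarMeasure] {τ : G → G → G} {gauge : G → ℝ}
    (hτ : ∀ h, MeasurePreserving (τ h))
    (h0 : ∀ h, 0 ≤ gauge h)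
    (hloc : ∀ r₀ : ℝ, ∃ r₁ D : ℝ, r₀ ≤ r₁ ∧ 0 ≤ D ∧ ∀ h, gauge h ≤ 1 →
      (∀ x, ‖τ h x‖ ≤ r₀ → ‖x‖ ≤ r₁) ∧ ∀ x, ‖x‖ ≤ r₁ → ‖τ h x - x‖ ≤ D * gauge h)
    {ψ : G → ℂ} (hψ : ContDiff ℝ ∞ ψ) (hψc : HasCompactSupport ψ) :
    ∃ C : ℝ, 0 ≤ C ∧ ∀ h, ∫⁻ x, ‖ψ (τ h x) - ψ x‖ₑ ≤ ENNReal.ofReal (C * gauge h) := by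
  have hψi := hψ.continuous.integrable_of_hasCompactSupport hψc (μ := volume)
  obtain ⟨K, hK⟩ := hψ.lipschitzWith_of_hasCompactSupport hψc (by simp)
  obtain ⟨r₀, hr₀⟩ := hψc.isCompact.isBounded.subset_closedBall (0 : G)
  have hz : ∀ x, r₀ < ‖x‖ → ψ x = 0 := fun x hx => by
    by_contra hne
    have := hr₀ (subset_tsupport _ hne)
    rw [mem_closedBall_zero_iff] at this
    linarith
  obtain ⟨r₁, D, hr, hD, hh⟩ := hloc r₀
  set A := (∫⁻ x, ‖ψ x‖ₑ).toReal with hA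
  have hA' : ∫⁻ x, ‖ψ x‖ₑ = ENNReal.ofReal A := (ENNReal.ofReal_toReal hψi.2.ne).symm
  set m := (volume (Metric.closedBall (0 : G) r₁)).toReal with hm
  have hm' : volume (Metric.closedBall (0 : G) r₁) = ENNReal.ofReal m :=
    (ENNReal.ofReal_toReal measure_closedBall_lt_top.ne).symm
  have hA0 : 0 ≤ A := ENNReal.toReal_nonneg
  have hm0 : 0 ≤ m := ENNReal.toReal_nonneg
  -- For `gauge h ≤ 1` the difference is supported in the ball of radius `r₁`, of volume `m`, and is
  -- at most `K D gauge h` there; for larger `h` the trivial bound `2A` is at most `2A gauge h`.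
  refine ⟨2 * A + K * D * m, by positivity, fun h => ?_⟩
  rcases le_or_gt (gauge h) 1 with h1 | h1
  · have hb : ∀ x, ‖ψ (τ h x) - ψ x‖ₑ ≤
        (Metric.closedBall (0 : G) r₁).indicator (fun _ => ENNReal.ofReal (K * (D * gauge h))) x := by
      intro x
      by_cases hx : ‖x‖ ≤ r₁
      · rw [Set.indicator_of_mem (by rwa [mem_closedBall_zero_iff]), ← ofReal_norm]
        refine ENNReal.ofReal_le_ofReal ((hK.norm_sub_le _ _).trans ?_)
        exact mul_le_mul_of_nonneg_left ((hh h h1).2 x hx) K.2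
      · rw [hz x (by linarith), hz (τ h x) (by
          by_contra hc
          exact hx ((hh h h1).1 x (not_lt.1 hc)))]
        simp
    refine (lintegral_mono hb).trans ?_
    rw [lintegral_indicator_const Metric.isClosed_closedBall.measurableSet, hm',
      ← ENNReal.ofReal_mul (by have := h0 h; positivity)]
    refine ENNReal.ofReal_le_ofReal ?_
    have := mul_nonneg hA0 (h0 h)
    nlinarith
  · have hψm := hψ.continuous.measurable
    calc _ ≤ ∫⁻ x, (‖ψ (τ h x)‖ₑ + ‖ψ x‖ₑ) := lintegral_mono fun x => enorm_sub_le
      _ = ENNReal.ofReal (2 * A) := by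
        rw [lintegral_add_right _ hψm.enorm, (hτ h).lintegral_comp hψm.enorm, hA',
          ← ENNReal.ofReal_add hA0 hA0, two_mul]
      _ ≤ _ := by
        refine ENNReal.ofReal_le_ofReal ?_
        have : 0 ≤ K * D * m * gauge h := mul_nonneg (by positivity) (h0 h)
        nlinarith

/-- The real line as a homogeneous group. -/
def lineGroup : HomogeneousGroup ℝ where
  op := fun x y => x + y
  dil := fun s x => s * x
  gauge := fun x => |x|
  dim := 1
  op_assoc := add_assoc
  op_zero := add_zero
  zero_op := zero_add
  op_neg := add_neg_cancel
  continuous_op := by fun_prop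
  measurePreserving_op := fun h => measurePreserving_add_left volume h
  continuous_dil := by fun_prop
  dil_neg := fun s x => by ring
  dil_op := fun s x y => by ring
  map_dil := fun s hs => by
    rw [Real.map_volume_mul_left hs.ne', pow_one, abs_of_pos (inv_pos.2 hs)]
  continuous_gauge := continuous_abs
  gauge_neg := abs_neg
  gauge_nonneg := abs_nonneg
  gauge_dil := fun s hs x => by rw [abs_mul, abs_of_pos hs]
  modulus := fun ψ hψ hψc => by
    refine exists_lintegral_sub_le (τ := fun h x => -h + x)
      (fun h => measurePreserving_add_left volume (-h)) abs_nonneg (fun r₀ => ?_) hψ hψc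
    refine ⟨r₀ + 1, 1, by linarith, zero_le_one, fun h hh => ⟨fun x hx => ?_, fun x _ => ?_⟩⟩
    · have := norm_add_le (-h + x) h
      rw [neg_add_cancel_comm] at this
      rw [Real.norm_eq_abs h] at this
      linarith
    · simp

variable {n : ℕ}

/-- The Euclidean norm on `ℂⁿ`. -/
def znorm (w : Fin n → ℂ) : ℝ := ‖(WithLp.toLp 2 w : EuclideanSpace ℂ (Fin n))‖

/-- The symplectic form `Im (w · conj z)`. -/
def form (w z : Fin n → ℂ) : ℝ := (∑ j, w j * star (z j)).im

lemma znorm_nonneg (w : Fin n → ℂ) : 0 ≤ znorm w := norm_nonneg _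

lemma znorm_sq (w : Fin n → ℂ) : znorm w ^ 2 = ∑ j, ‖w j‖ ^ 2 := by
  rw [znorm, EuclideanSpace.norm_sq_eq]

lemma znorm_add_le (w z : Fin n → ℂ) : znorm (w + z) ≤ znorm w + znorm z := by
  rw [znorm, WithLp.toLp_add]; exact norm_add_le _ _

lemma znorm_neg (w : Fin n → ℂ) : znorm (-w) = znorm w := by
  rw [znorm, WithLp.toLp_neg, norm_neg]; rfl

lemma znorm_smul (c : ℝ) (w : Fin n → ℂ) : znorm ((c : ℂ) • w) = |c| * znorm w := by
  rw [znorm, WithLp.toLp_smul, norm_smul, Complex.norm_real]; rfl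

lemma norm_le_znorm (w : Fin n → ℂ) : ‖w‖ ≤ znorm w :=
  (pi_norm_le_iff_of_nonneg (znorm_nonneg w)).2 fun j =>
    PiLp.norm_apply_le (WithLp.toLp 2 w : EuclideanSpace ℂ (Fin n)) j

lemma continuous_znorm : Continuous (znorm : (Fin n → ℂ) → ℝ) :=
  (PiLp.continuous_toLp 2 _).norm

lemma znorm_le (w : Fin n → ℂ) : znorm w ≤ √n * ‖w‖ := by
  refine le_of_sq_le_sq ?_ (by positivity)
  rw [znorm_sq, mul_pow, Real.sq_sqrt (Nat.cast_nonneg _)]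
  calc _ ≤ ∑ _j : Fin n, ‖w‖ ^ 2 := Finset.sum_le_sum fun j _ => by
        gcongr; exact norm_le_pi_norm w j
    _ = _ := by simp

lemma abs_form_le (w z : Fin n → ℂ) : |form w z| ≤ znorm w * znorm z := by
  refine (Complex.abs_im_le_norm _).trans ?_
  have := norm_inner_le_norm (𝕜 := ℂ) (WithLp.toLp 2 z : EuclideanSpace ℂ (Fin n)) (WithLp.toLp 2 w)
  rw [mul_comm, znorm, znorm]
  refine le_trans (le_of_eq ?_) this
  simp [PiLp.inner_apply]

lemma form_add_left (w w' z : Fin n → ℂ) : form (w + w') z = form w z + form w' z := by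
  simp [form, add_mul, Finset.sum_add_distrib]

lemma form_add_right (w z z' : Fin n → ℂ) : form w (z + z') = form w z + form w z' := by
  simp only [form, Pi.add_apply, star_add, mul_add, Finset.sum_add_distrib, Complex.add_im]

lemma form_neg_left (w z : Fin n → ℂ) : form (-w) z = -form w z := by
  simp [form]

lemma form_neg_right (w z : Fin n → ℂ) : form w (-z) = -form w z := by
  simp [form]

lemma form_self (w : Fin n → ℂ) : form w w = 0 := by
  simp only [form, Complex.im_sum, ← starRingEnd_apply]
  simp [Complex.mul_conj]

lemma form_zero_left (z : Fin n → ℂ) : form 0 z = 0 := by simp [form]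

lemma form_zero_right (z : Fin n → ℂ) : form z 0 = 0 := by simp [form]

lemma form_smul (c : ℝ) (w z : Fin n → ℂ) :
    form ((c : ℂ) • w) ((c : ℂ) • z) = c ^ 2 * form w z := by
  have : ∀ j, (c : ℂ) * w j * star ((c : ℂ) * z j) = ((c ^ 2 : ℝ) : ℂ) * (w j * star (z j)) := by
    intro j
    simp only [← starRingEnd_apply, map_mul, Complex.conj_ofReal]
    push_cast; ring
  simp only [form, Pi.smul_apply, smul_eq_mul, this, ← Finset.mul_sum,
    Complex.im_ofReal_mul]

lemma contDiff_form : ContDiff ℝ ∞ fun p : (Fin n → ℂ) × (Fin n → ℂ) => form p.1 p.2 := by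
  unfold form
  refine Complex.imCLM.contDiff.comp (ContDiff.sum fun j _ => ContDiff.mul (by fun_prop) ?_)
  exact Complex.conjCLE.contDiff.comp (by fun_prop)

lemma hmul_fst (g h : Heis n) : (hmul g h).1 = g.1 + h.1 := rfl

lemma hmul_snd (g h : Heis n) : (hmul g h).2 = g.2 + h.2 + (1 / 2) * form g.1 h.1 := rfl

lemma hinv_eq_neg (g : Heis n) : hinv g = -g := rfl

lemma contDiff_hmul : ContDiff ℝ ∞ fun p : Heis n × Heis n => hmul p.1 p.2 := by
  refine ContDiff.prodMk (by fun_prop) ?_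
  refine ContDiff.add (by fun_prop) (contDiff_const.mul ?_)
  exact contDiff_form.comp (f := fun p : Heis n × Heis n => (p.1.1, p.2.1)) (by fun_prop)

lemma continuous_form : Continuous fun p : (Fin n → ℂ) × (Fin n → ℂ) => form p.1 p.2 :=
  contDiff_form.continuous

/-- A left translation is a shear: a translation in `z` combined with a translation in `t` whose
length depends on `z` alone. -/
lemma measurePreserving_hmul_left (h : Heis n) : MeasurePreserving (hmul h) := by
  refine (measurePreserving_add_left (volume : Measure (Fin n → ℂ)) h.1).skew_product
    (g := fun z t => h.2 + t + (1 / 2) * form h.1 z) ?_ (Eventually.of_forall fun z => ?_)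
  · refine Continuous.measurable (Continuous.add (by fun_prop) (continuous_const.mul ?_))
    exact continuous_form.comp (by fun_prop : Continuous fun p : (Fin n → ℂ) × ℝ => (h.1, p.1))
  · have : (fun t => h.2 + t + (1 / 2) * form h.1 z) =
        fun t => (h.2 + (1 / 2) * form h.1 z) + t := by funext t; ring
    rw [this]
    exact (measurePreserving_add_left volume _).map_eq

lemma measurePreserving_hmul_right (h : Heis n) : MeasurePreserving (fun g => hmul g h) := by
  refine (measurePreserving_add_right (volume : Measure (Fin n → ℂ)) h.1).skew_product
    (g := fun z t => t + h.2 + (1 / 2) * form z h.1) ?_ (Eventually.of_forall fun z => ?_)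
  · refine Continuous.measurable (Continuous.add (by fun_prop) (continuous_const.mul ?_))
    exact continuous_form.comp (by fun_prop : Continuous fun p : (Fin n → ℂ) × ℝ => (p.1, h.1))
  · have : (fun t => t + h.2 + (1 / 2) * form z h.1) =
        fun t => (h.2 + (1 / 2) * form z h.1) + t := by funext t; ring
    rw [this]
    exact (measurePreserving_add_left volume _).map_eq

lemma hmul_assoc (x y z : Heis n) : hmul (hmul x y) z = hmul x (hmul y z) := by
  refine Prod.ext (add_assoc _ _ _) ?_
  simp only [hmul_snd, hmul_fst, form_add_left, form_add_right]
  ring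

lemma koranyi_pow_four (g : Heis n) : koranyi g ^ 4 = znorm g.1 ^ 4 + g.2 ^ 2 := by
  rw [koranyi, ← Real.rpow_natCast, ← Real.rpow_mul (by positivity), ← znorm_sq]
  norm_num
  ring

lemma koranyi_nonneg (g : Heis n) : 0 ≤ koranyi g := Real.rpow_nonneg (by positivity) _

lemma koranyi_lt_iff {g : Heis n} {r : ℝ} (hr : 0 ≤ r) :
    koranyi g < r ↔ znorm g.1 ^ 4 + g.2 ^ 2 < r ^ 4 := by
  rw [← koranyi_pow_four]
  exact (pow_lt_pow_iff_left₀ (koranyi_nonneg g) hr (by norm_num)).symm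

lemma znorm_le_koranyi (g : Heis n) : znorm g.1 ≤ koranyi g := by
  refine le_of_pow_le_pow_left₀ (n := 4) (by norm_num) (koranyi_nonneg g) ?_
  rw [koranyi_pow_four]
  nlinarith [sq_nonneg g.2]

lemma abs_snd_le_koranyi_sq (g : Heis n) : |g.2| ≤ koranyi g ^ 2 := by
  refine abs_le_of_sq_le_sq ?_ (by positivity)
  have := koranyi_pow_four g
  have h : 0 ≤ znorm g.1 ^ 4 := by positivity
  nlinarith

lemma koranyi_dil {s : ℝ} (hs : 0 < s) (g : Heis n) : koranyi (dil s g) = s * koranyi g := by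
  refine (pow_left_inj₀ (koranyi_nonneg _) (mul_nonneg hs.le (koranyi_nonneg _))
    (by norm_num : 4 ≠ 0)).1 ?_
  rw [mul_pow, koranyi_pow_four, koranyi_pow_four]
  simp only [dil, znorm_smul, abs_of_pos hs]
  ring

lemma koranyi_neg (g : Heis n) : koranyi (-g) = koranyi g := by
  simp [koranyi]

lemma continuous_koranyi : Continuous (koranyi : Heis n → ℝ) := by
  unfold koranyi
  exact Continuous.rpow_const (by fun_prop) fun _ => Or.inr (by norm_num)

instance isAddHaarMeasure_volume_heis : (volume : Measure (Heis n)).IsAddHaarMeasure :=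
  Measure.prod.instIsAddHaarMeasure _ _

/-- The Heisenberg group as a homogeneous group. -/
def heisGroup (n : ℕ) : HomogeneousGroup (Heis n) where
  op := hmul
  dil := dil
  gauge := koranyi
  dim := 2 * n + 2
  op_assoc := hmul_assoc
  op_zero := fun x => Prod.ext (add_zero _) (by simp [hmul_snd, form_zero_right])
  zero_op := fun x => Prod.ext (zero_add _) (by simp [hmul_snd, form_zero_left])
  op_neg := fun x => Prod.ext (add_neg_cancel _) (by simp [hmul_snd, form_neg_right, form_self])
  continuous_op := contDiff_hmul.continuous
  measurePreserving_op := measurePreserving_hmul_left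
  continuous_dil := by unfold dil; fun_prop
  dil_neg := fun s x => Prod.ext (smul_neg _ _) (by simp [dil])
  dil_op := fun s x y => by
    refine Prod.ext (smul_add _ _ _) ?_
    simp only [hmul_snd, dil, form_smul]
    ring
  map_dil := fun s hs => by
    have e : (dil s : Heis n → Heis n) = Prod.map (fun z => s • z) (fun t => s ^ 2 • t) := by
      funext g
      refine Prod.ext ?_ (by simp [dil])
      funext j
      simp [dil]
    have hs2 : 0 < s ^ 2 := by positivity
    rw [e, Measure.volume_eq_prod, ← Measure.map_prod_map _ _ (by fun_prop) (by fun_prop),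
      Measure.map_addHaar_smul _ hs.ne', Measure.map_addHaar_smul _ hs2.ne',
      Measure.prod_smul_left, Measure.prod_smul_right, smul_smul,
      ← ENNReal.ofReal_mul (abs_nonneg _)]
    congr 2
    rw [abs_of_pos (by positivity), abs_of_pos (by positivity), ← mul_inv, Module.finrank_pi_fintype]
    simp only [Complex.finrank_real_complex, Finset.sum_const, Finset.card_univ, Fintype.card_fin,
      smul_eq_mul, Module.finrank_self, pow_one]
    rw [← pow_add, mul_comm n 2]
  continuous_gauge := continuous_koranyi
  gauge_neg := koranyi_neg
  gauge_nonneg := koranyi_nonneg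
  gauge_dil := fun s hs x => koranyi_dil hs x
  modulus := fun ψ hψ hψc => by
    refine exists_lintegral_sub_le (τ := fun h x => hmul (-h) x)
      (fun h => measurePreserving_hmul_left (-h)) koranyi_nonneg (fun r₀ => ?_) hψ hψc
    have hz : ∀ h : Heis n, ‖h.1‖ ≤ koranyi h := fun h =>
      (norm_le_znorm _).trans (znorm_le_koranyi h)
    have hform : ∀ h x : Heis n, |form h.1 x.1| ≤ koranyi h * (√n * ‖x‖) := fun h x =>
      (abs_form_le _ _).trans (mul_le_mul (znorm_le_koranyi h)
        ((znorm_le _).trans (mul_le_mul_of_nonneg_left (norm_fst_le x) (by positivity)))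
        (znorm_nonneg _) (koranyi_nonneg h))
    have ht : ∀ h : Heis n, koranyi h ≤ 1 → |h.2| ≤ koranyi h := fun h hh =>
      (abs_snd_le_koranyi_sq h).trans (by nlinarith [koranyi_nonneg h])
    set r := max r₀ 0
    -- The first constant bounds `h · y` for `‖y‖ ≤ r` and gauge of `h` at most 1. The second bounds
    -- the displacement relative to the gauge: `|h.2| ≤ gauge² ≤ gauge`, and the symplectic form is
    -- at most `gauge · √n · ‖x‖`.
    refine ⟨r + 1 + √n * r, 1 + √n * (r + 1 + √n * r), ?_, by positivity, fun h hh =>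
      ⟨fun x hx => ?_, fun x hx => ?_⟩⟩
    · have := le_max_left r₀ 0
      have : 0 ≤ √n * r := by positivity
      linarith
    · set y := hmul (-h) x with hy
      have hxy : x = hmul h y := by
        rw [hy, ← hmul_assoc]
        refine Prod.ext ?_ ?_ <;> simp [hmul_snd, hmul_fst, form_neg_right, form_self, form_zero_left]
      have hyr : ‖y‖ ≤ r := hx.trans (le_max_left _ _)
      have h0 : 0 ≤ √n * r := by positivity
      have hf := (hform h y).trans (mul_le_mul hh
        (mul_le_mul_of_nonneg_left hyr (Real.sqrt_nonneg _)) (by positivity) zero_le_one)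
      rw [hxy, Prod.norm_def, hmul_fst, hmul_snd]
      refine max_le ?_ ?_
      · refine (norm_add_le _ _).trans ?_
        have := (norm_fst_le y).trans hyr
        linarith [hz h]
      · rw [Real.norm_eq_abs]
        have h1 : |y.2| ≤ r := (norm_snd_le y).trans hyr
        have h2 := (ht h hh).trans hh
        rw [abs_le] at *
        constructor <;> linarith [hf.1, hf.2, h1.1, h1.2, h2.1, h2.2]
    · have hf := hform h x
      have hf' : koranyi h * (√n * ‖x‖) ≤ koranyi h * (√n * (r + 1 + √n * r)) := by
        have := koranyi_nonneg h
        gcongr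
      have h0 : 0 ≤ koranyi h * (√n * (r + 1 + √n * r)) :=
        mul_nonneg (koranyi_nonneg h) (by positivity)
      rw [Prod.norm_def]
      refine max_le ?_ ?_
      · rw [Prod.fst_sub, hmul_fst, add_sub_cancel_right, Prod.fst_neg, norm_neg]
        linarith [hz h]
      · rw [Prod.snd_sub, hmul_snd, Prod.fst_neg, Prod.snd_neg, form_neg_left, Real.norm_eq_abs]
        have h2 := ht h hh
        rw [abs_le] at *
        constructor <;> linarith [hf.1, hf.2, h2.1, h2.2]

end FlagHeisenberg

end

/-! ### Right actions, the regular representation and convolution. -/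

noncomputable section

namespace FlagHeisenberg

/-- A continuous measure preserving right action of a homogeneous group. -/
structure RightAction {G : Type*} [NormedAddCommGroup G] [NormedSpace ℝ G] [MeasureSpace G]
    (𝔾 : HomogeneousGroup G) (X : Type*) [TopologicalSpace X] [MeasureSpace X] where
  act : X → G → X
  act_op : ∀ g h h', act (act g h) h' = act g (𝔾.op h h')
  act_zero : ∀ g, act g 0 = g
  continuous_act : Continuous fun p : X × G => act p.1 p.2
  measurePreserving_act : ∀ h, MeasurePreserving (fun g => act g h)

namespace RightAction

variable {G : Type*} [NormedAddCommGroup G] [NormedSpace ℝ G] [MeasureSpace G] [BorelSpace G]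
  [SecondCountableTopology G] [SFinite (volume : Measure G)] {𝔾 : HomogeneousGroup G}
  {X : Type*} [TopologicalSpace X] [MeasureSpace X] [BorelSpace X] [R1Space X]
  [SecondCountableTopologyEither X ℂ] [SecondCountableTopology X]
  [SigmaFinite (volume : Measure X)] [IsLocallyFiniteMeasure (volume : Measure X)] [(volume : Measure X).Regular]
  (α : RightAction 𝔾 X)

/-- The convolution `∫ κ(h) f(g h) dh`. -/
def aconv (κ : G → ℂ) (f : X → ℂ) (g : X) : ℂ := ∫ h, κ h * f (α.act g h)

/-- The regular representation on `L²`. -/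
def rep : UnitaryRep 𝔾 (Lp ℂ 2 (volume : Measure X)) where
  U := fun h => Lp.compMeasurePreservingₗᵢ ℂ (fun g => α.act g h) (α.measurePreserving_act h)
  op := fun h h' x => by
    have h1 := Lp.compMeasurePreserving_comp_apply x (α.measurePreserving_act h')
      (α.measurePreserving_act h)
    refine h1.symm.trans ?_
    have h2 : (fun g => α.act g h') ∘ (fun g => α.act g h) = fun g => α.act g (𝔾.op h h') :=
      funext fun g => α.act_op g h h'
    change Lp.compMeasurePreserving _ _ x = Lp.compMeasurePreserving _ _ x
    congr 2
  zero := fun x => by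
    have h2 : (fun g => α.act g 0) = id := funext fun g => α.act_zero g
    change Lp.compMeasurePreserving _ _ x = x
    have h3 := Lp.compMeasurePreserving_id_apply x
    refine Eq.trans ?_ h3
    congr 2
  cont := fun x => by
    have hc : Continuous fun p : G × X => α.act p.2 p.1 :=
      α.continuous_act.comp continuous_swap
    let F : C(G, C(X, X)) := ContinuousMap.curry ⟨_, hc⟩
    have hF : ∀ h, MeasurePreserving (F h) volume volume := α.measurePreserving_act
    exact Continuous.compMeasurePreservingLp (continuous_const (y := x)) F.continuous hF
      (by norm_num)

/-- The map `(h, g) ↦ (h, gh)` preserves the product measure. This makes `f(gh)` measurable in both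
variables when `f` is only almost everywhere strongly measurable. -/
lemma quasiMeasurePreserving_act :
    Measure.QuasiMeasurePreserving (fun p : G × X => α.act p.2 p.1) (volume.prod volume) volume := by
  have h1 : MeasurePreserving (fun p : G × X => (p.1, α.act p.2 p.1)) (volume.prod volume)
      (volume.prod volume) :=
    (MeasurePreserving.id (volume : Measure G)).skew_product (g := fun h g => α.act g h)
      (α.continuous_act.comp continuous_swap).measurable
      (Eventually.of_forall fun h => (α.measurePreserving_act h).map_eq)
  exact Measure.quasiMeasurePreserving_snd.comp h1.quasiMeasurePreserving

lemma aestronglyMeasurable_prod {κ : G → ℂ} (hκ : AEStronglyMeasurable κ) {f : X → ℂ}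
    (hf : AEStronglyMeasurable f) :
    AEStronglyMeasurable (fun p : G × X => κ p.1 * f (α.act p.2 p.1)) (volume.prod volume) :=
  hκ.comp_fst.mul (hf.comp_quasiMeasurePreserving α.quasiMeasurePreserving_act)

lemma aestronglyMeasurable_aconv {κ : G → ℂ} (hκ : AEStronglyMeasurable κ) {f : X → ℂ}
    (hf : AEStronglyMeasurable f) : AEStronglyMeasurable (α.aconv κ f) :=
  (α.aestronglyMeasurable_prod hκ hf).prod_swap.integral_prod_right'

/-- Young's inequality in `L¹`. -/
lemma lintegral_enorm_aconv_le {κ : G → ℂ} (hκ : AEStronglyMeasurable κ) {f : X → ℂ}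
    (hf : AEStronglyMeasurable f) :
    ∫⁻ g, ‖α.aconv κ f g‖ₑ ≤ (∫⁻ h, ‖κ h‖ₑ) * ∫⁻ g, ‖f g‖ₑ := by
  calc _ ≤ ∫⁻ g, ∫⁻ h, ‖κ h * f (α.act g h)‖ₑ :=
        lintegral_mono fun g => enorm_integral_le_lintegral_enorm _
    _ = ∫⁻ h, ∫⁻ g, ‖κ h * f (α.act g h)‖ₑ :=
        lintegral_lintegral_swap (α.aestronglyMeasurable_prod hκ hf).prod_swap.enorm
    _ = ∫⁻ h, ‖κ h‖ₑ * ∫⁻ g, ‖f g‖ₑ := by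
        refine lintegral_congr fun h => ?_
        have h1 := (α.measurePreserving_act h)
        simp only [enorm_mul]
        rw [lintegral_const_mul' _ _ enorm_ne_top]
        congr 1
        have h2 : AEMeasurable (fun g => ‖f g‖ₑ) (Measure.map (fun g => α.act g h) volume) := by
          rw [h1.map_eq]; exact hf.enorm
        rw [← lintegral_map' h2 h1.measurable.aemeasurable, h1.map_eq]
    _ = _ := lintegral_mul_const'' _ hκ.enorm

lemma lintegral_enorm_le_rpow_mul {f : X → ℂ} (hf : AEStronglyMeasurable f) (s : Set X) :
    ∫⁻ g in s, ‖f g‖ₑ ≤ volume s ^ (1 / 2 : ℝ) * eLpNorm f 2 volume := by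
  have h := eLpNorm_le_eLpNorm_mul_rpow_measure_univ (μ := volume.restrict s) (p := 1) (q := 2)
    (by norm_num) hf.restrict
  rw [eLpNorm_one_eq_lintegral_enorm, Measure.restrict_apply_univ] at h
  refine h.trans ?_
  rw [mul_comm]
  have e : (1 / (1 : ℝ≥0∞).toReal - 1 / (2 : ℝ≥0∞).toReal) = 1 / 2 := by norm_num
  rw [e]
  exact mul_le_mul_right (eLpNorm_restrict_le _ _ _ _) _

lemma integrable_prod_restrict {κ : G → ℂ} (hκ : Integrable κ) {f : X → ℂ} (hf : MemLp f 2)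
    {s : Set X} (hs : volume s < ⊤) :
    Integrable (fun p : G × X => κ p.1 * f (α.act p.2 p.1))
      (volume.prod (volume.restrict s)) := by
  have hm : AEStronglyMeasurable (fun p : G × X => κ p.1 * f (α.act p.2 p.1))
      (volume.prod (volume.restrict s)) := by
    refine (α.aestronglyMeasurable_prod hκ.1 hf.1).mono_ac ?_
    exact Measure.AbsolutelyContinuous.prod Measure.AbsolutelyContinuous.rfl
      Measure.restrict_le_self.absolutelyContinuous
  refine ⟨hm, ?_⟩
  rw [hasFiniteIntegral_iff_enorm, lintegral_prod _ hm.enorm]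
  calc _ ≤ ∫⁻ h, ‖κ h‖ₑ * (volume s ^ (1 / 2 : ℝ) * eLpNorm f 2 volume) := by
        refine lintegral_mono fun h => ?_
        simp only [enorm_mul]
        rw [lintegral_const_mul' _ _ enorm_ne_top]
        have h1 := hf.comp_measurePreserving (α.measurePreserving_act h)
        refine mul_le_mul_right ((lintegral_enorm_le_rpow_mul h1.1 s).trans ?_) _
        rw [eLpNorm_comp_measurePreserving hf.1 (α.measurePreserving_act h)]
    _ = (∫⁻ h, ‖κ h‖ₑ) * (volume s ^ (1 / 2 : ℝ) * eLpNorm f 2 volume) :=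
        lintegral_mul_const'' _ hκ.1.enorm
    _ < ⊤ := ENNReal.mul_lt_top hκ.2
        (ENNReal.mul_lt_top (ENNReal.rpow_lt_top_of_nonneg (by norm_num) hs.ne) hf.2)

/-- The operators of the regular representation are given by convolution. -/
theorem opr_toLp_ae_eq {κ : G → ℂ} (hκ : Integrable κ) {f : X → ℂ} (hf : MemLp f 2) :
    α.rep.opr κ (hf.toLp f) =ᵐ[volume] α.aconv κ f := by
  -- A Bochner integral in `L²` has no pointwise values, so both sides are tested against indicators
  -- of sets of finite measure, and Fubini's theorem compares the results.
  refine ae_eq_of_forall_setIntegral_eq_of_sigmaFinite (fun s hs hμ => ?_) (fun s hs hμ => ?_)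
    fun s hs hμ => ?_
  · have := Fact.mk hμ
    exact ((Lp.memLp (α.rep.opr κ (hf.toLp f))).restrict s).integrable (by norm_num)
  · exact (α.integrable_prod_restrict hκ hf hμ).integral_prod_right
  · rw [← L2.inner_indicatorConstLp_one (𝕜 := ℂ) hs hμ.ne, α.rep.opr_apply hκ]
    refine (integral_inner (𝕜 := ℂ) (α.rep.integrable_smul hκ (hf.toLp f))
      (indicatorConstLp 2 hs hμ.ne 1)).symm.trans ?_
    simp only [aconv]
    rw [← integral_integral_swap (f := fun h g => κ h * f (α.act g h))
      (α.integrable_prod_restrict hκ hf hμ)]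
    refine integral_congr_ae (Eventually.of_forall fun h => ?_)
    simp only [inner_smul_right]
    rw [L2.inner_indicatorConstLp_one (𝕜 := ℂ) hs hμ.ne, integral_const_mul]
    congr 1
    refine integral_congr_ae (ae_restrict_of_ae ?_)
    exact ((hf.comp_measurePreserving (α.measurePreserving_act h)).coeFn_toLp)

lemma memLp_aconv {κ : G → ℂ} (hκ : Integrable κ) {f : X → ℂ} (hf : MemLp f 2) :
    MemLp (α.aconv κ f) 2 :=
  (memLp_congr_ae (α.opr_toLp_ae_eq hκ hf)).1 (Lp.memLp _)

lemma toLp_aconv {κ : G → ℂ} (hκ : Integrable κ) {f : X → ℂ} (hf : MemLp f 2) :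
    (α.memLp_aconv hκ hf).toLp (α.aconv κ f) = α.rep.opr κ (hf.toLp f) := by
  refine Lp.ext ((MemLp.coeFn_toLp _).trans (α.opr_toLp_ae_eq hκ hf).symm)

lemma eLpNorm_aconv_le_of_norm_opr_le {κ : G → ℂ} (hκ : Integrable κ) {f : X → ℂ} (hf : MemLp f 2)
    {C : ℝ} (hC : ‖α.rep.opr κ‖ ≤ C) :
    eLpNorm (α.aconv κ f) 2 volume ≤ ENNReal.ofReal C * eLpNorm f 2 volume := by
  have h1 := (α.rep.opr κ).le_of_opNorm_le hC (hf.toLp f)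
  rw [← α.toLp_aconv hκ hf, Lp.norm_toLp, Lp.norm_toLp] at h1
  have hC0 : 0 ≤ C := (norm_nonneg _).trans hC
  rw [← ENNReal.ofReal_toReal (α.memLp_aconv hκ hf).2.ne, ← ENNReal.ofReal_toReal hf.2.ne,
    ← ENNReal.ofReal_mul hC0]
  exact ENNReal.ofReal_le_ofReal h1

end RightAction

/-- Right translations of the Heisenberg group. -/
def heisAction (n : ℕ) : RightAction (heisGroup n) (Heis n) where
  act := hmul
  act_op := hmul_assoc
  act_zero := (heisGroup n).op_zero
  continuous_act := contDiff_hmul.continuous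
  measurePreserving_act := measurePreserving_hmul_right

lemma hmul_central {n : ℕ} (g : Heis n) (v : ℝ) : hmul g (central v) = (g.1, g.2 + v) :=
  Prod.ext (add_zero _) (by simp [hmul_snd, central, form_zero_right])

/-- Translations by central elements. -/
def centralAction (n : ℕ) : RightAction lineGroup (Heis n) where
  act := fun g v => hmul g (central v)
  act_op := fun g v w => by
    simp only [hmul_central, lineGroup, add_assoc]
  act_zero := fun g => by rw [hmul_central, add_zero]
  continuous_act := by simp only [hmul_central]; fun_prop
  measurePreserving_act := fun v => measurePreserving_hmul_right (central v)

lemma hmul_hinv_self {n : ℕ} (g : Heis n) : hmul (hinv g) g = 0 := by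
  have := (heisGroup n).op_neg (-g)
  rwa [neg_neg] at this

lemma measurableEmbedding_hmul_left {n : ℕ} (h : Heis n) : MeasurableEmbedding (hmul h) :=
  (MeasurableEquiv.mk ⟨hmul h, hmul (-h), (heisGroup n).neg_op_cancel h,
    (heisGroup n).op_neg_cancel h⟩ ((heisGroup n).measurable_op h)
      ((heisGroup n).measurable_op (-h))).measurableEmbedding

lemma hinv_hmul {n : ℕ} (g h : Heis n) : hinv (hmul g h) = hmul (hinv h) (hinv g) := by
  refine Prod.ext ?_ ?_
  · simp [hinv_eq_neg, hmul_fst, add_comm]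
  · simp only [hinv_eq_neg, hmul_snd, Prod.snd_neg, Prod.fst_neg, form_neg_left, form_neg_right]
    have h1 : form g.1 h.1 = -form h.1 g.1 := by
      have := form_self (g.1 + h.1)
      rw [form_add_left, form_add_right, form_add_right, form_self, form_self] at this
      linarith
    rw [h1]; ring

/-- Substitute `g = g' h`: the argument of `k` becomes `h⁻¹`. Thus convolution by `k` on the right
averages right translations against the reflected kernel. -/
lemma conv₁_eq_aconv {n : ℕ} (f k : Heis n → ℂ) :
    conv₁ f k = (heisAction n).aconv (fun h => k (-h)) f := by
  funext g'
  rw [conv₁, ← (measurePreserving_hmul_left g').integral_comp (measurableEmbedding_hmul_left g'),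
    RightAction.aconv]
  refine integral_congr_ae (Eventually.of_forall fun h => ?_)
  simp only [hinv_hmul, hmul_assoc, hmul_hinv_self]
  rw [mul_comm, (heisGroup n).op_zero |> fun h0 => show hmul (hinv h) 0 = hinv h from h0 _]
  rfl

lemma conv₂_eq_aconv {n : ℕ} (f : Heis n → ℂ) (c : ℝ → ℂ) :
    conv₂ f c = (centralAction n).aconv (fun v => c (-v)) f := by
  funext g'
  exact integral_congr_ae (Eventually.of_forall fun v => mul_comm _ _)

end FlagHeisenberg

end

/-! ### Bump functions and derivatives of translated dilates. -/

noncomputable section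

namespace FlagHeisenberg

/-- A smooth function with compact support in the open unit ball of the gauge. -/
structure IsBump {G : Type*} [NormedAddCommGroup G] [NormedSpace ℝ G] [MeasureSpace G]
    (𝔾 : HomogeneousGroup G) (ψ : G → ℂ) : Prop where
  contDiff : ContDiff ℝ ∞ ψ
  hasCompactSupport : HasCompactSupport ψ
  tsupport_subset : tsupport ψ ⊆ {x | 𝔾.gauge x < 1}

namespace IsBump

variable {G : Type*} [NormedAddCommGroup G] [NormedSpace ℝ G] [MeasureSpace G]
  {𝔾 : HomogeneousGroup G} {ψ : G → ℂ} (hψ : IsBump 𝔾 ψ)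

include hψ

lemma eq_zero (x : G) (hx : 1 ≤ 𝔾.gauge x) : ψ x = 0 := by
  by_contra h
  exact not_lt.2 hx (hψ.tsupport_subset (subset_tsupport _ h))

lemma continuous : Continuous ψ := hψ.contDiff.continuous

lemma exists_bound : ∃ M, ∀ x, ‖ψ x‖ ≤ M :=
  hψ.continuous.bounded_above_of_compact_support hψ.hasCompactSupport

lemma integrable [BorelSpace G] [IsFiniteMeasureOnCompacts (volume : Measure G)] :
    Integrable ψ := hψ.continuous.integrable_of_hasCompactSupport hψ.hasCompactSupport

lemma fderiv_apply {v : G → G} (hv : ContDiff ℝ ∞ v) : IsBump 𝔾 fun x => fderiv ℝ ψ x (v x) := by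
  have hs : tsupport (fun x => fderiv ℝ ψ x (v x)) ⊆ tsupport ψ := by
    refine closure_minimal (fun x hx => ?_) (isClosed_tsupport _)
    refine support_fderiv_subset ℝ (fun h => hx ?_)
    simp only [h, zero_apply]
  exact ⟨(hψ.contDiff.fderiv_right (m := ∞) (by simp)).clm_apply hv,
    hψ.hasCompactSupport.of_isClosed_subset (isClosed_tsupport _) hs, hs.trans hψ.tsupport_subset⟩

end IsBump

lemma IsBump.deriv {φ : ℝ → ℂ} (hφ : IsBump lineGroup φ) : IsBump lineGroup (deriv φ) :=
  hφ.fderiv_apply (v := fun _ => 1) contDiff_const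

variable {n : ℕ}

/-- The horizontal coordinate vectors. -/
def horVec : Fin n ⊕ Fin n → Fin n → ℂ
  | Sum.inl j => Pi.single j 1
  | Sum.inr j => Pi.single j Complex.I

/-- The right-invariant horizontal fields. -/
def rightField (i : Fin n ⊕ Fin n) (g : Heis n) : Heis n := (horVec i, (1 / 2) * form (horVec i) g.1)

lemma form_antisymm (w z : Fin n → ℂ) : form w z = -form z w := by
  have := form_self (w + z)
  rw [form_add_left, form_add_right, form_add_right, form_self, form_self] at this
  linarith

lemma horField_eq (i : Fin n ⊕ Fin n) (g : Heis n) :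
    horField i g = (horVec i, (1 / 2) * form g.1 (horVec i)) := by
  have h1 : ∀ j : Fin n, ∀ c : ℂ,
      form g.1 (Pi.single j c) = (g.1 j * star c).im := by
    intro j c
    rw [form, Finset.sum_eq_single j]
    · simp
    · intro b _ hb; simp [hb]
    · simp
  rcases i with j | j
  · rw [horField, horVec, h1]; simp
  · rw [horField, horVec, h1]
    simp [Complex.mul_im]

lemma contDiff_rightField (i : Fin n ⊕ Fin n) : ContDiff ℝ ∞ (rightField (n := n) i) := by
  unfold rightField
  refine contDiff_const.prodMk (contDiff_const.mul ?_)
  exact contDiff_form.comp (f := fun g : Heis n => (horVec i, g.1)) (by fun_prop)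

lemma contDiff_horField (i : Fin n ⊕ Fin n) : ContDiff ℝ ∞ (horField (n := n) i) := by
  have : horField (n := n) i = fun g => (horVec i, (1 / 2) * form g.1 (horVec i)) :=
    funext (horField_eq i)
  rw [this]
  refine contDiff_const.prodMk (contDiff_const.mul ?_)
  exact contDiff_form.comp (f := fun g : Heis n => (g.1, horVec i)) (by fun_prop)

/-- The derivative along a right-invariant horizontal field. -/
def horDeriv (i : Fin n ⊕ Fin n) (φ : Heis n → ℂ) (x : Heis n) : ℂ :=
  fderiv ℝ φ x (rightField i x)

/-- The derivative along the centre. -/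
def vertDeriv (φ : Heis n → ℂ) (x : Heis n) : ℂ := fderiv ℝ φ x (0, 1)

lemma IsBump.horDeriv {φ : Heis n → ℂ} (hφ : IsBump (heisGroup n) φ) (i : Fin n ⊕ Fin n) :
    IsBump (heisGroup n) (horDeriv i φ) := hφ.fderiv_apply (contDiff_rightField i)

lemma IsBump.vertDeriv {φ : Heis n → ℂ} (hφ : IsBump (heisGroup n) φ) :
    IsBump (heisGroup n) (vertDeriv φ) := hφ.fderiv_apply contDiff_const

/-- The translated dilate `g ↦ φ_s(g⁻¹ g')` of a function. -/
def transDilate (φ : Heis n → ℂ) (s : ℝ) (g' g : Heis n) : ℂ :=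
  (heisGroup n).dilate φ s (hmul (hinv g) g')

lemma contDiff_dil (s : ℝ) : ContDiff ℝ ∞ (dil s : Heis n → Heis n) := by
  unfold dil; fun_prop

/-- One directional derivative is read off along a straight line, which avoids the chain rule for
the group operations. -/
lemma fderiv_eq_of_line {E F : Type*} [NormedAddCommGroup E] [NormedSpace ℝ E]
    [NormedAddCommGroup F] [NormedSpace ℝ F] {φ : F → ℂ} {Ψ : E → ℂ} {g X : E} {x w : F} {c : ℂ}
    (hΨ : DifferentiableAt ℝ Ψ g) (hφ : DifferentiableAt ℝ φ x)
    (h : ∀ t : ℝ, Ψ (g + t • X) = c * φ (x + t • w)) : fderiv ℝ Ψ g X = c * fderiv ℝ φ x w := by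
  rw [← hΨ.lineDeriv_eq_fderiv, ← hφ.lineDeriv_eq_fderiv, lineDeriv, lineDeriv]
  simp only [h]
  have h2 := hφ.lineDifferentiableAt (v := w)
  exact deriv_const_mul _ h2

lemma isTest_transDilate {φ : Heis n → ℂ} (hφ : IsBump (heisGroup n) φ) {s : ℝ} (hs : 0 < s)
    (g' : Heis n) : IsTest (transDilate φ s g') := by
  constructor
  · refine contDiff_const.mul (hφ.contDiff.comp ((contDiff_dil s⁻¹).comp ?_))
    exact contDiff_hmul.comp (f := fun g : Heis n => (-g, g')) (by fun_prop)
  · have h1 : HasCompactSupport ((heisGroup n).dilate φ s) := by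
      refine HasCompactSupport.of_support_subset_isCompact
        (K := dil s '' tsupport φ) (hφ.hasCompactSupport.isCompact.image (contDiff_dil s).continuous)
        fun x hx => ⟨dil s⁻¹ x, subset_tsupport _ fun h => hx ?_, ?_⟩
      · change _ * φ (dil s⁻¹ x) = 0
        rw [h, mul_zero]
      · refine Prod.ext ?_ ?_
        · simp only [dil, smul_smul, ← Complex.ofReal_mul, mul_inv_cancel₀ hs.ne',
            Complex.ofReal_one, one_smul]
        · simp only [dil]; field_simp
    have h2 : Continuous fun x : Heis n => hmul g' (-x) :=
      contDiff_hmul.continuous.comp (f := fun x : Heis n => (g', -x)) (by fun_prop)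
    refine HasCompactSupport.of_support_subset_isCompact (h1.isCompact.image h2) fun g hg =>
      ⟨hmul (hinv g) g', subset_tsupport _ hg, ?_⟩
    have h3 := hinv_hmul (hinv g) g'
    simp only [hinv_eq_neg, neg_neg] at h3 ⊢
    rw [h3, ← hmul_assoc, show hmul g' (-g') = 0 from (heisGroup n).op_neg g']
    exact (heisGroup n).zero_op g

/-- The line through `g` along a left-invariant horizontal field is exactly `g · exp(tX)`. Inversion
puts `exp(-tX)` to the left of `g⁻¹ g'`, whence the right-invariant field, the minus sign, and the
factor `s⁻¹` from the dilation. -/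
lemma line_horizontal (i : Fin n ⊕ Fin n) {s : ℝ} (hs : 0 < s) (g' g : Heis n) (t : ℝ) :
    dil s⁻¹ (hmul (hinv (g + t • horField i g)) g') = dil s⁻¹ (hmul (hinv g) g') +
      t • ((-s⁻¹) • rightField i (dil s⁻¹ (hmul (hinv g) g'))) := by
  have e : ∀ (c : ℝ) (w : Fin n → ℂ), c • w = (c : ℂ) • w := fun c w => by
    funext j; simp
  have hsm : ∀ (c : ℝ) (w z : Fin n → ℂ), form ((c : ℂ) • w) z = c * form w z := fun c w z => by
    simp only [form, Pi.smul_apply, smul_eq_mul, mul_assoc, ← Finset.mul_sum,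
      Complex.im_ofReal_mul]
  have hsm' : ∀ (c : ℝ) (w z : Fin n → ℂ), form w ((c : ℂ) • z) = c * form w z := fun c w z => by
    rw [form_antisymm, hsm, form_antisymm w z]; ring
  rw [horField_eq]
  refine Prod.ext ?_ ?_
  · funext j
    simp only [dil, hmul_fst, hinv, Prod.fst_add, Prod.smul_fst, rightField, Pi.add_apply,
      Pi.smul_apply, Pi.neg_apply, smul_eq_mul, Complex.real_smul]
    push_cast
    ring
  · simp only [dil, hmul_fst, hmul_snd, hinv, Prod.fst_add, Prod.smul_fst, Prod.snd_add,
      Prod.smul_snd, rightField, smul_eq_mul, e, hsm, hsm', form_add_left, form_add_right,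
      form_neg_left, form_neg_right]
    rw [form_antisymm g.1 (horVec i)]
    field_simp
    ring

lemma line_vertical {s : ℝ} (g' g : Heis n) (t : ℝ) :
    dil s⁻¹ (hmul (hinv (g + t • ((0, 1) : Heis n))) g') = dil s⁻¹ (hmul (hinv g) g') +
      t • ((-(s⁻¹ ^ 2)) • ((0, 1) : Heis n)) := by
  refine Prod.ext ?_ ?_
  · simp [dil, hmul_fst, hinv]
  · simp only [dil, hmul_fst, hmul_snd, hinv, Prod.fst_add, Prod.smul_fst, Prod.snd_add,
      Prod.smul_snd, smul_eq_mul, smul_zero, add_zero]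
    ring

lemma fderiv_transDilate_horField {φ : Heis n → ℂ} (hφ : IsBump (heisGroup n) φ) {s : ℝ}
    (hs : 0 < s) (g' g : Heis n) (i : Fin n ⊕ Fin n) :
    fderiv ℝ (transDilate φ s g') g (horField i g) =
      -((s⁻¹ : ℝ) * transDilate (horDeriv i φ) s g' g) := by
  rw [fderiv_eq_of_line (φ := φ) (c := (((s ^ (heisGroup n).dim)⁻¹ : ℝ) : ℂ))
    (((isTest_transDilate hφ hs g').1.differentiable (by simp)) g)
    ((hφ.contDiff.differentiable (by simp)) (dil s⁻¹ (hmul (hinv g) g')))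
    (fun t => by rw [← line_horizontal i hs]; rfl)]
  rw [map_smul, transDilate, HomogeneousGroup.dilate, Complex.real_smul]
  simp only [horDeriv, Complex.ofReal_neg]
  change _ = -(_ * (_ * fderiv ℝ φ (dil s⁻¹ (hmul (hinv g) g'))
    (rightField i (dil s⁻¹ (hmul (hinv g) g')))))
  ring

lemma fderiv_transDilate_vert {φ : Heis n → ℂ} (hφ : IsBump (heisGroup n) φ) {s : ℝ}
    (hs : 0 < s) (g' g : Heis n) :
    fderiv ℝ (transDilate φ s g') g (0, 1) =
      -((s⁻¹ ^ 2 : ℝ) * transDilate (vertDeriv φ) s g' g) := by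
  rw [fderiv_eq_of_line (φ := φ) (c := (((s ^ (heisGroup n).dim)⁻¹ : ℝ) : ℂ))
    (((isTest_transDilate hφ hs g').1.differentiable (by simp)) g)
    ((hφ.contDiff.differentiable (by simp)) (dil s⁻¹ (hmul (hinv g) g')))
    (fun t => by rw [← line_vertical]; rfl)]
  rw [map_smul, transDilate, HomogeneousGroup.dilate, Complex.real_smul]
  simp only [vertDeriv, Complex.ofReal_neg]
  change _ = -(_ * (_ * fderiv ℝ φ (dil s⁻¹ (hmul (hinv g) g')) (0, 1)))
  ring

end FlagHeisenberg

end

/-! ### Integration by parts in the convolutions. -/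

noncomputable section

namespace FlagHeisenberg

variable {n : ℕ}

lemma measurable_hinv_hmul (g' : Heis n) : Measurable fun g : Heis n => hmul (hinv g) g' :=
  (contDiff_hmul.continuous.comp (f := fun g : Heis n => (-g, g')) (by fun_prop)).measurable

lemma IsTest.integrable_mul {Ψ : Heis n → ℂ} (hΨ : IsTest Ψ) {W : Heis n → ℂ} (hW : Integrable W) :
    Integrable fun g => W g * Ψ g := by
  obtain ⟨M, hM⟩ := hΨ.1.continuous.bounded_above_of_compact_support hΨ.2
  exact hW.mul_bdd hΨ.1.continuous.aestronglyMeasurable (Eventually.of_forall hM)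

lemma IsTest.fderiv_apply {Ψ : Heis n → ℂ} (hΨ : IsTest Ψ) {v : Heis n → Heis n}
    (hv : ContDiff ℝ ∞ v) : IsTest fun g => fderiv ℝ Ψ g (v g) := by
  refine ⟨(hΨ.1.fderiv_right (m := ∞) (by simp)).clm_apply hv, ?_⟩
  refine hΨ.2.of_isClosed_subset (isClosed_tsupport _)
    (closure_minimal (fun x hx => ?_) (isClosed_tsupport _))
  refine support_fderiv_subset ℝ (fun h => hx ?_)
  simp only [h, zero_apply]

/-- `f' = ∂_t f` in the sense of distributions. -/
def IsWeakVert (f f' : Heis n → ℂ) : Prop :=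
  ∀ Ψ : Heis n → ℂ, IsTest Ψ → ∫ g, f g * fderiv ℝ Ψ g (0, 1) = -∫ g, f' g * Ψ g

lemma IsVertDeriv.isWeakVert {A V : Heis n → HorVec n} (h : IsVertDeriv A V) (i : Fin n ⊕ Fin n) :
    IsWeakVert (fun g => A g i) (fun g => V g i) := fun Ψ hΨ => h Ψ hΨ i

/-- The coefficients of the horizontal fields do not depend on `t`, so these fields commute with
`∂_t`. -/
lemma fderiv_fderiv_comm {Ψ : Heis n → ℂ} (hΨ : ContDiff ℝ ∞ Ψ) (i : Fin n ⊕ Fin n) (g : Heis n) :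
    fderiv ℝ (fun g => fderiv ℝ Ψ g (horField i g)) g (0, 1) =
      fderiv ℝ (fun g => fderiv ℝ Ψ g (0, 1)) g (horField i g) := by
  have hF : DifferentiableAt ℝ (fderiv ℝ Ψ) g :=
    ((hΨ.fderiv_right (m := ∞) (by simp)).differentiable (by simp)) g
  have hv : DifferentiableAt ℝ (horField (n := n) i) g :=
    ((contDiff_horField i).differentiable (by simp)) g
  have h0 : fderiv ℝ (horField (n := n) i) g (0, 1) = 0 := by
    rw [← hv.lineDeriv_eq_fderiv, lineDeriv]
    simp [horField_eq]
  have hsymm : IsSymmSndFDerivAt ℝ Ψ g :=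
    (hΨ.contDiffAt).isSymmSndFDerivAt (by
      rw [minSmoothness_of_isRCLikeNormedField]
      exact WithTop.coe_le_coe.2 (le_top (a := (2 : ℕ∞))))
  rw [fderiv_clm_apply hF hv, fderiv_clm_apply hF (by fun_prop)]
  simp [h0, hsymm.eq]

/-- If `D = ∇₍₁₎ · A`, `V = ∇₍₂₎ A` and `a = ∇₍₁₎ · V` then `a = ∇₍₂₎ D`. -/
lemma isWeakVert_of_isHorDiv {A V : Heis n → HorVec n} {D a : Heis n → ℂ}
    (hA : ∀ i, Integrable fun g => A g i) (hV : ∀ i, Integrable fun g => V g i)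
    (hAV : IsVertDeriv A V) (hAD : IsHorDiv A D) (hVa : IsHorDiv V a) : IsWeakVert D a := by
  intro Ψ hΨ
  have hX : ∀ i, IsTest fun g => fderiv ℝ Ψ g (horField i g) := fun i =>
    hΨ.fderiv_apply (contDiff_horField i)
  have hT : IsTest fun g => fderiv ℝ Ψ g (0, 1) := hΨ.fderiv_apply contDiff_const
  have h1 := hAD _ hT
  have h2 := hVa _ hΨ
  rw [integral_finsetSum _ fun i _ => (hX i).integrable_mul (hV i)] at h2
  rw [integral_finsetSum _ fun i _ =>
    (hT.fderiv_apply (contDiff_horField i)).integrable_mul (hA i)] at h1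
  have h3 : ∀ i, ∫ g, A g i * fderiv ℝ (fun g => fderiv ℝ Ψ g (0, 1)) g (horField i g) =
      -∫ g, V g i * fderiv ℝ Ψ g (horField i g) := fun i => by
    rw [← hAV _ (hX i) i]
    exact integral_congr_ae (Eventually.of_forall fun g => by
      simp only [fderiv_fderiv_comm hΨ.1 i g])
  rw [Finset.sum_congr rfl fun i _ => h3 i, Finset.sum_neg_distrib, h2, neg_neg] at h1
  rw [h1, neg_neg]

section Kernels

variable {φ : Heis n → ℂ} (hφ : IsBump (heisGroup n) φ) {E : Set ℝ} (hE : MeasurableSet E)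
  {α β : ℝ} (hα : 0 < α) (hEs : E ⊆ Set.Ioc α β)

include hφ hE hα hEs in
/-- Integration by parts in the horizontal directions. -/
theorem conv₁_kerInt_eq_sum {V : Heis n → HorVec n} {a : Heis n → ℂ}
    (hV : ∀ i, Integrable fun g => V g i) (ha : Integrable a) (hVa : IsHorDiv V a) (g' : Heis n) :
    conv₁ a ((heisGroup n).kerInt φ 0 E) g' =
      ∑ i, conv₁ (fun g => V g i) ((heisGroup n).kerInt (horDeriv i φ) 1 E) g' := by
  have hm := measurable_hinv_hmul g'
  have hM := fun i => (hφ.horDeriv i).exists_bound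
  choose M hM using hM
  obtain ⟨M₀, hM₀⟩ := hφ.exists_bound
  simp only [conv₁]
  rw [HomogeneousGroup.integral_mul_kerInt _ hφ.continuous hE hM₀ 0 hα hEs ha hm,
    Finset.sum_congr rfl fun i _ => HomogeneousGroup.integral_mul_kerInt _
      (hφ.horDeriv i).continuous hE (hM i) 1 hα hEs (hV i) hm,
    ← integral_finsetSum _ fun i _ => HomogeneousGroup.integrableOn_integral_mul_dilate _
      (hφ.horDeriv i).continuous hE (hM i) 1 hα hEs (hV i) hm]
  refine setIntegral_congr_fun hE fun s hs => ?_
  have hs0 : 0 < s := hα.trans (hEs hs).1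
  have h1 := hVa _ (isTest_transDilate hφ hs0 g')
  simp only [fderiv_transDilate_horField hφ hs0] at h1
  have h2 : ∀ i, Integrable fun g => V g i *
      -(((s⁻¹ : ℝ) : ℂ) * transDilate (horDeriv i φ) s g' g) := fun i => by
    have := ((isTest_transDilate (hφ.horDeriv i) hs0 g').integrable_mul (hV i)).const_mul
      (-((s⁻¹ : ℝ) : ℂ))
    refine this.congr (Eventually.of_forall fun g => ?_)
    simp only; ring
  rw [integral_finsetSum _ fun i _ => h2 i] at h1
  change _ * ∫ g, a g * transDilate φ s g' g = ∑ i, _ * ∫ g, V g i *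
    transDilate (horDeriv i φ) s g' g
  rw [← neg_eq_iff_eq_neg.2 h1, ← Finset.sum_neg_distrib, Finset.mul_sum]
  refine Finset.sum_congr rfl fun i _ => ?_
  rw [← integral_neg, ← integral_const_mul, ← integral_const_mul]
  refine integral_congr_ae (Eventually.of_forall fun g => ?_)
  simp only [zero_add, pow_succ, pow_zero, one_mul, mul_inv]
  push_cast
  ring

lemma measurable_hinv_hmul_central (g' : Heis n) :
    Measurable fun p : Heis n × ℝ => hmul (hinv p.1) (hmul g' (central p.2)) := by
  refine (contDiff_hmul.continuous.comp
    (f := fun p : Heis n × ℝ => (-p.1, hmul g' (central p.2))) ?_).measurable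
  simp only [hmul_central]
  fun_prop

lemma integrable_prod_conv {f : Heis n → ℂ} (hf : Integrable f) {κ : Heis n → ℂ}
    (hκ : Measurable κ) {M : ℝ} (hM : ∀ x, ‖κ x‖ ≤ M) {c : ℝ → ℂ} (hc : Integrable c)
    (g' : Heis n) :
    Integrable (fun p : Heis n × ℝ => (f p.1 * c (-p.2)) *
      κ (hmul (hinv p.1) (hmul g' (central p.2)))) (volume.prod volume) :=
  (hf.mul_prod hc.comp_neg).mul_bdd (hκ.comp (measurable_hinv_hmul_central g')).aestronglyMeasurable
    (Eventually.of_forall fun _ => hM _)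

/-- The composition of the two convolutions as an integral over the product. -/
lemma conv₂_conv₁ {f : Heis n → ℂ} (hf : Integrable f) {κ : Heis n → ℂ} (hκ : Measurable κ) {M : ℝ}
    (hM : ∀ x, ‖κ x‖ ≤ M) {c : ℝ → ℂ} (hc : Integrable c) (g' : Heis n) :
    conv₂ (conv₁ f κ) c g' = ∫ p : Heis n × ℝ, (f p.1 * c (-p.2)) *
      κ (hmul (hinv p.1) (hmul g' (central p.2))) := by
  rw [Measure.volume_eq_prod, integral_prod_symm _ (integrable_prod_conv hf hκ hM hc g')]
  simp only [conv₂, conv₁]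
  refine integral_congr_ae (Eventually.of_forall fun v => ?_)
  simp only [← integral_mul_const]
  refine integral_congr_ae (Eventually.of_forall fun g => ?_)
  simp only
  ring

/-- Associativity: both sides are iterated integrals of one integrable function on the product. -/
lemma conv₁_conv₂ {f : Heis n → ℂ} (hf : Integrable f) {κ : Heis n → ℂ} (hκ : Measurable κ) {M : ℝ}
    (hM : ∀ x, ‖κ x‖ ≤ M) {c : ℝ → ℂ} (hc : Integrable c) (g' : Heis n) :
    conv₁ f (conv₂ κ c) g' = conv₂ (conv₁ f κ) c g' := by
  rw [conv₂_conv₁ hf hκ hM hc, Measure.volume_eq_prod,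
    integral_prod _ (integrable_prod_conv hf hκ hM hc g')]
  simp only [conv₂, conv₁, ← integral_const_mul, hmul_assoc]
  congr! 4
  ring

include hφ in
lemma integrable_dilate_central (s : ℝ) (hs : 0 < s) (x : Heis n) :
    Integrable fun v : ℝ => (heisGroup n).dilate φ s (hmul x (central v)) := by
  have hc : Continuous fun v : ℝ => hmul x (central v) := by simp only [hmul_central]; fun_prop
  refine (((heisGroup n).continuous_dilate hφ.continuous s).comp
    hc).integrable_of_hasCompactSupport ?_
  refine HasCompactSupport.intro (isCompact_Icc (a := -x.2 - s ^ 2) (b := -x.2 + s ^ 2))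
    fun v hv => (heisGroup n).dilate_eq_zero hφ.eq_zero hs ?_
  have h1 : |x.2 + v| ≤ koranyi (hmul x (central v)) ^ 2 := by
    have := abs_snd_le_koranyi_sq (hmul x (central v))
    rwa [hmul_central] at this ⊢
  by_contra h2
  have h3 : koranyi (hmul x (central v)) ^ 2 ≤ s ^ 2 :=
    pow_le_pow_left₀ (koranyi_nonneg _) (not_le.1 h2).le 2
  rw [abs_le] at h1
  exact hv ⟨by linarith [h1.1], by linarith [h1.2]⟩

include hφ in
lemma hasDerivAt_dilate_central (s : ℝ) (x : Heis n) (v : ℝ) :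
    HasDerivAt (fun v : ℝ => (heisGroup n).dilate φ s (hmul x (central v)))
      ((s⁻¹ ^ 2 : ℝ) * (heisGroup n).dilate (vertDeriv φ) s (hmul x (central v))) v := by
  have h1 : HasDerivAt (fun v : ℝ => dil s⁻¹ (hmul x (central v))) ((0, s⁻¹ ^ 2) : Heis n) v := by
    simp only [dil, hmul_central]
    refine (hasDerivAt_const v _).prodMk ?_
    exact (((hasDerivAt_id v).const_add x.2).const_mul (s⁻¹ ^ 2)).congr_deriv (mul_one _)
  have h2 := ((hφ.contDiff.differentiable (by simp))
    (dil s⁻¹ (hmul x (central v)))).hasFDerivAt.comp_hasDerivAt v h1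
  have h3 := h2.const_mul (((s ^ (2 * n + 2))⁻¹ : ℝ) : ℂ)
  refine h3.congr_deriv ?_
  have e : ((0, s⁻¹ ^ 2) : Heis n) = (s⁻¹ ^ 2) • (0, 1) := by simp
  rw [e, map_smul, Complex.real_smul]
  change _ = _ * (_ * fderiv ℝ φ (dil s⁻¹ (hmul x (central v))) (0, 1))
  rw [show (heisGroup n).dim = 2 * n + 2 from rfl]
  ring

lemma hasDerivAt_dilate_neg {φ₂ : ℝ → ℂ} (hφ₂ : IsBump lineGroup φ₂) (t v : ℝ) :
    HasDerivAt (fun v : ℝ => lineGroup.dilate φ₂ t (-v))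
      (-((t⁻¹ : ℝ) * lineGroup.dilate (deriv φ₂) t (-v))) v := by
  have h1 : HasDerivAt (fun v : ℝ => t⁻¹ * -v) (-t⁻¹) v := by
    simpa using ((hasDerivAt_id v).neg).const_mul t⁻¹
  have h2 := ((hφ₂.contDiff.differentiable (by simp)) (t⁻¹ * -v)).hasDerivAt.scomp v h1
  refine (h2.const_mul (((t ^ 1)⁻¹ : ℝ) : ℂ)).congr_deriv ?_
  change _ = -(_ * ((((t ^ 1)⁻¹ : ℝ) : ℂ) * deriv φ₂ (t⁻¹ * -v)))
  rw [Complex.real_smul]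
  push_cast
  ring

include hφ in
-- Integration by parts along a central fibre. The second kernel is evaluated at `-v`, and the
-- resulting sign cancels that of the integration by parts.
lemma integral_vertDeriv_mul_dilate {φ₂ : ℝ → ℂ} (hφ₂ : IsBump lineGroup φ₂) {s t : ℝ} (hs : 0 < s)
    (x : Heis n) :
    ∫ v, ((s⁻¹ ^ 2 : ℝ) * (heisGroup n).dilate (vertDeriv φ) s (hmul x (central v))) *
        lineGroup.dilate φ₂ t (-v) =
      ∫ v, (heisGroup n).dilate φ s (hmul x (central v)) *
        ((t⁻¹ : ℝ) * lineGroup.dilate (deriv φ₂) t (-v)) := by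
  have hb : ∀ {η : ℝ → ℂ}, IsBump lineGroup η → ∀ {W : ℝ → ℂ}, Integrable W →
      Integrable fun v => W v * lineGroup.dilate η t (-v) := by
    intro η hη W hW
    obtain ⟨M, hM⟩ := hη.exists_bound
    refine hW.mul_bdd (c := |(t ^ 1)⁻¹| * M) ?_ (Eventually.of_forall fun v => ?_)
    · exact ((lineGroup.continuous_dilate hη.continuous t).comp continuous_neg).aestronglyMeasurable
    · rw [HomogeneousGroup.dilate, norm_mul, Complex.norm_real]
      exact mul_le_mul_of_nonneg_left (hM _) (abs_nonneg _)
  have hi := integrable_dilate_central hφ s hs x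
  have hi' := integrable_dilate_central hφ.vertDeriv s hs x
  have h := integral_mul_deriv_eq_deriv_mul_of_integrable
    (fun v _ => hasDerivAt_dilate_central hφ s x v)
    (fun v _ => hasDerivAt_dilate_neg hφ₂ t v) (by
      refine ((hb hφ₂.deriv hi).const_mul (-((t⁻¹ : ℝ) : ℂ))).congr
        (Eventually.of_forall fun v => ?_)
      simp only [Pi.mul_apply]; ring) (by
      refine ((hb hφ₂ hi').const_mul ((s⁻¹ ^ 2 : ℝ) : ℂ)).congr
        (Eventually.of_forall fun v => ?_)
      simp only [Pi.mul_apply]; ring) (hb hφ₂ hi)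
  simp only [mul_neg, integral_neg, neg_inj] at h
  exact h.symm

include hφ hE hα hEs in
lemma conv₂_vertDeriv_kerInt {φ₂ : ℝ → ℂ} (hφ₂ : IsBump lineGroup φ₂) {s : ℝ} (hs : 0 < s)
    (x : Heis n) :
    (s⁻¹ ^ 2 : ℝ) * conv₂ ((heisGroup n).dilate (vertDeriv φ) s) (lineGroup.kerInt φ₂ 0 E) x =
      conv₂ ((heisGroup n).dilate φ s) (lineGroup.kerInt (deriv φ₂) 1 E) x := by
  obtain ⟨M, hM⟩ := hφ₂.exists_bound
  obtain ⟨M', hM'⟩ := hφ₂.deriv.exists_bound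
  have hi := integrable_dilate_central hφ s hs x
  have hi' := integrable_dilate_central hφ.vertDeriv s hs x
  simp only [conv₂]
  rw [HomogeneousGroup.integral_mul_kerInt _ hφ₂.continuous hE hM 0 hα hEs hi' measurable_neg,
    HomogeneousGroup.integral_mul_kerInt _ hφ₂.deriv.continuous hE hM' 1 hα hEs hi measurable_neg,
    ← integral_const_mul]
  refine setIntegral_congr_fun hE fun t ht => ?_
  have h := integral_vertDeriv_mul_dilate hφ hφ₂ (t := t) hs x
  simp only [mul_assoc, mul_left_comm _ ((t⁻¹ : ℝ) : ℂ), integral_const_mul] at h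
  rw [mul_left_comm, h]
  simp only [zero_add, pow_succ, pow_zero, one_mul, mul_inv]
  push_cast
  ring

/-- Integration by parts along the centre. -/
theorem conv₂_conv₁_kerInt {φ : Heis n → ℂ} (hφ : IsBump (heisGroup n) φ) (m : ℕ)
    {E : Set ℝ} (hE : MeasurableSet E) {α β : ℝ} (hα : 0 < α) (hEs : E ⊆ Set.Ioc α β)
    {φ₂ : ℝ → ℂ} (hφ₂ : IsBump lineGroup φ₂)
    {E' : Set ℝ} (hE' : MeasurableSet E') {α' β' : ℝ} (hα' : 0 < α') (hEs' : E' ⊆ Set.Ioc α' β')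
    {f f' : Heis n → ℂ} (hf : Integrable f) (hf' : Integrable f') (hff' : IsWeakVert f f')
    (g' : Heis n) :
    conv₂ (conv₁ f' ((heisGroup n).kerInt φ m E)) (lineGroup.kerInt φ₂ 0 E') g' =
      conv₂ (conv₁ f ((heisGroup n).kerInt φ m E)) (lineGroup.kerInt (deriv φ₂) 1 E') g' := by
  obtain ⟨M, hM⟩ := hφ.exists_bound
  obtain ⟨M', hM'⟩ := hφ.vertDeriv.exists_bound
  rcases le_or_gt α β with hαβ | hαβ
  swap
  · have : E = ∅ := Set.subset_eq_empty hEs (Set.Ioc_eq_empty hαβ.not_gt)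
    rw [this, HomogeneousGroup.kerInt_empty]
    simp [conv₁, conv₂]
  have hc₀ := lineGroup.integrable_kerInt hφ₂.continuous hφ₂.integrable 0 hE' hα' hEs'
  have hc₁ := lineGroup.integrable_kerInt hφ₂.deriv.continuous hφ₂.deriv.integrable 1 hE' hα' hEs'
  have hK := (heisGroup n).measurable_kerInt hφ.continuous m E
  have hKb := (heisGroup n).norm_kerInt_le hE hM m hα hαβ hEs
  have hdb : ∀ {η : Heis n → ℂ} {M : ℝ}, (∀ x, ‖η x‖ ≤ M) → ∀ s x,
      ‖(heisGroup n).dilate η s x‖ ≤ |(s ^ (heisGroup n).dim)⁻¹| * M := fun hη s x => by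
    rw [HomogeneousGroup.dilate, norm_mul, Complex.norm_real]
    exact mul_le_mul_of_nonneg_left (hη _) (abs_nonneg _)
  rw [conv₂_conv₁ hf' hK hKb hc₀, conv₂_conv₁ hf hK hKb hc₁, Measure.volume_eq_prod,
    HomogeneousGroup.integral_mul_kerInt _ hφ.continuous hE hM m hα hEs
      (hf'.mul_prod hc₀.comp_neg) (measurable_hinv_hmul_central g'),
    HomogeneousGroup.integral_mul_kerInt _ hφ.continuous hE hM m hα hEs
      (hf.mul_prod hc₁.comp_neg) (measurable_hinv_hmul_central g')]
  -- At a fixed scale `s` the weak derivative goes first to the translated dilate of φ, which is a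
  -- test function, and from there along the centre to φ₂.
  refine setIntegral_congr_fun hE fun s hs => ?_
  have hs0 : 0 < s := hα.trans (hEs hs).1
  have hdm : ∀ {η : Heis n → ℂ}, IsBump (heisGroup n) η → Measurable ((heisGroup n).dilate η s) :=
    fun hη => ((heisGroup n).continuous_dilate hη.continuous s).measurable
  have h1 : ∀ x, conv₁ f' ((heisGroup n).dilate φ s) x =
      (s⁻¹ ^ 2 : ℝ) * conv₁ f ((heisGroup n).dilate (vertDeriv φ) s) x := by
    intro x
    have h2 := hff' _ (isTest_transDilate hφ hs0 x)
    simp only [fderiv_transDilate_vert hφ hs0, mul_neg, integral_neg, neg_inj] at h2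
    rw [conv₁, conv₁, ← integral_const_mul]
    refine h2.symm.trans (integral_congr_ae (Eventually.of_forall fun g => ?_))
    simp only [transDilate]
    ring
  have h3 := conv₂_conv₁ hf' (hdm hφ) (hdb hM s) hc₀ g'
  have h4 := conv₂_conv₁ hf (hdm hφ) (hdb hM s) hc₁ g'
  have h5 : conv₂ (conv₁ f' ((heisGroup n).dilate φ s)) (lineGroup.kerInt φ₂ 0 E') g' =
      conv₂ (conv₁ f ((heisGroup n).dilate φ s)) (lineGroup.kerInt (deriv φ₂) 1 E') g' := by
    rw [← conv₁_conv₂ hf (hdm hφ) (hdb hM s) hc₁,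
      ← funext (conv₂_vertDeriv_kerInt hφ hE' hα' hEs' hφ₂ hs0)]
    have h6 := conv₁_conv₂ hf (hdm hφ.vertDeriv) (hdb hM' s) hc₀ g'
    simp only [conv₁, mul_left_comm _ ((s⁻¹ ^ 2 : ℝ) : ℂ), integral_const_mul] at h6 ⊢
    rw [h6]
    simp only [conv₂, ← integral_const_mul]
    refine integral_congr_ae (Eventually.of_forall fun v => ?_)
    simp only [h1]
    ring
  rw [Measure.volume_eq_prod] at h3 h4 ⊢
  exact congr_arg _ ((h3.symm.trans h5).trans h4)

/-- The truncated flag kernel as a convolution along the centre. -/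
theorem truncKernel_eq {φ : Heis n → ℂ} (hφ : IsBump (heisGroup n) φ)
    {φ₂ : ℝ → ℂ} (hφ₂ : IsBump lineGroup φ₂) {ε δ : ℝ} (hε : 0 < ε) (hδ : 0 < δ) (N M : ℝ) :
    truncKernel φ φ₂ ε N δ M = conv₂ ((heisGroup n).kerInt φ 0 (Set.Ioc ε N))
      (lineGroup.kerInt φ₂ 0 (Set.Ioc δ M)) := by
  obtain ⟨B, hB⟩ := hφ.exists_bound
  obtain ⟨B₂, hB₂⟩ := hφ₂.exists_bound
  funext x
  have hc₀ := lineGroup.integrable_kerInt hφ₂.continuous hφ₂.integrable 0 measurableSet_Ioc hδ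
    (subset_refl (Set.Ioc δ M))
  have hm : Measurable fun v : ℝ => hmul x (central v) := by
    simp only [hmul_central]; fun_prop
  have h1 := (heisGroup n).integral_mul_kerInt hφ.continuous measurableSet_Ioc hB 0 hε
    (subset_refl (Set.Ioc ε N)) hc₀.comp_neg hm
  simp only [conv₂, mul_comm _ (lineGroup.kerInt φ₂ 0 _ _)]
  rw [h1, truncKernel]
  refine setIntegral_congr_fun measurableSet_Ioc fun s hs => ?_
  have hs0 : 0 < s := hε.trans hs.1
  have h2 := lineGroup.integral_mul_kerInt hφ₂.continuous measurableSet_Ioc hB₂ 0 hδ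
    (subset_refl (Set.Ioc δ M)) (integrable_dilate_central hφ s hs0 x) measurable_neg
  simp only [mul_comm (lineGroup.kerInt φ₂ 0 _ _)]
  rw [h2, ← integral_const_mul]
  refine setIntegral_congr_fun measurableSet_Ioc fun t ht => ?_
  simp only [conv₂, zero_add, pow_one]
  rw [← mul_assoc, ← Complex.ofReal_mul]
  congr 1
  refine integral_congr_ae (Eventually.of_forall fun v => ?_)
  simp only [dilate₂, HomogeneousGroup.dilate, lineGroup, pow_one]
  rfl

end Kernels

end FlagHeisenberg

end

/-! ### Boxes, slabs and tubes. -/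

noncomputable section

namespace FlagHeisenberg

variable {n : ℕ}

/-- The points `g` with `|z(g) - w| ≤ ρ` whose central coordinate relative to `c` is at most `ℓ`. -/
def slab (w : Fin n → ℂ) (c : Heis n) (ρ ℓ : ℝ) : Set (Heis n) :=
  {g | znorm (g.1 - w) ≤ ρ ∧ |(hmul (hinv c) g).2| ≤ ℓ}

/-- The closed box `c · {(z, t) : |z| ≤ ρ, |t| ≤ ℓ}`. -/
def box (c : Heis n) (ρ ℓ : ℝ) : Set (Heis n) := slab c.1 c ρ ℓ

lemma hinv_hmul_fst (c g : Heis n) : (hmul (hinv c) g).1 = g.1 - c.1 := by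
  rw [hmul_fst, hinv_eq_neg, Prod.fst_neg, neg_add_eq_sub]

lemma mem_box_iff {c g : Heis n} {ρ ℓ : ℝ} :
    g ∈ box c ρ ℓ ↔ znorm (hmul (hinv c) g).1 ≤ ρ ∧ |(hmul (hinv c) g).2| ≤ ℓ := by
  rw [hinv_hmul_fst]; rfl

lemma continuous_hmul_left (c : Heis n) : Continuous (hmul c) :=
  contDiff_hmul.continuous.comp (f := fun g : Heis n => (c, g)) (by fun_prop)

lemma isClosed_slab (w : Fin n → ℂ) (c : Heis n) (ρ ℓ : ℝ) : IsClosed (slab w c ρ ℓ) := by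
  have h := continuous_hmul_left (hinv c)
  exact (isClosed_le (continuous_znorm.comp (by fun_prop)) continuous_const).inter
    (isClosed_le (continuous_snd.comp h).abs continuous_const)

lemma isClosed_box (c : Heis n) (ρ ℓ : ℝ) : IsClosed (box c ρ ℓ) := isClosed_slab _ _ _ _

lemma box_subset_box (c : Heis n) {ρ ρ' ℓ ℓ' : ℝ} (hρ : ρ ≤ ρ') (hℓ : ℓ ≤ ℓ') :
    box c ρ ℓ ⊆ box c ρ' ℓ' := fun _ hg => ⟨hg.1.trans hρ, hg.2.trans hℓ⟩

variable (n) in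
/-- The volume of the Euclidean unit ball of `ℂⁿ`. -/
def unitVol : ℝ := (volume {z : Fin n → ℂ | znorm z ≤ 1}).toReal

lemma volume_znorm_le_one_lt_top : volume {z : Fin n → ℂ | znorm z ≤ 1} < ⊤ :=
  (measure_mono (fun z (hz : znorm z ≤ 1) =>
    mem_closedBall_zero_iff.2 ((norm_le_znorm z).trans hz))).trans_lt
    (measure_closedBall_lt_top (x := (0 : Fin n → ℂ)) (r := 1))

lemma znorm_zero : znorm (0 : Fin n → ℂ) = 0 := by
  simpa using znorm_smul 0 (0 : Fin n → ℂ)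

lemma unitVol_pos : 0 < unitVol n := by
  refine ENNReal.toReal_pos ?_ volume_znorm_le_one_lt_top.ne
  have ho : IsOpen {z : Fin n → ℂ | znorm z < 1} := isOpen_lt continuous_znorm continuous_const
  have h1 : 0 < volume {z : Fin n → ℂ | znorm z < 1} :=
    ho.measure_pos _ ⟨0, by simp [znorm_zero]⟩
  exact (h1.trans_le (measure_mono fun z (hz : znorm z < 1) => hz.le)).ne'

lemma volume_znorm_sub_le (w : Fin n → ℂ) {ρ : ℝ} (hρ : 0 < ρ) :
    volume {z : Fin n → ℂ | znorm (z - w) ≤ ρ} = ENNReal.ofReal (unitVol n * ρ ^ (2 * n)) := by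
  have h1 : {z : Fin n → ℂ | znorm (z - w) ≤ ρ} =
      (fun z => z + -w) ⁻¹' ((fun z => ρ⁻¹ • z) ⁻¹' {z | znorm z ≤ 1}) := by
    ext z
    rw [Set.mem_preimage, Set.mem_preimage, ← sub_eq_add_neg]
    have : znorm (ρ⁻¹ • (z - w)) = ρ⁻¹ * znorm (z - w) := by
      rw [← abs_of_pos (inv_pos.2 hρ), ← znorm_smul, abs_of_pos (inv_pos.2 hρ)]
      rfl
    change znorm (z - w) ≤ ρ ↔ znorm (ρ⁻¹ • (z - w)) ≤ 1
    rw [this, inv_mul_le_iff₀ hρ, mul_one]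
  rw [h1, measure_preimage_add_right, Measure.addHaar_preimage_smul _ (inv_pos.2 hρ).ne',
    mul_comm (unitVol n), ENNReal.ofReal_mul (by positivity), unitVol,
    ENNReal.ofReal_toReal volume_znorm_le_one_lt_top.ne]
  congr 2
  rw [inv_pow, inv_inv, abs_of_pos (by positivity)]
  congr 1
  simp [Module.finrank_pi_fintype, mul_comm]

lemma volume_slab (w : Fin n → ℂ) (c : Heis n) {ρ : ℝ} (hρ : 0 < ρ) (ℓ : ℝ) :
    volume (slab w c ρ ℓ) = ENNReal.ofReal (unitVol n * ρ ^ (2 * n) * (2 * ℓ)) := by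
  have h1 : slab w c ρ ℓ = hmul (hinv c) ⁻¹'
      ({z | znorm (z - (w - c.1)) ≤ ρ} ×ˢ Set.Icc (-ℓ) ℓ) := by
    ext g
    simp only [slab, Set.mem_preimage, Set.mem_prod, Set.mem_ofPred_eq, Set.mem_Icc,
      hinv_hmul_fst, sub_sub_sub_cancel_right, abs_le]
  have hm : MeasurableSet {z : Fin n → ℂ | znorm (z - (w - c.1)) ≤ ρ} :=
    (isClosed_le (continuous_znorm.comp (by fun_prop)) continuous_const).measurableSet
  rw [h1, (measurePreserving_hmul_left (hinv c)).measure_preimage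
    (hm.prod measurableSet_Icc).nullMeasurableSet, Measure.volume_eq_prod, Measure.prod_prod,
    volume_znorm_sub_le _ hρ, Real.volume_Icc, ENNReal.ofReal_mul
    (mul_nonneg unitVol_pos.le (by positivity)), sub_neg_eq_add, two_mul ℓ]

lemma volume_box (c : Heis n) {ρ : ℝ} (hρ : 0 < ρ) (ℓ : ℝ) :
    volume (box c ρ ℓ) = ENNReal.ofReal (unitVol n * ρ ^ (2 * n) * (2 * ℓ)) :=
  volume_slab _ _ hρ ℓ

lemma hmul_hinv_cancel (g h : Heis n) : hmul (hinv g) (hmul g h) = h := by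
  have := (heisGroup n).neg_op_cancel g h
  rwa [← hinv_eq_neg] at this

lemma hmul_cancel_hinv (g h : Heis n) : hmul g (hmul (hinv g) h) = h := by
  have := (heisGroup n).op_neg_cancel g h
  rwa [← hinv_eq_neg] at this

lemma hinv_hmul_eq_neg (g g' : Heis n) : hmul (hinv g') g = -hmul (hinv g) g' := by
  rw [← hinv_eq_neg, hinv_hmul]
  simp [hinv_eq_neg]

/-- Enlargement of a box by a Korányi ball. -/
lemma mem_box_of_koranyi_le {c g g' : Heis n} {ρ ℓ α : ℝ} (hg : g ∈ box c ρ ℓ)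
    (h : koranyi (hmul (hinv g) g') ≤ α) :
    g' ∈ box c (ρ + α) (ℓ + α ^ 2 + ρ * α / 2) := by
  rw [mem_box_iff] at hg ⊢
  set x := hmul (hinv c) g
  set y := hmul (hinv g) g'
  have hxy : hmul (hinv c) g' = hmul x y := by rw [hmul_assoc, hmul_cancel_hinv]
  have hy1 := (znorm_le_koranyi y).trans h
  have hy2 := (abs_snd_le_koranyi_sq y).trans (pow_le_pow_left₀ (koranyi_nonneg _) h 2)
  rw [hxy, hmul_fst, hmul_snd]
  refine ⟨(znorm_add_le _ _).trans (add_le_add hg.1 hy1), ?_⟩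
  -- The twist of the group law shifts the central coordinate in proportion to the width ρ; this is
  -- the origin of the term `ρ α / 2`.
  have h3 : |form x.1 y.1| ≤ ρ * α := (abs_form_le _ _).trans
    (mul_le_mul hg.1 hy1 (znorm_nonneg _) ((znorm_nonneg _).trans hg.1))
  calc |x.2 + y.2 + 1 / 2 * form x.1 y.1|
      ≤ |x.2| + |y.2| + |1 / 2 * form x.1 y.1| := abs_add_three _ _ _
    _ ≤ ℓ + α ^ 2 + ρ * α / 2 := by
        rw [abs_mul, abs_of_pos (by norm_num : (0 : ℝ) < 1 / 2)]
        linarith [hg.2]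

/-- Enlargement of a box in the central direction. -/
lemma mem_box_of_hmul_central {c g : Heis n} {ρ ℓ β v : ℝ} (hg : hmul g (central v) ∈ box c ρ ℓ)
    (h : |v| ≤ β) : g ∈ box c ρ (ℓ + β) := by
  rw [mem_box_iff, ← hmul_assoc, hmul_central] at hg
  rw [mem_box_iff]
  refine ⟨hg.1, ?_⟩
  have := abs_sub (((hmul (hinv c) g).2 + v)) v
  rw [add_sub_cancel_right] at this
  linarith [hg.2]

/-- The width is taken from the box and the height from the ball, which is better than either set
when the box is narrow and tall. -/
lemma box_inter_subset_slab {c g' : Heis n} {ρ ℓ α : ℝ} :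
    box c ρ ℓ ∩ {g | koranyi (hmul (hinv g) g') ≤ α} ⊆ slab c.1 g' ρ (α ^ 2) := by
  rintro g ⟨hg, h⟩
  refine ⟨hg.1, ?_⟩
  rw [hinv_hmul_eq_neg, Prod.snd_neg, abs_neg]
  exact (abs_snd_le_koranyi_sq _).trans (pow_le_pow_left₀ (koranyi_nonneg _) h 2)

namespace Tube

variable (T S : Tube n)

lemma height_pos : 0 < T.height := add_pos (pow_pos T.r_pos 2) T.s_pos

lemma sq_r_le_height : T.r ^ 2 ≤ T.height := by
  have := T.s_pos
  simp only [height]; linarith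

lemma height_double : T.double.height = 4 * T.height := by
  simp only [height, double]; ring

lemma carrier_subset_box : T.carrier ⊆ box T.center T.r T.height := by
  rintro g ⟨b, hb, v, hv, rfl⟩
  rw [mem_box_iff, hmul_assoc, hmul_hinv_cancel, hmul_central]
  have hb' : koranyi b < T.r := hb
  have hv' : |v| < T.s := hv
  refine ⟨(znorm_le_koranyi b).trans hb'.le, ?_⟩
  have h1 := (abs_snd_le_koranyi_sq b).trans (pow_le_pow_left₀ (koranyi_nonneg _) hb'.le 2)
  refine (abs_add_le _ _).trans ?_
  simp only [height]
  linarith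

/-- The central coordinate is shared between the Korányi ball and the central interval in the
proportion `r² : s` in which they make up the height. -/
lemma mem_carrier_of {g : Heis n}
    (h1 : znorm (hmul (hinv T.center) g).1 ^ 4 +
      ((hmul (hinv T.center) g).2 / T.height * T.r ^ 2) ^ 2 < T.r ^ 4)
    (h2 : |(hmul (hinv T.center) g).2| < T.height) : g ∈ T.carrier := by
  have hh := T.height_pos
  set x := hmul (hinv T.center) g with hx
  refine ⟨(x.1, x.2 / T.height * T.r ^ 2), (koranyi_lt_iff T.r_pos.le).2 h1,
    x.2 / T.height * T.s, ?_, ?_⟩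
  · change |x.2 / T.height * T.s| < T.s
    rw [abs_mul, abs_div, abs_of_pos hh, abs_of_pos T.s_pos]
    exact mul_lt_of_lt_one_left T.s_pos ((div_lt_one hh).2 h2)
  · rw [hmul_assoc, hmul_central]
    have : x.2 / T.height * T.r ^ 2 + x.2 / T.height * T.s = x.2 := by
      rw [← mul_add]
      exact div_mul_cancel₀ _ hh.ne'
    rw [this, hx]
    exact (hmul_cancel_hinv _ _).symm

/-- The factor 3/4 works because `(3/4)⁴ + (3/4)² < 1`. Together with `carrier_subset_box` this
makes tubes and boxes interchangeable up to constants. -/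
lemma box_subset_carrier :
    box T.center (3 / 4 * T.r) (3 / 4 * T.height) ⊆ T.carrier := by
  intro g hg
  rw [mem_box_iff] at hg
  have hh := T.height_pos
  have hr := T.r_pos
  refine T.mem_carrier_of ?_ (hg.2.trans_lt (by linarith))
  have h1 := pow_le_pow_left₀ (znorm_nonneg _) hg.1 4
  have h2 : |(hmul (hinv T.center) g).2 / T.height| ≤ 3 / 4 := by
    rw [abs_div, abs_of_pos hh, div_le_iff₀ hh]
    exact hg.2
  have h3 := pow_le_pow_left₀ (abs_nonneg _) h2 2
  rw [sq_abs] at h3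
  have h4 : 0 < T.r ^ 4 := by positivity
  rw [mul_pow] at h1
  rw [mul_pow, ← pow_mul]
  nlinarith [mul_le_mul_of_nonneg_right h3 h4.le]

lemma ofReal_le_volume_carrier :
    ENNReal.ofReal (unitVol n * T.r ^ (2 * n) * T.height) ≤
      ENNReal.ofReal ((4 / 3) ^ (2 * n)) * volume T.carrier := by
  refine le_trans ?_ (mul_le_mul_right (measure_mono T.box_subset_carrier) _)
  rw [volume_box _ (mul_pos (by norm_num) T.r_pos), ← ENNReal.ofReal_mul (by positivity)]
  refine ENNReal.ofReal_le_ofReal ?_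
  have : (4 / 3 : ℝ) ^ (2 * n) * (unitVol n * (3 / 4 * T.r) ^ (2 * n) * (2 * (3 / 4 * T.height))) =
      unitVol n * T.r ^ (2 * n) * T.height * (3 / 2 * ((4 / 3) * (3 / 4)) ^ (2 * n)) := by
    rw [mul_pow, mul_pow]; ring
  rw [this]
  have h := mul_nonneg (mul_nonneg (unitVol_pos (n := n)).le (pow_nonneg T.r_pos.le (2 * n))) T.height_pos.le
  norm_num
  linarith

lemma box_subset_double : box T.center T.r T.height ⊆ T.double.carrier := by
  refine (box_subset_box _ ?_ ?_).trans T.double.box_subset_carrier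
  · have := T.r_pos
    simp only [double]; linarith
  · have := T.height_pos
    rw [height_double]; linarith

variable {T S}

/-- Were `S.r < 2 T.r`, two antipodal points with `|z|` halfway between these radii would lie in
`2T`; their horizontal distance exceeds the diameter `2 S.r` of the horizontal projection of the box
of `S`. Antipodal points exist because `n ≥ 1`. -/
lemma two_mul_r_le (hn : 1 ≤ n) (h : T.double.carrier ⊆ S.carrier) : 2 * T.r ≤ S.r := by
  by_contra! hlt
  set lam : ℝ := (2 * T.r + S.r) / 2 with hlam
  have hR := S.r_pos
  set z : Fin n → ℂ := (lam : ℂ) • Pi.single ⟨0, hn⟩ 1 with hz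
  have h1 : znorm (Pi.single (⟨0, hn⟩ : Fin n) (1 : ℂ)) = 1 := by
    rw [← sq_eq_sq₀ (znorm_nonneg _) zero_le_one, znorm_sq,
      Finset.sum_eq_single_of_mem _ (Finset.mem_univ ⟨0, hn⟩)]
    · simp
    · intro j _ hj
      simp [hj]
  have hzn : znorm z = lam := by rw [hz, znorm_smul, h1, abs_of_pos (by linarith), mul_one]
  have key : ∀ y : Fin n → ℂ, znorm y = lam → znorm (T.center.1 + y - S.center.1) ≤ S.r := by
    intro y hy
    have h2 : hmul T.double.center ((y, 0) : Heis n) ∈ T.double.carrier := by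
      refine T.double.mem_carrier_of ?_ ?_
      · rw [hmul_hinv_cancel]
        simp only [hy, zero_div, zero_mul, ne_eq, OfNat.ofNat_ne_zero, not_false_eq_true,
          zero_pow, add_zero]
        exact pow_lt_pow_left₀ (by simp only [double]; linarith) (by linarith) (by norm_num)
      · rw [hmul_hinv_cancel, abs_zero]
        exact T.double.height_pos
    exact (S.carrier_subset_box (h h2)).1
  have h3 := key z hzn
  have h4 := key (-z) (by rw [znorm_neg, hzn])
  have h5 := znorm_add_le (T.center.1 + z - S.center.1) (-(T.center.1 + -z - S.center.1))
  rw [znorm_neg, show T.center.1 + z - S.center.1 + -(T.center.1 + -z - S.center.1) =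
    ((2 : ℝ) : ℂ) • z by ext; simp; ring, znorm_smul, hzn, abs_two] at h5
  linarith

/-- Otherwise a point on the central axis, at a height halfway between `S.height` and `4 T.height`,
lies in `2T` but not in the box of `S` about the common centre. -/
lemma four_mul_height_le (h : T.double.carrier ⊆ S.carrier) (hc : S.center = T.center) :
    4 * T.height ≤ S.height := by
  by_contra! hlt
  set t : ℝ := (4 * T.height + S.height) / 2 with ht
  have hH := S.height_pos
  have hh := T.double.height_pos
  have hd := T.height_double
  have hr := T.double.r_pos
  have h2 : hmul T.double.center ((0, t) : Heis n) ∈ T.double.carrier := by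
    refine T.double.mem_carrier_of ?_ ?_
    · rw [hmul_hinv_cancel]
      have h3 : (t / T.double.height) ^ 2 < 1 := by
        rw [sq_lt_one_iff_abs_lt_one, abs_div, abs_of_pos hh, div_lt_one hh,
          abs_of_pos (by linarith)]
        linarith
      have h4 : 0 < T.double.r ^ 4 := by positivity
      simp only [znorm_zero]
      rw [mul_pow, ← pow_mul]
      nlinarith
    · rw [hmul_hinv_cancel, abs_of_pos (by simp only; linarith)]
      simp only
      linarith
  have h3 := (mem_box_iff.1 (S.carrier_subset_box (h h2))).2
  rw [hc, show T.center = T.double.center from rfl, hmul_hinv_cancel] at h3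
  have := le_abs_self t
  simp only at h3
  linarith

end Tube

end FlagHeisenberg

end

/-! ### Supports and precursor data of particles. -/

noncomputable section

namespace FlagHeisenberg

variable {n : ℕ}

/-- Square integrable functions that vanish almost everywhere off `B`. -/
structure IsSquareOn (B : Set (Heis n)) (f : Heis n → ℂ) : Prop where
  memLp : MemLp f 2
  ae_eq_zero : ∀ᵐ g, g ∉ B → f g = 0

lemma IsSquareOn.lintegral_le {B : Set (Heis n)} (hB : MeasurableSet B) {f : Heis n → ℂ}
    (hf : IsSquareOn B f) :
    ∫⁻ g, ‖f g‖ₑ ≤ volume B ^ (1 / 2 : ℝ) * eLpNorm f 2 volume := by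
  have h0 : ∫⁻ g in Bᶜ, ‖f g‖ₑ = 0 := by
    rw [setLIntegral_eq_zero_iff' hB.compl hf.memLp.1.enorm.restrict]
    filter_upwards [hf.ae_eq_zero] with g hg hgB
    rw [hg hgB, enorm_zero]
  rw [← lintegral_add_compl _ hB, h0, add_zero]
  exact RightAction.lintegral_enorm_le_rpow_mul hf.memLp.1 B

lemma IsSquareOn.integrable {B : Set (Heis n)} (hB : MeasurableSet B) (hBv : volume B < ⊤)
    {f : Heis n → ℂ} (hf : IsSquareOn B f) : Integrable f :=
  ⟨hf.memLp.1, (hf.lintegral_le hB).trans_lt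
    (ENNReal.mul_lt_top (ENNReal.rpow_lt_top_of_nonneg (by norm_num) hBv.ne) hf.memLp.2)⟩

/-- The fundamental lemma of the calculus of variations on the complement of `B`. It requires that
complement to be open, and closed boxes provide this. It shows that weak derivatives vanish wherever
the original field does. -/
lemma IsSquareOn.of_forall_isTest {B : Set (Heis n)} (hB : IsClosed B) {f : Heis n → ℂ}
    (hf : MemLp f 2)
    (h : ∀ Ψ : Heis n → ℂ, IsTest Ψ → (∀ g ∈ B, g ∉ tsupport Ψ) → ∫ g, f g * Ψ g = 0) :
    IsSquareOn B f := by
  refine ⟨hf, hB.isOpen_compl.ae_eq_zero_of_integral_contDiff_smul_eq_zero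
    ((hf.locallyIntegrable (by norm_num)).locallyIntegrableOn _) fun u hu huc hus => ?_⟩
  have hts : tsupport (fun g => (u g : ℂ)) ⊆ tsupport u :=
    closure_mono fun g hg => by
      rw [Function.mem_support] at hg ⊢
      exact fun h0 => hg (by rw [h0, Complex.ofReal_zero])
  have h1 := h (fun g => (u g : ℂ)) ⟨Complex.ofRealCLM.contDiff.comp hu,
    huc.of_isClosed_subset (isClosed_tsupport _) hts⟩ fun g hg hgs => hus (hts hgs) hg
  rw [← h1]
  exact integral_congr_ae (Eventually.of_forall fun g => by
    simp only [Complex.real_smul]; ring)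

lemma fderiv_eq_zero_of_notMem {Ψ : Heis n → ℂ} {g : Heis n} (h : g ∉ tsupport Ψ) (v : Heis n) :
    fderiv ℝ Ψ g v = 0 := by
  have : fderiv ℝ Ψ g = 0 := by
    by_contra h0
    exact h (support_fderiv_subset ℝ h0)
  rw [this, zero_apply]

lemma IsVertDeriv.isSquareOn {B : Set (Heis n)} (hB : IsClosed B) {A V : Heis n → HorVec n}
    (hA : ∀ᵐ g, g ∉ B → A g = 0) (hV : MemLp V 2) (h : IsVertDeriv A V) (i : Fin n ⊕ Fin n) :
    IsSquareOn B fun g => V g i := by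
  refine IsSquareOn.of_forall_isTest hB (hV.eval_piLp i) fun Ψ hΨ hs => ?_
  rw [← neg_eq_zero, ← h Ψ hΨ i]
  refine integral_eq_zero_of_ae ?_
  filter_upwards [hA] with g hg
  by_cases hgB : g ∈ B
  · simp [fderiv_eq_zero_of_notMem (hs g hgB)]
  · simp [hg hgB]

lemma IsHorDiv.isSquareOn {B : Set (Heis n)} (hB : IsClosed B) {A : Heis n → HorVec n}
    {D : Heis n → ℂ} (hA : ∀ i, ∀ᵐ g, g ∉ B → A g i = 0) (hD : MemLp D 2) (h : IsHorDiv A D) :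
    IsSquareOn B D := by
  refine IsSquareOn.of_forall_isTest hB hD fun Ψ hΨ hs => ?_
  rw [← neg_eq_zero, ← h Ψ hΨ]
  refine integral_eq_zero_of_ae ?_
  filter_upwards [ae_all_iff.2 hA] with g hg
  by_cases hgB : g ∈ B
  · simp [fderiv_eq_zero_of_notMem (hs g hgB)]
  · simp [hg _ hgB]

/-- The data of a particle: `V = ∇₍₂₎ A`, `D = ∇₍₁₎ · A`, `a = ∇₍₁₎ · V = ∇₍₂₎ D`, all of them square
integrable and vanishing off `box c r h`, with the precursor estimates in terms of `N = ‖a‖₂`. -/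
structure Precursor (c : Heis n) (r h C : ℝ) (N : ℝ≥0∞) (A V : Fin n ⊕ Fin n → Heis n → ℂ)
    (D a : Heis n → ℂ) : Prop where
  A_mem : ∀ i, IsSquareOn (box c r h) (A i)
  V_mem : ∀ i, IsSquareOn (box c r h) (V i)
  D_mem : IsSquareOn (box c r h) D
  a_mem : IsSquareOn (box c r h) a
  A_vert : ∀ i, IsWeakVert (A i) (V i)
  D_vert : IsWeakVert D a
  A_hor : ∀ φ, IsBump (heisGroup n) φ → ∀ E α β, MeasurableSet E → 0 < α → E ⊆ Set.Ioc α β →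
    conv₁ D ((heisGroup n).kerInt φ 0 E) =
      fun g => ∑ i, conv₁ (A i) ((heisGroup n).kerInt (horDeriv i φ) 1 E) g
  V_hor : ∀ φ, IsBump (heisGroup n) φ → ∀ E α β, MeasurableSet E → 0 < α → E ⊆ Set.Ioc α β →
    conv₁ a ((heisGroup n).kerInt φ 0 E) =
      fun g => ∑ i, conv₁ (V i) ((heisGroup n).kerInt (horDeriv i φ) 1 E) g
  A_le : ∀ i, eLpNorm (A i) 2 volume ≤ ENNReal.ofReal (C * r * h) * N
  V_le : ∀ i, eLpNorm (V i) 2 volume ≤ ENNReal.ofReal (C * r) * N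
  D_le : eLpNorm D 2 volume ≤ ENNReal.ofReal (C * h) * N

lemma volume_box_lt_top (c : Heis n) {ρ : ℝ} (hρ : 0 < ρ) (ℓ : ℝ) : volume (box c ρ ℓ) < ⊤ := by
  rw [volume_box c hρ]
  exact ENNReal.ofReal_lt_top

lemma eLpNorm_coord_le (A : Heis n → HorVec n) (i : Fin n ⊕ Fin n) :
    eLpNorm (fun g => A g i) 2 volume ≤ eLpNorm A 2 volume :=
  eLpNorm_mono fun g => PiLp.norm_apply_le (A g) i

theorem IsParticle.exists_precursor {C₀ : ℝ} {T : Tube n} {a : Heis n → ℂ}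
    (h : IsParticle C₀ T a) : ∃ A V D,
      Precursor T.center T.r T.height |C₀| (eLpNorm a 2 volume) A V D a := by
  obtain ⟨ha, A, V, D, hA, hV, hD, hAT, hAV, hAD, hVa, h1, h2, h3⟩ := h
  have hB := isClosed_box T.center T.r T.height
  have hBv := volume_box_lt_top T.center T.r_pos T.height
  have hA0 : ∀ᵐ g, g ∉ box T.center T.r T.height → A g = 0 := by
    filter_upwards [hAT] with g hg hgB
    exact hg fun hgT => hgB (T.carrier_subset_box hgT)
  have hAi : ∀ i, IsSquareOn (box T.center T.r T.height) fun g => A g i := fun i =>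
    ⟨hA.eval_piLp i, by
      filter_upwards [hA0] with g hg hgB
      rw [hg hgB]; rfl⟩
  have hVi := hAV.isSquareOn hB hA0 hV
  have hDs := hAD.isSquareOn hB (fun i => (hAi i).ae_eq_zero) hD
  have has := hVa.isSquareOn hB (fun i => (hVi i).ae_eq_zero) ha
  have hAint := fun i => (hAi i).integrable hB.measurableSet hBv
  have hVint := fun i => (hVi i).integrable hB.measurableSet hBv
  -- `C₀` may be negative; its absolute value keeps all later constants nonnegative.
  have habs : ∀ {x : ℝ}, 0 ≤ x → ENNReal.ofReal (C₀ * x) ≤ ENNReal.ofReal (|C₀| * x) := fun hx =>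
    ENNReal.ofReal_le_ofReal (mul_le_mul_of_nonneg_right (le_abs_self _) hx)
  have hr := T.r_pos
  have hh := T.height_pos
  refine ⟨fun i g => A g i, fun i g => V g i, D, hAi, hVi, hDs, has, hAV.isWeakVert,
    isWeakVert_of_isHorDiv hAint hVint hAV hAD hVa,
    fun φ hφ E α β hE hα hEs => funext fun g => conv₁_kerInt_eq_sum hφ hE hα hEs hAint
      (hDs.integrable hB.measurableSet hBv) hAD g,
    fun φ hφ E α β hE hα hEs => funext fun g => conv₁_kerInt_eq_sum hφ hE hα hEs hVint
      (has.integrable hB.measurableSet hBv) hVa g,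
    fun i => (eLpNorm_coord_le A i).trans (h1.trans ?_),
    fun i => (eLpNorm_coord_le V i).trans (h3.trans ?_), h2.trans ?_⟩
  · rw [mul_assoc, mul_assoc]
    exact mul_le_mul_left (habs (mul_pos hr hh).le) _
  · exact mul_le_mul_left (habs hr.le) _
  · exact mul_le_mul_left (habs hh.le) _

end FlagHeisenberg

end

/-! ### Supports, additivity and Schur's test for the convolutions. -/

noncomputable section

namespace FlagHeisenberg

variable {n : ℕ}

section Kernels

variable {G : Type*} [NormedAddCommGroup G] [NormedSpace ℝ G] [MeasureSpace G] [BorelSpace G]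
  [SecondCountableTopology G] [SFinite (volume : Measure G)] {𝔾 : HomogeneousGroup G}
  {φ : G → ℂ} (hφ : IsBump 𝔾 φ) {E : Set ℝ} (hE : MeasurableSet E)
  {α β : ℝ} (hα : 0 < α) (hEs : E ⊆ Set.Ioc α β)

include hφ hE hα hEs in
lemma IsBump.exists_kerInt_bound (m : ℕ) : ∃ M, ∀ x, ‖𝔾.kerInt φ m E x‖ ≤ M := by
  obtain ⟨M, hM⟩ := hφ.exists_bound
  rcases le_or_gt α β with h | h
  · exact ⟨_, 𝔾.norm_kerInt_le hE hM m hα h hEs⟩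
  · have : E = ∅ := Set.subset_eq_empty hEs (Set.Ioc_eq_empty h.not_gt)
    exact ⟨0, fun x => by rw [this, HomogeneousGroup.kerInt_empty]; simp⟩

include hφ hE hα in
/-- The kernel with the weight `s⁻²` is integrable, uniformly in the upper limit. -/
lemma IsBump.lintegral_kerInt_one_le {K : ℝ} (hK : ∫⁻ x, ‖φ x‖ₑ ≤ ENNReal.ofReal K)
    (hEs : E ⊆ Set.Ioi α) :
    ∫⁻ x, ‖𝔾.kerInt φ 1 E x‖ₑ ≤ ENNReal.ofReal (α⁻¹ * K) := by
  refine (𝔾.lintegral_enorm_kerInt_le hφ.continuous 1 (hEs.trans fun x hx => hα.trans hx) hE).trans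
    ?_
  rw [ENNReal.ofReal_mul (by positivity)]
  exact mul_le_mul' (HomogeneousGroup.setLIntegral_inv_sq_le hα hEs) hK

end Kernels

lemma IsBump.comp_neg {φ : Heis n → ℂ} (hφ : IsBump (heisGroup n) φ) :
    IsBump (heisGroup n) fun x => φ (-x) := by
  refine ⟨hφ.contDiff.comp contDiff_neg,
    hφ.hasCompactSupport.comp_homeomorph (Homeomorph.neg _), fun x hx => ?_⟩
  have h1 : -x ∈ tsupport φ :=
    tsupport_comp_subset_preimage φ (f := fun x : Heis n => -x) continuous_neg hx
  have h2 := hφ.tsupport_subset h1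
  simp only [Set.mem_ofPred_eq] at h2 ⊢
  rwa [(heisGroup n).gauge_neg] at h2

lemma IsBump.comp_neg_line {φ : ℝ → ℂ} (hφ : IsBump lineGroup φ) :
    IsBump lineGroup fun x => φ (-x) := by
  refine ⟨hφ.contDiff.comp contDiff_neg,
    hφ.hasCompactSupport.comp_homeomorph (Homeomorph.neg _), fun x hx => ?_⟩
  have h1 : -x ∈ tsupport φ :=
    tsupport_comp_subset_preimage φ (f := fun x : ℝ => -x) continuous_neg hx
  have h2 := hφ.tsupport_subset h1
  simp only [Set.mem_ofPred_eq] at h2 ⊢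
  rwa [lineGroup.gauge_neg] at h2

section Convolution

variable {f k : Heis n → ℂ} {c : ℝ → ℂ}

lemma aestronglyMeasurable_conv₁ (hf : AEStronglyMeasurable f) (hk : Measurable k) :
    AEStronglyMeasurable (conv₁ f k) := by
  rw [conv₁_eq_aconv]
  exact (heisAction n).aestronglyMeasurable_aconv (hk.comp measurable_neg).aestronglyMeasurable hf

lemma aestronglyMeasurable_conv₂ (hf : AEStronglyMeasurable f) (hc : Measurable c) :
    AEStronglyMeasurable (conv₂ f c) := by
  rw [conv₂_eq_aconv]
  exact (centralAction n).aestronglyMeasurable_aconv (hc.comp measurable_neg).aestronglyMeasurable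
    hf

lemma lintegral_enorm_conv₁_le (hf : AEStronglyMeasurable f) (hk : Measurable k) :
    ∫⁻ g, ‖conv₁ f k g‖ₑ ≤ (∫⁻ x, ‖k x‖ₑ) * ∫⁻ g, ‖f g‖ₑ := by
  rw [conv₁_eq_aconv, ← lintegral_neg_eq_self (fun x => ‖k x‖ₑ)]
  exact (heisAction n).lintegral_enorm_aconv_le (hk.comp measurable_neg).aestronglyMeasurable hf

lemma lintegral_enorm_conv₂_le (hf : AEStronglyMeasurable f) (hc : Measurable c) :
    ∫⁻ g, ‖conv₂ f c g‖ₑ ≤ (∫⁻ x, ‖c x‖ₑ) * ∫⁻ g, ‖f g‖ₑ := by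
  rw [conv₂_eq_aconv, ← lintegral_neg_eq_self (fun x => ‖c x‖ₑ)]
  exact (centralAction n).lintegral_enorm_aconv_le (hc.comp measurable_neg).aestronglyMeasurable hf

lemma memLp_conv₁ (hf : MemLp f 2) (hk : Integrable k) : MemLp (conv₁ f k) 2 := by
  rw [conv₁_eq_aconv]
  exact (heisAction n).memLp_aconv hk.comp_neg hf

lemma memLp_conv₂ (hf : MemLp f 2) (hc : Integrable c) : MemLp (conv₂ f c) 2 := by
  rw [conv₂_eq_aconv]
  exact (centralAction n).memLp_aconv hc.comp_neg hf

lemma conv₁_eq_zero {z : Heis n} {ρ ℓ α : ℝ} (hf : ∀ᵐ g, g ∉ box z ρ ℓ → f g = 0)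
    (hk : ∀ x, α ≤ koranyi x → k x = 0) {g' : Heis n}
    (hg' : g' ∉ box z (ρ + α) (ℓ + α ^ 2 + ρ * α / 2)) : conv₁ f k g' = 0 := by
  refine integral_eq_zero_of_ae ?_
  filter_upwards [hf] with g hg
  by_cases hgB : g ∈ box z ρ ℓ
  · have : α ≤ koranyi (hmul (hinv g) g') := by
      by_contra! h
      exact hg' (mem_box_of_koranyi_le hgB h.le)
    simp [hk _ this]
  · simp [hg hgB]

lemma conv₂_eq_zero {z : Heis n} {ρ ℓ β : ℝ} (hf : ∀ g, g ∉ box z ρ ℓ → f g = 0)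
    (hc : ∀ v, β ≤ |v| → c v = 0) {g' : Heis n} (hg' : g' ∉ box z ρ (ℓ + β)) :
    conv₂ f c g' = 0 := by
  refine integral_eq_zero_of_ae (Eventually.of_forall fun v => ?_)
  by_cases hgB : hmul g' (central v) ∈ box z ρ ℓ
  · have : β ≤ |(-v)| := by
      by_contra! h
      rw [abs_neg] at h
      exact hg' (mem_box_of_hmul_central hgB h.le)
    simp [hc _ this]
  · simp [hf _ hgB]

lemma conv₂_conv₁_add_left (hf : Integrable f) {k' : Heis n → ℂ} (hk : Measurable k)
    (hk' : Measurable k') {M M' : ℝ} (hM : ∀ x, ‖k x‖ ≤ M) (hM' : ∀ x, ‖k' x‖ ≤ M')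
    (hc : Integrable c) (g : Heis n) :
    conv₂ (conv₁ f fun x => k x + k' x) c g =
      conv₂ (conv₁ f k) c g + conv₂ (conv₁ f k') c g := by
  rw [conv₂_conv₁ (κ := fun x => k x + k' x) hf (hk.add hk') (fun x => (norm_add_le _ _).trans (add_le_add (hM x) (hM' x))) hc,
    conv₂_conv₁ hf hk hM hc, conv₂_conv₁ hf hk' hM' hc, Measure.volume_eq_prod,
    ← integral_add (integrable_prod_conv hf hk hM hc g) (integrable_prod_conv hf hk' hM' hc g)]
  simp only [mul_add]

lemma conv₂_conv₁_add_right (hf : Integrable f) (hk : Measurable k) {M : ℝ} (hM : ∀ x, ‖k x‖ ≤ M)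
    {c' : ℝ → ℂ} (hc : Integrable c) (hc' : Integrable c') (g : Heis n) :
    conv₂ (conv₁ f k) (fun v => c v + c' v) g =
      conv₂ (conv₁ f k) c g + conv₂ (conv₁ f k) c' g := by
  rw [conv₂_conv₁ (c := fun v => c v + c' v) hf hk hM (hc.add hc'),
    conv₂_conv₁ hf hk hM hc, conv₂_conv₁ hf hk hM hc', Measure.volume_eq_prod,
    ← integral_add (integrable_prod_conv hf hk hM hc g) (integrable_prod_conv hf hk hM hc' g)]
  simp only [mul_add, add_mul]

lemma conv₁_add (hf : Integrable f) {k' : Heis n → ℂ} (hk : Measurable k)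
    (hk' : Measurable k') {M M' : ℝ} (hM : ∀ x, ‖k x‖ ≤ M) (hM' : ∀ x, ‖k' x‖ ≤ M') (g : Heis n) :
    conv₁ f (fun x => k x + k' x) g = conv₁ f k g + conv₁ f k' g := by
  have hm := measurable_hinv_hmul g
  simp only [conv₁, mul_add]
  exact integral_add
    (hf.mul_bdd (hk.comp hm).aestronglyMeasurable (Eventually.of_forall fun _ => hM _))
    (hf.mul_bdd (hk'.comp hm).aestronglyMeasurable (Eventually.of_forall fun _ => hM' _))

lemma conv₂_sum {ι : Type*} [Fintype ι] {f k : ι → Heis n → ℂ} (hf : ∀ i, Integrable (f i))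
    (hk : ∀ i, Measurable (k i)) (hM : ∀ i, ∃ M, ∀ x, ‖k i x‖ ≤ M) (hc : Integrable c)
    (g' : Heis n) :
    conv₂ (fun g => ∑ i, conv₁ (f i) (k i) g) c g' = ∑ i, conv₂ (conv₁ (f i) (k i)) c g' := by
  simp only [conv₂, Finset.sum_mul]
  refine integral_finsetSum _ fun i _ => ?_
  obtain ⟨M, hM⟩ := hM i
  refine (integrable_prod_conv (hf i) (hk i) hM hc g').integral_prod_right.congr
    (Eventually.of_forall fun v => ?_)
  simp only [conv₁, ← integral_mul_const]
  refine integral_congr_ae (Eventually.of_forall fun g => ?_)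
  simp only
  ring

/-- Schur's test for functions supported in `B`. -/
theorem eLpNorm_conv₁_le_of_lintegral_le {B : Set (Heis n)} (hB : MeasurableSet B)
    (hf : IsSquareOn B f) (hk : Measurable k) {S : ℝ≥0∞}
    (hS : ∀ g', ∫⁻ g in B, ‖k (hmul (hinv g) g')‖ₑ ≤ S) :
    eLpNorm (conv₁ f k) 2 volume ≤
      (S * ∫⁻ x, ‖k x‖ₑ) ^ (1 / 2 : ℝ) * eLpNorm f 2 volume := by
  have hkm : Measurable fun p : Heis n × Heis n => k (hmul (hinv p.2) p.1) :=
    hk.comp (contDiff_hmul.continuous.comp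
      (f := fun p : Heis n × Heis n => (-p.2, p.1)) (by fun_prop)).measurable
  have hkg : ∀ g', Measurable fun g => k (hmul (hinv g) g') := fun g' =>
    hkm.comp (measurable_prodMk_left (x := g'))
  have h1 : ∀ g', ‖conv₁ f k g'‖ₑ ^ (2 : ℝ) ≤
      S * ∫⁻ g, ‖f g‖ₑ ^ (2 : ℝ) * ‖k (hmul (hinv g) g')‖ₑ := by
    intro g'
    -- The kernel is split as `|k|^(1/2) |k|^(1/2)` for Cauchy–Schwarz. As `f` lives on `B`, the
    -- first factor is integrated over `B` only, which is where the smallness of `S` enters.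
    have h2 : ‖conv₁ f k g'‖ₑ ≤ ∫⁻ g in B,
        ‖k (hmul (hinv g) g')‖ₑ ^ (1 / 2 : ℝ) * (‖f g‖ₑ * ‖k (hmul (hinv g) g')‖ₑ ^ (1 / 2 : ℝ)) := by
      refine (enorm_integral_le_lintegral_enorm _).trans ?_
      rw [← lintegral_indicator hB]
      refine lintegral_mono_ae ?_
      filter_upwards [hf.ae_eq_zero] with g hg
      by_cases hgB : g ∈ B
      · rw [Set.indicator_of_mem hgB, enorm_mul, mul_left_comm, ← ENNReal.rpow_add_of_nonneg _ _
          (by norm_num) (by norm_num)]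
        norm_num
      · simp [hg hgB]
    have h3 := ENNReal.lintegral_mul_le_Lp_mul_Lq (volume.restrict B)
      (Real.HolderConjugate.two_two)
      ((hkg g').enorm.pow_const (1 / 2 : ℝ)).aemeasurable
      (hf.memLp.1.enorm.restrict.mul ((hkg g').enorm.pow_const (1 / 2 : ℝ)).aemeasurable)
    have h4 := h2.trans h3
    refine (ENNReal.rpow_le_rpow h4 (by norm_num : (0 : ℝ) ≤ 2)).trans ?_
    have e : ∀ x : ℝ≥0∞, (x ^ (1 / 2 : ℝ)) ^ (2 : ℝ) = x := fun x => by
      rw [← ENNReal.rpow_mul]; norm_num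
    rw [ENNReal.mul_rpow_of_nonneg _ _ (by norm_num), e, e]
    simp only [Pi.mul_apply, e, ENNReal.mul_rpow_of_nonneg _ _ (by norm_num : (0 : ℝ) ≤ 2)]
    exact mul_le_mul' (hS g') (setLIntegral_le_lintegral _ _)
  have h5 : ∫⁻ g', ‖conv₁ f k g'‖ₑ ^ (2 : ℝ) ≤
      (S * ∫⁻ x, ‖k x‖ₑ) * ∫⁻ g, ‖f g‖ₑ ^ (2 : ℝ) := by
    refine (lintegral_mono h1).trans ?_
    have hm : AEMeasurable (fun p : Heis n × Heis n =>
        ‖f p.2‖ₑ ^ (2 : ℝ) * ‖k (hmul (hinv p.2) p.1)‖ₑ) (volume.prod volume) :=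
      ((hf.memLp.1.comp_snd).enorm.pow_const _).mul hkm.enorm.aemeasurable
    rw [lintegral_const_mul'' _ hm.lintegral_prod_right', lintegral_lintegral_swap hm, mul_assoc]
    refine mul_le_mul_right (le_of_eq ?_) _
    rw [← lintegral_const_mul'' _ (hf.memLp.1.enorm.pow_const _)]
    refine lintegral_congr fun g => ?_
    have hkg' : Measurable fun x => k (hmul (hinv g) x) :=
      hk.comp (continuous_hmul_left (hinv g)).measurable
    simp only
    rw [lintegral_const_mul _ hkg'.enorm, mul_comm,
      (measurePreserving_hmul_left (hinv g)).lintegral_comp hk.enorm]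
  have e2 : ∀ u : Heis n → ℂ, eLpNorm u 2 volume = (∫⁻ g, ‖u g‖ₑ ^ (2 : ℝ)) ^ (1 / 2 : ℝ) :=
    fun u => by
      rw [eLpNorm_eq_lintegral_rpow_enorm_toReal (by norm_num) (by norm_num)]
      norm_num
  rw [e2, e2, ← ENNReal.mul_rpow_of_nonneg _ _ (by norm_num)]
  exact ENNReal.rpow_le_rpow h5 (by norm_num)

end Convolution

end FlagHeisenberg

end

/-! ### The contribution of large central scales. -/

noncomputable section

namespace FlagHeisenberg

variable {n : ℕ}

/-- Bounds for the generating functions of a flag kernel, with a common constant `K`. -/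
structure FlagBounds (φ₁ : Heis n → ℂ) (φ₂ : ℝ → ℂ) (K : ℝ) : Prop where
  nonneg : 0 ≤ K
  bump₁ : IsBump (heisGroup n) φ₁
  bump₂ : IsBump lineGroup φ₂
  op₁ : ∀ ε N, 0 < ε → ∀ f : Heis n → ℂ, MemLp f 2 →
    eLpNorm (conv₁ f ((heisGroup n).kerInt φ₁ 0 (Set.Ioc ε N))) 2 volume ≤
      ENNReal.ofReal K * eLpNorm f 2 volume
  op₂ : ∀ ε N, 0 < ε → ∀ f : Heis n → ℂ, MemLp f 2 →
    eLpNorm (conv₂ f (lineGroup.kerInt φ₂ 0 (Set.Ioc ε N))) 2 volume ≤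
      ENNReal.ofReal K * eLpNorm f 2 volume
  sup : ∀ i x, ‖horDeriv i φ₁ x‖ ≤ K
  hor : ∀ i, ∫⁻ x, ‖horDeriv i φ₁ x‖ₑ ≤ ENNReal.ofReal K
  vert : ∫⁻ x, ‖deriv φ₂ x‖ₑ ≤ ENNReal.ofReal K

/-- The minimum and maximum make the splitting valid whatever the position of `r`, with an empty
piece when `r` lies outside the interval. -/
lemma Ioc_split (ε ρ r : ℝ) :
    Set.Ioc ε ρ = Set.Ioc ε (min ρ r) ∪ Set.Ioc (max ε r) ρ := by
  ext x
  simp only [Set.mem_union, Set.mem_Ioc, le_min_iff, max_lt_iff]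
  constructor
  · rintro ⟨h1, h2⟩
    rcases le_or_gt x r with h | h
    · exact Or.inl ⟨h1, h2, h⟩
    · exact Or.inr ⟨⟨h1, h⟩, h2⟩
  · rintro (⟨h1, h2, -⟩ | ⟨⟨h1, -⟩, h2⟩) <;> exact ⟨h1, h2⟩

lemma Ioc_split_disjoint (ε ρ r : ℝ) :
    Disjoint (Set.Ioc ε (min ρ r)) (Set.Ioc (max ε r) ρ) := by
  rw [Set.disjoint_left]
  intro x hx hx'
  exact absurd (hx.2.trans (min_le_right _ _)) (not_le.2 ((le_max_right _ _).trans_lt hx'.1))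

lemma sum_ofReal_mul (n : ℕ) (x : ℝ) (N : ℝ≥0∞) :
    ∑ _i : Fin n ⊕ Fin n, ENNReal.ofReal x * N = ENNReal.ofReal (2 * n * x) * N := by
  rw [Finset.sum_const, nsmul_eq_mul, ← mul_assoc, ENNReal.ofReal_mul (by positivity)]
  congr 2
  rw [Finset.card_univ, Fintype.card_sum, Fintype.card_fin, ← two_mul, ← ENNReal.ofReal_natCast]
  push_cast
  rfl

lemma IsSquareOn.lintegral_le_of_box {c : Heis n} {ρ ℓ X Y : ℝ} {N : ℝ≥0∞} {f : Heis n → ℂ}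
    (hρ : 0 < ρ) (hX : 0 ≤ X) (hV : unitVol n * ρ ^ (2 * n) * (2 * ℓ) ≤ X ^ 2)
    (hf : IsSquareOn (box c ρ ℓ) f) (hY : eLpNorm f 2 volume ≤ ENNReal.ofReal Y * N) :
    ∫⁻ g, ‖f g‖ₑ ≤ ENNReal.ofReal (X * Y) * N := by
  refine (hf.lintegral_le (isClosed_box _ _ _).measurableSet).trans ?_
  rw [ENNReal.ofReal_mul hX, mul_assoc]
  refine mul_le_mul' ?_ hY
  rw [volume_box c hρ]
  refine (ENNReal.rpow_le_rpow (ENNReal.ofReal_le_ofReal hV) (by norm_num)).trans ?_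
  rw [ENNReal.ofReal_rpow_of_nonneg (by positivity) (by norm_num), ← Real.sqrt_eq_rpow,
    Real.sqrt_sq hX]

lemma kerInt_Ioc_eq_zero {φ : Heis n → ℂ} (hφ : IsBump (heisGroup n) φ) (m : ℕ) {E : Set ℝ}
    (hE : MeasurableSet E) {α β : ℝ} (hα : 0 < α) (hEs : E ⊆ Set.Ioc α β) {x : Heis n}
    (hx : β ≤ koranyi x) : (heisGroup n).kerInt φ m E x = 0 :=
  (heisGroup n).kerInt_eq_zero hE hφ.eq_zero m hα hEs hx

/-- The square root of the volume of a box, up to a constant. -/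
def boxSize (n : ℕ) (r h : ℝ) : ℝ := √(unitVol n * r ^ (2 * n) * h)

lemma boxSize_nonneg (n : ℕ) (r h : ℝ) : 0 ≤ boxSize n r h := Real.sqrt_nonneg _

lemma boxSize_sq {r h : ℝ} (hr : 0 < r) (hh : 0 < h) :
    boxSize n r h ^ 2 = unitVol n * r ^ (2 * n) * h :=
  Real.sq_sqrt (mul_nonneg (mul_nonneg unitVol_pos.le (by positivity)) hh.le)

section Estimates

variable {φ₁ : Heis n → ℂ} {φ₂ : ℝ → ℂ} {K : ℝ} (hF : FlagBounds φ₁ φ₂ K)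
  {c : Heis n} {r h C : ℝ} {N : ℝ≥0∞} {A V : Fin n ⊕ Fin n → Heis n → ℂ} {D a : Heis n → ℂ}
  (hP : Precursor c r h C N A V D a) (hr : 0 < r) (hh : 0 < h) (hC : 0 ≤ C)

include hP hr hh in
lemma Precursor.lintegral_A_le (i : Fin n ⊕ Fin n) :
    ∫⁻ g, ‖A i g‖ₑ ≤ ENNReal.ofReal (2 * boxSize n r h * (C * r * h)) * N := by
  refine (hP.A_mem i).lintegral_le_of_box hr (mul_nonneg two_pos.le (boxSize_nonneg _ _ _)) ?_
    (hP.A_le i)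
  rw [mul_pow, boxSize_sq hr hh]
  have := mul_nonneg (mul_nonneg (unitVol_pos (n := n)).le (pow_nonneg hr.le (2 * n))) hh.le
  linarith

include hF hP hr hh hC in
-- Young's inequality, with Cauchy–Schwarz for `A` on its box; the scales of `E` may reach to
-- infinity because of the weight `s⁻²`.
lemma Precursor.lintegral_conv₁_A_le {E : Set ℝ} (hE : MeasurableSet E) {α : ℝ} (hα : 0 < α)
    (hEs : E ⊆ Set.Ioi α) (i : Fin n ⊕ Fin n) :
    ∫⁻ g, ‖conv₁ (A i) ((heisGroup n).kerInt (horDeriv i φ₁) 1 E) g‖ₑ ≤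
      ENNReal.ofReal (2 * K * C * boxSize n r h * h * (r / α)) * N := by
  have hb := hF.bump₁.horDeriv i
  refine (lintegral_enorm_conv₁_le (hP.A_mem i).memLp.1
    ((heisGroup n).measurable_kerInt hb.continuous 1 E)).trans ?_
  refine (mul_le_mul' (hb.lintegral_kerInt_one_le hE hα (hF.hor i) hEs)
    (hP.lintegral_A_le hr hh i)).trans (le_of_eq ?_)
  have := hF.nonneg
  rw [← mul_assoc, ← ENNReal.ofReal_mul (by positivity)]
  congr 2
  field_simp

include hF hP hr hh hC in
-- The scales are split at `r`. Below `r` the convolution stays in a box comparable with the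
-- original one, where the `L²` bound and Cauchy–Schwarz apply. Above `r` the divergence is moved
-- from `A` to the kernel, and the loss `r` in the bound for `A` is compensated by the gain `1/r`.
lemma Precursor.lintegral_conv₁_D_le (hrh : r ^ 2 ≤ h) {ε : ℝ} (hε : 0 < ε) (ρ : ℝ) :
    ∫⁻ g, ‖conv₁ D ((heisGroup n).kerInt φ₁ 0 (Set.Ioc ε ρ)) g‖ₑ ≤
      ENNReal.ofReal ((3 * 2 ^ n + 4 * n) * K * C * boxSize n r h * h) * N := by
  have hK := hF.nonneg
  have hτ := boxSize_nonneg n r h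
  have hb := hF.bump₁
  have hc := hb.continuous
  have hDi := hP.D_mem.integrable (isClosed_box _ _ _).measurableSet (volume_box_lt_top c hr h)
  set E := Set.Ioc ε (min ρ r) with hE
  set E' := Set.Ioc (max ε r) ρ with hE'
  have hEs : E ⊆ Set.Ioc ε ρ := Set.Ioc_subset_Ioc_right (min_le_left _ _)
  have hEs' : E' ⊆ Set.Ioc ε ρ := Set.Ioc_subset_Ioc_left (le_max_left _ _)
  have hmr : 0 < max ε r := hε.trans_le (le_max_left _ _)
  have hm := fun m E => (heisGroup n).measurable_kerInt hc m E
  obtain ⟨M₀, hM₀⟩ := hb.exists_bound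
  obtain ⟨M, hM⟩ := hb.exists_kerInt_bound measurableSet_Ioc hε hEs 0
  obtain ⟨M', hM'⟩ := hb.exists_kerInt_bound measurableSet_Ioc hε hEs' 0
  have hsplit : conv₁ D ((heisGroup n).kerInt φ₁ 0 (Set.Ioc ε ρ)) = fun g =>
      conv₁ D ((heisGroup n).kerInt φ₁ 0 E) g + conv₁ D ((heisGroup n).kerInt φ₁ 0 E') g := by
    funext g
    rw [← conv₁_add hDi (hm _ _) (hm _ _) hM hM', Ioc_split ε ρ r]
    congr 1
    funext x
    exact (heisGroup n).kerInt_union hc hM₀ 0 measurableSet_Ioc measurableSet_Ioc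
      (Ioc_split_disjoint _ _ _) hε hEs hEs' x
  have hlow : ∫⁻ g, ‖conv₁ D ((heisGroup n).kerInt φ₁ 0 E) g‖ₑ ≤
      ENNReal.ofReal (3 * 2 ^ n * boxSize n r h * (K * (C * h))) * N := by
    have hs : IsSquareOn (box c (r + r) (h + r ^ 2 + r * r / 2))
        (conv₁ D ((heisGroup n).kerInt φ₁ 0 E)) :=
      ⟨memLp_conv₁ hP.D_mem.memLp ((heisGroup n).integrable_kerInt hc hb.integrable 0
        measurableSet_Ioc hε (subset_refl E)), Eventually.of_forall fun g hg =>
        conv₁_eq_zero hP.D_mem.ae_eq_zero (fun x hx => kerInt_Ioc_eq_zero hb 0 measurableSet_Ioc hε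
          (subset_refl E) ((min_le_right _ _).trans hx)) hg⟩
    refine hs.lintegral_le_of_box (by linarith) (by positivity) ?_
      ((hF.op₁ ε _ hε D hP.D_mem.memLp).trans ?_)
    -- Since `r² ≤ h`, the full height satisfies `2(h + 3r²/2) ≤ 5h ≤ 9h`; the doubled width gives
    -- `2^(2n)`, and `3 · 2^n` is the root of the product `9 · 2^(2n)`.
    · rw [mul_pow, boxSize_sq hr hh, ← two_mul, mul_pow, mul_pow, ← pow_mul, mul_comm n 2]
      have hw : 0 ≤ unitVol n * (2 ^ (2 * n) * r ^ (2 * n)) :=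
        mul_nonneg unitVol_pos.le (by positivity)
      nlinarith
    · rw [ENNReal.ofReal_mul hK, mul_assoc]
      exact mul_le_mul_right hP.D_le _
  have hhigh : ∫⁻ g, ‖conv₁ D ((heisGroup n).kerInt φ₁ 0 E') g‖ₑ ≤
      ENNReal.ofReal (2 * n * (2 * K * C * boxSize n r h * h)) * N := by
    rw [hP.A_hor φ₁ hb E' _ _ measurableSet_Ioc hmr (subset_refl E'), ← sum_ofReal_mul]
    refine (lintegral_mono fun g => enorm_sum_le _ _).trans ?_
    rw [lintegral_finsetSum' _ fun i _ => (aestronglyMeasurable_conv₁ (hP.A_mem i).memLp.1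
      ((heisGroup n).measurable_kerInt (hb.horDeriv i).continuous 1 E')).enorm]
    refine Finset.sum_le_sum fun i _ => ?_
    have := hP.lintegral_conv₁_A_le hF hr hh hC (measurableSet_Ioc (a := max ε r) (b := ρ)) hr
      (fun x hx => (le_max_right _ _).trans_lt hx.1) i
    rwa [div_self hr.ne', mul_one] at this
  rw [hsplit]
  refine (lintegral_mono fun g => enorm_add_le _ _).trans ?_
  rw [lintegral_add_left' (aestronglyMeasurable_conv₁ hP.D_mem.memLp.1 (hm 0 E)).enorm]
  refine (add_le_add hlow hhigh).trans (le_of_eq ?_)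
  rw [← add_mul, ← ENNReal.ofReal_add (by positivity) (by positivity)]
  congr 2
  ring

include hF hP hr hh hC in
/-- The part of the flag kernel with a large central scale. -/
theorem Precursor.lintegral_central_le (hrh : r ^ 2 ≤ h) {ε ρ η M : ℝ} (hε : 0 < ε) (hη : 0 < η) :
    ∫⁻ g, ‖conv₂ (conv₁ a ((heisGroup n).kerInt φ₁ 0 (Set.Ioc ε ρ)))
      (lineGroup.kerInt φ₂ 0 (Set.Ioc η M)) g‖ₑ ≤
      ENNReal.ofReal ((3 * 2 ^ n + 4 * n) * K ^ 2 * C * (h / η) * boxSize n r h) * N := by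
  have hK := hF.nonneg
  have hτ := boxSize_nonneg n r h
  have hBm := (isClosed_box c r h).measurableSet
  have hBv := volume_box_lt_top c hr h
  have hb := hF.bump₂.deriv
  rw [funext (conv₂_conv₁_kerInt hF.bump₁ 0 measurableSet_Ioc hε (subset_refl _) hF.bump₂
    measurableSet_Ioc hη (subset_refl _) (hP.D_mem.integrable hBm hBv)
    (hP.a_mem.integrable hBm hBv) hP.D_vert)]
  refine (lintegral_enorm_conv₂_le (aestronglyMeasurable_conv₁ hP.D_mem.memLp.1
    ((heisGroup n).measurable_kerInt hF.bump₁.continuous _ _))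
    (lineGroup.measurable_kerInt hb.continuous _ _)).trans ?_
  refine (mul_le_mul' (hb.lintegral_kerInt_one_le measurableSet_Ioc hη hF.vert
    fun x hx => hx.1) (hP.lintegral_conv₁_D_le hF hr hh hC hrh hε ρ)).trans (le_of_eq ?_)
  rw [← mul_assoc, ← ENNReal.ofReal_mul (by positivity)]
  congr 2
  field_simp

end Estimates

end FlagHeisenberg

end

/-! ### One dyadic block of Heisenberg scales. -/

noncomputable section

namespace FlagHeisenberg

variable {n : ℕ}

lemma setLIntegral_box_kernel_le {k : Heis n → ℂ} {M α : ℝ} (hM : ∀ x, ‖k x‖ ≤ M)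
    (hk : ∀ x, α ≤ koranyi x → k x = 0) (c : Heis n) {r : ℝ} (hr : 0 < r) (h : ℝ) (g' : Heis n) :
    ∫⁻ g in box c r h, ‖k (hmul (hinv g) g')‖ₑ ≤
      ENNReal.ofReal M * ENNReal.ofReal (unitVol n * r ^ (2 * n) * (2 * min h (α ^ 2))) := by
  set W := slab c.1 g' r (α ^ 2)
  have hW : MeasurableSet W := (isClosed_slab _ _ _ _).measurableSet
  have h1 : ∫⁻ g in box c r h, ‖k (hmul (hinv g) g')‖ₑ ≤
      ∫⁻ g in box c r h, W.indicator (fun _ => ENNReal.ofReal M) g := by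
    refine setLIntegral_mono' (isClosed_box _ _ _).measurableSet fun g hg => ?_
    by_cases hα : koranyi (hmul (hinv g) g') ≤ α
    · rw [Set.indicator_of_mem (box_inter_subset_slab ⟨hg, hα⟩), ← ofReal_norm]
      exact ENNReal.ofReal_le_ofReal (hM _)
    · rw [hk _ (not_le.1 hα).le, enorm_zero]
      exact bot_le
  refine h1.trans ?_
  rw [lintegral_indicator hW, setLIntegral_const, Measure.restrict_apply hW]
  refine mul_le_mul_right ?_ _
  rcases le_total h (α ^ 2) with h2 | h2
  · rw [min_eq_left h2, ← volume_box c hr h]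
    exact measure_mono Set.inter_subset_right
  · rw [min_eq_right h2, ← volume_slab c.1 g' hr (α ^ 2)]
    exact measure_mono Set.inter_subset_left

/-- The first root is the cost of Cauchy–Schwarz on the output box, the second the gain in Schur's
test. They balance because `min h (4u²) · max h (u²) ≤ 4u²h`; the constant 15 comes from `28 · 2 · 4
= 224 ≤ 15²`. -/
lemma sqrt_mul_sqrt_le {w r u h : ℝ} (hw : 0 ≤ w) (hr : 0 ≤ r) (hu : 0 < u) (hh : 0 ≤ h) (n : ℕ) :
    √(w * (10 * u) ^ (2 * n) * (28 * max h (u ^ 2))) *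
        (√(w * r ^ (2 * n) * (2 * min h ((2 * u) ^ 2))) / u ^ (n + 2)) ≤
      15 * 10 ^ n * √w * √(w * r ^ (2 * n) * h) / u := by
  have h1 : min h ((2 * u) ^ 2) * max h (u ^ 2) ≤ 4 * u ^ 2 * h := by
    rcases le_total h (u ^ 2) with h2 | h2
    · rw [max_eq_right h2]
      nlinarith [min_le_left h ((2 * u) ^ 2), sq_nonneg u, mul_nonneg hh (sq_nonneg u)]
    · rw [max_eq_left h2]
      nlinarith [min_le_right h ((2 * u) ^ 2)]
  have h2 : w * (10 * u) ^ (2 * n) * (28 * max h (u ^ 2)) *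
      (w * r ^ (2 * n) * (2 * min h ((2 * u) ^ 2))) ≤
      (15 * 10 ^ n * u ^ (n + 1)) ^ 2 * (w * (w * r ^ (2 * n) * h)) := by
    have e1 : w * (10 * u) ^ (2 * n) * (28 * max h (u ^ 2)) *
        (w * r ^ (2 * n) * (2 * min h ((2 * u) ^ 2))) =
        (w ^ 2 * (10 ^ n) ^ 2 * (u ^ n) ^ 2 * r ^ (2 * n)) *
          (56 * (min h ((2 * u) ^ 2) * max h (u ^ 2))) := by
      rw [mul_pow 10 u]; ring
    have e2 : (15 * 10 ^ n * u ^ (n + 1)) ^ 2 * (w * (w * r ^ (2 * n) * h)) =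
        (w ^ 2 * (10 ^ n) ^ 2 * (u ^ n) ^ 2 * r ^ (2 * n)) * (225 * (u ^ 2 * h)) := by
      ring
    rw [e1, e2]
    refine mul_le_mul_of_nonneg_left ?_ (by positivity)
    nlinarith [mul_nonneg (sq_nonneg u) hh]
  rw [← mul_div_assoc, ← Real.sqrt_mul (by positivity), div_le_div_iff₀ (by positivity) hu]
  have h3 := Real.sqrt_le_sqrt h2
  rw [Real.sqrt_mul (sq_nonneg (15 * 10 ^ n * u ^ (n + 1))), Real.sqrt_sq (by positivity),
    Real.sqrt_mul hw] at h3
  calc _ ≤ 15 * 10 ^ n * u ^ (n + 1) * (√w * √(w * r ^ (2 * n) * h)) * u :=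
        mul_le_mul_of_nonneg_right h3 hu.le
    _ = _ := by ring

section Estimates

variable {φ₁ : Heis n → ℂ} {φ₂ : ℝ → ℂ} {K : ℝ} (hF : FlagBounds φ₁ φ₂ K)
  {c : Heis n} {r h C : ℝ} {N : ℝ≥0∞} {A V : Fin n ⊕ Fin n → Heis n → ℂ} {D a : Heis n → ℂ}
  (hP : Precursor c r h C N A V D a) (hr : 0 < r) (hh : 0 < h) (hC : 0 ≤ C)

include hF hP hr hh hC in
-- Schur's test: the kernel has size `K u^(-(2n+3))` and meets the box in volume at most `unitVol n
-- * r^(2n) * 2 min(h, (2u)²)`, while its full `L¹` norm is at most `K/u`. The bound is the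
-- geometric mean of the two integrals.
lemma Precursor.eLpNorm_conv₁_V_le {u : ℝ} (hu : 0 < u) {E : Set ℝ} (hE : MeasurableSet E)
    (hEs : E ⊆ Set.Ioc u (2 * u)) (i : Fin n ⊕ Fin n) :
    eLpNorm (conv₁ (V i) ((heisGroup n).kerInt (horDeriv i φ₁) 1 E)) 2 volume ≤
      ENNReal.ofReal (K * (√(unitVol n * r ^ (2 * n) * (2 * min h ((2 * u) ^ 2))) / u ^ (n + 2)) *
        (C * r)) * N := by
  have hK := hF.nonneg
  have hb := hF.bump₁.horDeriv i
  have hw := (unitVol_pos (n := n)).le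
  have hs := eLpNorm_conv₁_le_of_lintegral_le (isClosed_box c r h).measurableSet (hP.V_mem i)
    ((heisGroup n).measurable_kerInt hb.continuous 1 E)
    (fun g' => setLIntegral_box_kernel_le
      ((heisGroup n).norm_kerInt_le hE (hF.sup i) 1 hu (by linarith) hEs)
      (fun x hx => kerInt_Ioc_eq_zero hb 1 hE hu hEs hx) c hr h g')
  set y := √(unitVol n * r ^ (2 * n) * (2 * min h ((2 * u) ^ 2))) / u ^ (n + 2) with hy
  have hy0 : 0 ≤ y := by positivity
  have e : ENNReal.ofReal (K * y * (C * r)) * N =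
      ENNReal.ofReal (K * y) * (ENNReal.ofReal (C * r) * N) := by
    rw [ENNReal.ofReal_mul (by positivity), mul_assoc]
  rw [e]
  refine hs.trans ?_
  refine mul_le_mul' ?_ (hP.V_le i)
  refine (ENNReal.rpow_le_rpow (mul_le_mul_right (hb.lintegral_kerInt_one_le hE hu (hF.hor i)
    fun x hx => (hEs hx).1) _) (by norm_num)).trans ?_
  have h2u : 0 ≤ 2 * u - u := by linarith
  rw [← ENNReal.ofReal_mul (by positivity), ← ENNReal.ofReal_mul (by positivity),
    ENNReal.ofReal_rpow_of_nonneg (by positivity) (by norm_num), ← Real.sqrt_eq_rpow]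
  refine ENNReal.ofReal_le_ofReal ?_
  rw [Real.sqrt_le_left (by positivity), mul_pow K y, hy, div_pow, Real.sq_sqrt (by positivity),
    show (heisGroup n).dim = 2 * n + 2 from rfl]
  refine le_of_eq ?_
  rw [← pow_mul, show (n + 2) * 2 = 2 * n + 4 by ring, show 1 + 1 + (2 * n + 2) = 2 * n + 4 by ring]
  field_simp
  ring

include hF hP hr hh hC in
-- No central derivative is used here: the central singular integral is merely bounded on `L²`, and
-- its scales up to `max h (u²)` enlarge the height of the support by a bounded factor at most.
lemma Precursor.lintegral_dyadic_low_le {u : ℝ} (hu : 0 < u) (hru : r ≤ 8 * u)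
    {E : Set ℝ} (hE : MeasurableSet E) (hEs : E ⊆ Set.Ioc u (2 * u)) {δ M : ℝ} (hδ : 0 < δ)
    (hM : M ≤ max h (u ^ 2)) :
    ∫⁻ g, ‖conv₂ (conv₁ a ((heisGroup n).kerInt φ₁ 0 E))
      (lineGroup.kerInt φ₂ 0 (Set.Ioc δ M)) g‖ₑ ≤
      ENNReal.ofReal (30 * n * 10 ^ n * √(unitVol n) * K ^ 2 * C * boxSize n r h * (r / u)) * N := by
  have hK := hF.nonneg
  have hb := hF.bump₁
  have hw := (unitVol_pos (n := n)).le
  have hk₁ := (heisGroup n).integrable_kerInt hb.continuous hb.integrable 0 hE hu hEs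
  have hk₂ := lineGroup.integrable_kerInt hF.bump₂.continuous hF.bump₂.integrable 0
    measurableSet_Ioc hδ (subset_refl (Set.Ioc δ M))
  have hmem := memLp_conv₁ hP.a_mem.memLp hk₁
  set y := √(unitVol n * r ^ (2 * n) * (2 * min h ((2 * u) ^ 2))) / u ^ (n + 2) with hy
  have hy0 : 0 ≤ y := by positivity
  have hL2 : eLpNorm (conv₁ a ((heisGroup n).kerInt φ₁ 0 E)) 2 volume ≤
      ENNReal.ofReal (2 * n * (K * y * (C * r))) * N := by
    rw [hP.V_hor φ₁ hb E _ _ hE hu hEs, ← sum_ofReal_mul]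
    have : (fun g => ∑ i, conv₁ (V i) ((heisGroup n).kerInt (horDeriv i φ₁) 1 E) g) =
        ∑ i, conv₁ (V i) ((heisGroup n).kerInt (horDeriv i φ₁) 1 E) := by
      ext g; simp
    rw [this]
    refine (eLpNorm_sum_le (fun i _ => aestronglyMeasurable_conv₁ (hP.V_mem i).memLp.1
      ((heisGroup n).measurable_kerInt (hb.horDeriv i).continuous 1 E)) (by norm_num)).trans ?_
    exact Finset.sum_le_sum fun i _ => hP.eLpNorm_conv₁_V_le hF hr hh hC hu hE hEs i
  have hsq : IsSquareOn (box c (r + 2 * u) (h + (2 * u) ^ 2 + r * (2 * u) / 2 + max h (u ^ 2)))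
      (conv₂ (conv₁ a ((heisGroup n).kerInt φ₁ 0 E)) (lineGroup.kerInt φ₂ 0 (Set.Ioc δ M))) :=
    ⟨memLp_conv₂ hmem hk₂, Eventually.of_forall fun g hg => conv₂_eq_zero
      (fun g' hg' => conv₁_eq_zero hP.a_mem.ae_eq_zero
        (fun x hx => kerInt_Ioc_eq_zero hb 0 hE hu hEs hx) hg')
      (fun v hv => lineGroup.kerInt_eq_zero measurableSet_Ioc hF.bump₂.eq_zero 0 hδ
        (subset_refl _) (hM.trans hv)) hg⟩
  have h1 := hsq.lintegral_le_of_box (by positivity)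
    -- From `r ≤ 8u` the width is at most `10u`, and twice the height is at most `2(1 + 4 + 8 + 1)
    -- max h (u²)`.
    (X := √(unitVol n * (10 * u) ^ (2 * n) * (28 * max h (u ^ 2))))
    (Y := K * (2 * n * (K * y * (C * r)))) (N := N) (Real.sqrt_nonneg _) (by
      have hm : 0 ≤ max h (u ^ 2) := hh.le.trans (le_max_left _ _)
      rw [Real.sq_sqrt (by positivity)]
      refine mul_le_mul (mul_le_mul_of_nonneg_left (pow_le_pow_left₀ (by positivity)
        (by linarith) _) hw) ?_ (by positivity) (by positivity)
      nlinarith [le_max_left h (u ^ 2), le_max_right h (u ^ 2)]) (by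
      refine (hF.op₂ δ M hδ _ hmem).trans ?_
      rw [ENNReal.ofReal_mul hK, mul_assoc]
      exact mul_le_mul_right hL2 _)
  refine h1.trans (mul_le_mul_left (ENNReal.ofReal_le_ofReal ?_) _)
  have h2 := sqrt_mul_sqrt_le hw hr.le hu hh.le n
  rw [← hy] at h2
  calc _ = (2 * n * K ^ 2 * C * r) *
        (√(unitVol n * (10 * u) ^ (2 * n) * (28 * max h (u ^ 2))) * y) := by ring
    _ ≤ (2 * n * K ^ 2 * C * r) *
        (15 * 10 ^ n * √(unitVol n) * √(unitVol n * r ^ (2 * n) * h) / u) :=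
      mul_le_mul_of_nonneg_left h2 (by positivity)
    _ = _ := by rw [boxSize]; ring

include hF hP hr hh hC in
-- Both derivatives of `A` are moved to the kernels: the horizontal one gains `1/u`, and the central
-- one gains `1/h` because all central scales exceed `h`.
lemma Precursor.lintegral_dyadic_high_le {u : ℝ} (hu : 0 < u)
    {E : Set ℝ} (hE : MeasurableSet E) (hEs : E ⊆ Set.Ioc u (2 * u)) {δ M : ℝ} (hδ : h ≤ δ) :
    ∫⁻ g, ‖conv₂ (conv₁ a ((heisGroup n).kerInt φ₁ 0 E))
      (lineGroup.kerInt φ₂ 0 (Set.Ioc δ M)) g‖ₑ ≤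
      ENNReal.ofReal (4 * n * K ^ 2 * C * boxSize n r h * (r / u)) * N := by
  have hK := hF.nonneg
  have hτ := boxSize_nonneg n r h
  have hb := hF.bump₁
  have hBm := (isClosed_box c r h).measurableSet
  have hBv := volume_box_lt_top c hr h
  have hb₂ := hF.bump₂.deriv
  have hδ0 := hh.trans_le hδ
  have hk₂ := lineGroup.integrable_kerInt hF.bump₂.continuous hF.bump₂.integrable 0
    measurableSet_Ioc hδ0 (subset_refl (Set.Ioc δ M))
  have e : ∀ g, conv₂ (conv₁ a ((heisGroup n).kerInt φ₁ 0 E))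
      (lineGroup.kerInt φ₂ 0 (Set.Ioc δ M)) g =
      ∑ i, conv₂ (conv₁ (A i) ((heisGroup n).kerInt (horDeriv i φ₁) 1 E))
        (lineGroup.kerInt (deriv φ₂) 1 (Set.Ioc δ M)) g := by
    intro g
    rw [hP.V_hor φ₁ hb E _ _ hE hu hEs, conv₂_sum
      (fun i => (hP.V_mem i).integrable hBm hBv)
      (fun i => (heisGroup n).measurable_kerInt (hb.horDeriv i).continuous 1 E)
      (fun i => (hb.horDeriv i).exists_kerInt_bound hE hu hEs 1) hk₂]
    exact Finset.sum_congr rfl fun i _ => conv₂_conv₁_kerInt (hb.horDeriv i) 1 hE hu hEs hF.bump₂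
      measurableSet_Ioc hδ0 (subset_refl _) ((hP.A_mem i).integrable hBm hBv)
      ((hP.V_mem i).integrable hBm hBv) (hP.A_vert i) g
  have hAm := fun i => aestronglyMeasurable_conv₁ (hP.A_mem i).memLp.1
    ((heisGroup n).measurable_kerInt (hb.horDeriv i).continuous 1 E)
  have hm₂ := lineGroup.measurable_kerInt hb₂.continuous 1 (Set.Ioc δ M)
  simp only [e]
  refine (lintegral_mono fun g => enorm_sum_le _ _).trans ?_
  rw [lintegral_finsetSum' _ fun i _ => (aestronglyMeasurable_conv₂ (hAm i) hm₂).enorm]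
  have hi : ∀ i, ∫⁻ g, ‖conv₂ (conv₁ (A i) ((heisGroup n).kerInt (horDeriv i φ₁) 1 E))
      (lineGroup.kerInt (deriv φ₂) 1 (Set.Ioc δ M)) g‖ₑ ≤
      ENNReal.ofReal (2 * K ^ 2 * C * boxSize n r h * (r / u)) * N := by
    intro i
    refine (lintegral_enorm_conv₂_le (hAm i) hm₂).trans ?_
    refine (mul_le_mul' (hb₂.lintegral_kerInt_one_le measurableSet_Ioc hh hF.vert
      fun x hx => hδ.trans_lt hx.1) (hP.lintegral_conv₁_A_le hF hr hh hC hE hu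
      (fun x hx => (hEs hx).1) i)).trans (le_of_eq ?_)
    rw [← mul_assoc, ← ENNReal.ofReal_mul (by positivity)]
    congr 2
    field_simp
  refine (Finset.sum_le_sum fun i _ => hi i).trans (le_of_eq ?_)
  rw [sum_ofReal_mul]
  congr 2
  ring

end Estimates

end FlagHeisenberg

end

/-! ### Summation of the scales off an enlarged box. -/

noncomputable section

namespace FlagHeisenberg

variable {n : ℕ}

/-- The constant in the estimate of the part of a flag kernel with a large Heisenberg scale. -/
def horConst (n : ℕ) (K C : ℝ) : ℝ :=
  30 * n * 10 ^ n * √(unitVol n) * K ^ 2 * C + 4 * n * K ^ 2 * C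

lemma horConst_nonneg (n : ℕ) (K : ℝ) {C : ℝ} (hC : 0 ≤ C) : 0 ≤ horConst n K C := by
  unfold horConst
  positivity

section Estimates

variable {φ₁ : Heis n → ℂ} {φ₂ : ℝ → ℂ} {K : ℝ} (hF : FlagBounds φ₁ φ₂ K)
  {c : Heis n} {r h C : ℝ} {N : ℝ≥0∞} {A V : Fin n ⊕ Fin n → Heis n → ℂ} {D a : Heis n → ℂ}
  (hP : Precursor c r h C N A V D a) (hr : 0 < r) (hh : 0 < h) (hC : 0 ≤ C)

include hF hP hr in
lemma Precursor.aestronglyMeasurable_flag (E E' : Set ℝ) :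
    AEStronglyMeasurable (conv₂ (conv₁ a ((heisGroup n).kerInt φ₁ 0 E))
      (lineGroup.kerInt φ₂ 0 E')) :=
  aestronglyMeasurable_conv₂ (aestronglyMeasurable_conv₁ hP.a_mem.memLp.1
    ((heisGroup n).measurable_kerInt hF.bump₁.continuous 0 E))
    (lineGroup.measurable_kerInt hF.bump₂.continuous 0 E')

include hF hP hr in
lemma Precursor.flag_union_left {E E' : Set ℝ} (hE : MeasurableSet E) (hE' : MeasurableSet E')
    (hd : Disjoint E E') {α β : ℝ} (hα : 0 < α) (hEs : E ⊆ Set.Ioc α β) (hEs' : E' ⊆ Set.Ioc α β)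
    {δ M : ℝ} (hδ : 0 < δ) (g : Heis n) :
    conv₂ (conv₁ a ((heisGroup n).kerInt φ₁ 0 (E ∪ E'))) (lineGroup.kerInt φ₂ 0 (Set.Ioc δ M)) g =
      conv₂ (conv₁ a ((heisGroup n).kerInt φ₁ 0 E)) (lineGroup.kerInt φ₂ 0 (Set.Ioc δ M)) g +
      conv₂ (conv₁ a ((heisGroup n).kerInt φ₁ 0 E')) (lineGroup.kerInt φ₂ 0 (Set.Ioc δ M)) g := by
  have hb := hF.bump₁
  have hm := fun E => (heisGroup n).measurable_kerInt hb.continuous 0 E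
  obtain ⟨M₀, hM₀⟩ := hb.exists_bound
  obtain ⟨M₁, hM₁⟩ := hb.exists_kerInt_bound hE hα hEs 0
  obtain ⟨M₂, hM₂⟩ := hb.exists_kerInt_bound hE' hα hEs' 0
  rw [← conv₂_conv₁_add_left (hP.a_mem.integrable (isClosed_box _ _ _).measurableSet
    (volume_box_lt_top c hr h)) (hm _) (hm _) hM₁ hM₂ (lineGroup.integrable_kerInt
    hF.bump₂.continuous hF.bump₂.integrable 0 measurableSet_Ioc hδ (subset_refl _))]
  congr 2
  exact funext fun x => (heisGroup n).kerInt_union hb.continuous hM₀ 0 hE hE' hd hα hEs hEs' x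

include hF hP hr in
lemma Precursor.flag_union_right {E : Set ℝ} (hE : MeasurableSet E)
    {α β : ℝ} (hα : 0 < α) (hEs : E ⊆ Set.Ioc α β) {δ M : ℝ} (hδ : 0 < δ) (η : ℝ) (g : Heis n) :
    conv₂ (conv₁ a ((heisGroup n).kerInt φ₁ 0 E)) (lineGroup.kerInt φ₂ 0 (Set.Ioc δ M)) g =
      conv₂ (conv₁ a ((heisGroup n).kerInt φ₁ 0 E))
        (lineGroup.kerInt φ₂ 0 (Set.Ioc δ (min M η))) g +
      conv₂ (conv₁ a ((heisGroup n).kerInt φ₁ 0 E))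
        (lineGroup.kerInt φ₂ 0 (Set.Ioc (max δ η) M)) g := by
  have hb := hF.bump₁
  have hb₂ := hF.bump₂
  obtain ⟨M₀, hM₀⟩ := hb₂.exists_bound
  obtain ⟨M₁, hM₁⟩ := hb.exists_kerInt_bound hE hα hEs 0
  have hs : Set.Ioc δ (min M η) ⊆ Set.Ioc δ M := Set.Ioc_subset_Ioc_right (min_le_left _ _)
  have hs' : Set.Ioc (max δ η) M ⊆ Set.Ioc δ M := Set.Ioc_subset_Ioc_left (le_max_left _ _)
  rw [← conv₂_conv₁_add_right (hP.a_mem.integrable (isClosed_box _ _ _).measurableSet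
    (volume_box_lt_top c hr h)) ((heisGroup n).measurable_kerInt hb.continuous 0 E) hM₁
    (lineGroup.integrable_kerInt hb₂.continuous hb₂.integrable 0 measurableSet_Ioc hδ hs)
    (lineGroup.integrable_kerInt hb₂.continuous hb₂.integrable 0 measurableSet_Ioc hδ hs'),
    Ioc_split δ M η]
  congr 1
  exact funext fun x => lineGroup.kerInt_union hb₂.continuous hM₀ 0 measurableSet_Ioc
    measurableSet_Ioc (Ioc_split_disjoint δ M η) hδ hs hs' x

include hF hP hr hh hC in
lemma Precursor.lintegral_dyadic_le {u : ℝ} (hu : 0 < u) (hru : r ≤ 8 * u)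
    {E : Set ℝ} (hE : MeasurableSet E) (hEs : E ⊆ Set.Ioc u (2 * u)) {δ M : ℝ} (hδ : 0 < δ) :
    ∫⁻ g, ‖conv₂ (conv₁ a ((heisGroup n).kerInt φ₁ 0 E))
      (lineGroup.kerInt φ₂ 0 (Set.Ioc δ M)) g‖ₑ ≤
      ENNReal.ofReal (horConst n K C * boxSize n r h * (r / u)) * N := by
  have hτ := boxSize_nonneg n r h
  -- At this central scale the height of the support starts to grow, so Cauchy–Schwarz is efficient
  -- below it; above it the central derivative gains at least `1/h`.
  set η := max h (u ^ 2)
  rw [lintegral_congr fun g => congrArg (fun z : ℂ => ‖z‖ₑ)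
    (hP.flag_union_right hF hr hE hu hEs hδ η g)]
  refine (lintegral_mono fun g => enorm_add_le _ _).trans ?_
  rw [lintegral_add_left' (hP.aestronglyMeasurable_flag hF hr _ _).enorm]
  refine (add_le_add (hP.lintegral_dyadic_low_le hF hr hh hC hu hru hE hEs hδ (min_le_right _ _))
    (hP.lintegral_dyadic_high_le hF hr hh hC hu hE hEs
      ((le_max_left h (u ^ 2)).trans (le_max_right δ _)))).trans (le_of_eq ?_)
  rw [← add_mul, ← ENNReal.ofReal_add (by positivity) (by positivity), horConst]
  congr 2
  ring

include hF hP hr hh hC in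
-- Geometric summation by induction: the block `(u, 2u]` costs `r/u`, and the rest, starting at
-- `2u`, costs `2 · r/(2u)`, which together make `2 · r/u` independently of `k`.
lemma Precursor.lintegral_horizontal_le_of_subset (k : ℕ) : ∀ {u : ℝ}, 0 < u → r ≤ 8 * u →
    ∀ {E : Set ℝ}, MeasurableSet E → E ⊆ Set.Ioc u (2 ^ k * u) → ∀ {δ M : ℝ}, 0 < δ →
    ∫⁻ g, ‖conv₂ (conv₁ a ((heisGroup n).kerInt φ₁ 0 E))
      (lineGroup.kerInt φ₂ 0 (Set.Ioc δ M)) g‖ₑ ≤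
      ENNReal.ofReal (2 * horConst n K C * boxSize n r h * (r / u)) * N := by
  have hτ := boxSize_nonneg n r h
  have hB := horConst_nonneg n K hC
  induction k with
  | zero =>
    intro u hu hru E hE hEs δ M hδ
    refine (hP.lintegral_dyadic_le hF hr hh hC hu hru hE (hEs.trans
      (Set.Ioc_subset_Ioc_right (by linarith))) hδ).trans ?_
    refine mul_le_mul_left (ENNReal.ofReal_le_ofReal ?_) _
    have : 0 ≤ horConst n K C * boxSize n r h * (r / u) := by positivity
    linarith
  | succ k ih =>
    intro u hu hru E hE hEs δ M hδ
    have h1 := hP.lintegral_dyadic_le hF hr hh hC hu hru (hE.inter measurableSet_Ioc)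
      (Set.inter_subset_right (s := E)) hδ (M := M)
    have hsub : E ∩ Set.Ioi (2 * u) ⊆ Set.Ioc (2 * u) (2 ^ k * (2 * u)) := fun x hx =>
      ⟨hx.2, (hEs hx.1).2.trans_eq (by ring)⟩
    have h2 := ih (u := 2 * u) (by linarith) (by linarith) (hE.inter measurableSet_Ioi) hsub hδ
      (M := M)
    have hE2 : E = (E ∩ Set.Ioc u (2 * u)) ∪ (E ∩ Set.Ioi (2 * u)) := by
      rw [← Set.inter_union_distrib_left, Set.Ioc_union_Ioi_eq_Ioi (by linarith)]
      exact (Set.inter_eq_left.2 fun x hx => (hEs hx).1).symm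
    have hd : Disjoint (E ∩ Set.Ioc u (2 * u)) (E ∩ Set.Ioi (2 * u)) :=
      Set.disjoint_left.2 fun x hx hx' => absurd hx.2.2 (not_le.2 hx'.2)
    rw [hE2]
    simp only [hP.flag_union_left hF hr (hE.inter measurableSet_Ioc) (hE.inter measurableSet_Ioi)
      hd hu (Set.inter_subset_left.trans hEs) (Set.inter_subset_left.trans hEs) hδ]
    refine (lintegral_mono fun g => enorm_add_le _ _).trans ?_
    rw [lintegral_add_left' (hP.aestronglyMeasurable_flag hF hr _ _).enorm]
    refine (add_le_add h1 h2).trans (le_of_eq ?_)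
    rw [← add_mul, ← ENNReal.ofReal_add (by positivity) (by positivity)]
    congr 2
    field_simp
    norm_num

include hF hP hr hh hC in
/-- The part of the flag kernel with a large Heisenberg scale. -/
theorem Precursor.lintegral_horizontal_le {u : ℝ} (hu : 0 < u) (hru : r ≤ 8 * u) (L : ℝ)
    {δ : ℝ} (hδ : 0 < δ) (M : ℝ) :
    ∫⁻ g, ‖conv₂ (conv₁ a ((heisGroup n).kerInt φ₁ 0 (Set.Ioc u L)))
      (lineGroup.kerInt φ₂ 0 (Set.Ioc δ M)) g‖ₑ ≤
      ENNReal.ofReal (2 * horConst n K C * boxSize n r h * (r / u)) * N := by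
  obtain ⟨k, hk⟩ := pow_unbounded_of_one_lt (L / u) one_lt_two
  refine hP.lintegral_horizontal_le_of_subset hF hr hh hC k hu hru measurableSet_Ioc
    (Set.Ioc_subset_Ioc_right ?_) hδ
  exact ((div_lt_iff₀ hu).1 hk).le

include hF hP hr hh hC in
/-- The truncated flag convolution of a particle off an enlarged box. -/
theorem Precursor.setLIntegral_flag_le (hrh : r ^ 2 ≤ h) {c' : Heis n} {R H : ℝ}
    (hbox : box c r h ⊆ box c' R H) {ε ρ L δ η M : ℝ} (hε : 0 < ε) (hερ : ε ≤ ρ) (hρL : ρ ≤ L)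
    (hrρ : r ≤ 8 * ρ) (hδ : 0 < δ) (hδη : δ ≤ η) (hηM : η ≤ M) :
    ∫⁻ g in (box c' (R + ρ) (H + ρ ^ 2 + R * ρ / 2 + η))ᶜ,
      ‖conv₂ (conv₁ a ((heisGroup n).kerInt φ₁ 0 (Set.Ioc ε L)))
        (lineGroup.kerInt φ₂ 0 (Set.Ioc δ M)) g‖ₑ ≤
      ENNReal.ofReal ((2 * horConst n K C * (r / ρ) +
        (3 * 2 ^ n + 4 * n) * K ^ 2 * C * (h / η)) * boxSize n r h) * N := by
  have hτ := boxSize_nonneg n r h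
  have hB := horConst_nonneg n K hC
  have hρ := hε.trans_le hερ
  have hη := hδ.trans_le hδη
  have hsplit : ∀ g ∈ (box c' (R + ρ) (H + ρ ^ 2 + R * ρ / 2 + η))ᶜ,
      ‖conv₂ (conv₁ a ((heisGroup n).kerInt φ₁ 0 (Set.Ioc ε L)))
        (lineGroup.kerInt φ₂ 0 (Set.Ioc δ M)) g‖ₑ ≤
      ‖conv₂ (conv₁ a ((heisGroup n).kerInt φ₁ 0 (Set.Ioc ρ L)))
        (lineGroup.kerInt φ₂ 0 (Set.Ioc δ M)) g‖ₑ +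
      ‖conv₂ (conv₁ a ((heisGroup n).kerInt φ₁ 0 (Set.Ioc ε ρ)))
        (lineGroup.kerInt φ₂ 0 (Set.Ioc η M)) g‖ₑ := by
    intro g hg
    -- When both scales are small, the kernels move the support of `a` no further than the enlarged
    -- box, so this corner of the double integral is not seen on the complement.
    have h0 : conv₂ (conv₁ a ((heisGroup n).kerInt φ₁ 0 (Set.Ioc ε ρ)))
        (lineGroup.kerInt φ₂ 0 (Set.Ioc δ η)) g = 0 :=
      conv₂_eq_zero (fun g' hg' => conv₁_eq_zero
        (hP.a_mem.ae_eq_zero.mono fun g h1 h2 => h1 fun h3 => h2 (hbox h3))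
        (fun x hx => kerInt_Ioc_eq_zero hF.bump₁ 0 measurableSet_Ioc hε (subset_refl _) hx) hg')
      (fun v hv => lineGroup.kerInt_eq_zero measurableSet_Ioc hF.bump₂.eq_zero 0 hδ
        (subset_refl _) hv) hg
    rw [← Set.Ioc_union_Ioc_eq_Ioc hερ hρL, hP.flag_union_left hF hr measurableSet_Ioc
      measurableSet_Ioc (Set.Ioc_disjoint_Ioc_of_le le_rfl) hε (Set.Ioc_subset_Ioc_right hρL)
      (Set.Ioc_subset_Ioc_left hερ) hδ,
      hP.flag_union_right hF hr measurableSet_Ioc hε (subset_refl (Set.Ioc ε ρ)) hδ η,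
      min_eq_right hηM, max_eq_right hδη, h0, zero_add, add_comm]
    exact enorm_add_le _ _
  refine (setLIntegral_mono' (isClosed_box _ _ _).measurableSet.compl hsplit).trans ?_
  refine (setLIntegral_le_lintegral _ _).trans ?_
  rw [lintegral_add_left' (hP.aestronglyMeasurable_flag hF hr _ _).enorm]
  refine (add_le_add (hP.lintegral_horizontal_le hF hr hh hC hρ hrρ L hδ M)
    (hP.lintegral_central_le hF hr hh hC hrh hε hη)).trans (le_of_eq ?_)
  rw [← add_mul, ← ENNReal.ofReal_add (by positivity) (by positivity)]
  congr 2
  ring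

end Estimates

end FlagHeisenberg

end

/-! ### Existence of the flag convolution in `L²`. -/

noncomputable section

namespace FlagHeisenberg

namespace UnitaryRep

variable {G : Type*} [NormedAddCommGroup G] [NormedSpace ℝ G] [FiniteDimensional ℝ G]
  [MeasureSpace G] [BorelSpace G]
  [SecondCountableTopology G] [(volume : Measure G).IsAddHaarMeasure] {𝔾 : HomogeneousGroup G}
  {H : Type*} [NormedAddCommGroup H] [InnerProductSpace ℂ H] [CompleteSpace H]
  (ρ : UnitaryRep 𝔾 H)

/-- Convergence of truncated singular integrals at a vector for which the large scales are
absolutely convergent. -/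
theorem exists_tendsto_opr_kerInt_of_le {ψ : G → ℂ} (hψ : IsBump 𝔾 ψ) (h0 : ∫ x, ψ x = 0) {x : H}
    {B : ℝ} (hB : 0 ≤ B)
    (hlarge : ∀ M N, 1 ≤ M → M ≤ N → ‖ρ.opr (𝔾.kerInt ψ 0 (Set.Ioc M N)) x‖ ≤ B / M) :
    ∃ z, Tendsto (fun p : ℝ × ℝ => ρ.opr (𝔾.kerInt ψ 0 (Set.Ioc p.1 p.2)) x)
      (𝓝[>] 0 ×ˢ atTop) (𝓝 z) := by
  have hu : ∀ {ε M N : ℝ}, 0 < ε → ε ≤ M → M ≤ N →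
      ρ.opr (𝔾.kerInt ψ 0 (Set.Ioc ε N)) x =
        ρ.opr (𝔾.kerInt ψ 0 (Set.Ioc ε M)) x + ρ.opr (𝔾.kerInt ψ 0 (Set.Ioc M N)) x := by
    intro ε M N hε h1 h2
    rw [← Set.Ioc_union_Ioc_eq_Ioc h1 h2, ρ.opr_kerInt_union hψ.continuous hψ.hasCompactSupport
      measurableSet_Ioc measurableSet_Ioc (Set.Ioc_disjoint_Ioc_of_le le_rfl) hε
      (Set.Ioc_subset_Ioc_right h2) (Set.Ioc_subset_Ioc_left h1)]
    rfl
  obtain ⟨z₁, hz₁⟩ := ρ.exists_tendsto_opr_kerInt hψ.contDiff hψ.hasCompactSupport h0 hψ.eq_zero x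
  have hc : CauchySeq fun N : ℝ => ρ.opr (𝔾.kerInt ψ 0 (Set.Ioc 1 N)) x := by
    refine Metric.cauchySeq_iff'.2 fun ε hε => ⟨B / ε + 1, fun N hN => ?_⟩
    have h1 : 1 ≤ B / ε + 1 := le_add_of_nonneg_left (by positivity)
    rw [dist_eq_norm, hu one_pos h1 hN, add_sub_cancel_left]
    refine (hlarge _ _ h1 hN).trans_lt ?_
    rw [div_lt_iff₀ (by linarith), mul_add, mul_one, mul_div_cancel₀ _ hε.ne']
    linarith
  obtain ⟨z₂, hz₂⟩ := cauchySeq_tendsto_of_complete hc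
  -- Cutting at scale 1 separates the two truncations, so their limits are independent.
  refine ⟨z₁ + z₂, ((hz₁.comp tendsto_fst).add (hz₂.comp tendsto_snd)).congr' ?_⟩
  have h1 : ∀ᶠ ε : ℝ in 𝓝[>] 0, 0 < ε ∧ ε ≤ 1 := by
    filter_upwards [self_mem_nhdsWithin,
      mem_nhdsWithin_of_mem_nhds (Iic_mem_nhds (zero_lt_one (α := ℝ)))] with ε h1 h2 using ⟨h1, h2⟩
  filter_upwards [h1.prod_mk (eventually_ge_atTop (1 : ℝ))] with p hp
  exact (hu hp.1.1 hp.1.2 hp.2).symm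

end UnitaryRep

variable {n : ℕ}

lemma conv₁_kerInt (f φ : Heis n → ℂ) (m : ℕ) (E : Set ℝ) :
    conv₁ f ((heisGroup n).kerInt φ m E) =
      (heisAction n).aconv ((heisGroup n).kerInt (fun x => φ (-x)) m E) f := by
  rw [conv₁_eq_aconv]
  congr 1
  exact funext fun x => (heisGroup n).kerInt_neg φ m E x

lemma conv₂_kerInt (f : Heis n → ℂ) (φ : ℝ → ℂ) (m : ℕ) (E : Set ℝ) :
    conv₂ f (lineGroup.kerInt φ m E) =
      (centralAction n).aconv (lineGroup.kerInt (fun x => φ (-x)) m E) f := by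
  rw [conv₂_eq_aconv]
  congr 1
  exact funext fun x => lineGroup.kerInt_neg φ m E x

lemma integral_norm_le_of_lintegral_le {G : Type*} [MeasureSpace G] {k : G → ℂ} {X : ℝ}
    (hX : 0 ≤ X) (hk : Integrable k) (h : ∫⁻ x, ‖k x‖ₑ ≤ ENNReal.ofReal X) : ∫ x, ‖k x‖ ≤ X := by
  rw [integral_norm_eq_lintegral_enorm hk.1]
  exact ENNReal.toReal_le_of_le_ofReal hX h

lemma eLpNorm_conv₁_le {f k : Heis n → ℂ} {X : ℝ} (hX : 0 ≤ X) (hf : MemLp f 2) (hk : Integrable k)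
    (h : ∫⁻ x, ‖k x‖ₑ ≤ ENNReal.ofReal X) :
    eLpNorm (conv₁ f k) 2 volume ≤ ENNReal.ofReal X * eLpNorm f 2 volume := by
  rw [conv₁_eq_aconv]
  refine (heisAction n).eLpNorm_aconv_le_of_norm_opr_le hk.comp_neg hf
    (((heisAction n).rep.norm_opr_le _).trans ?_)
  rw [integral_neg_eq_self fun x => ‖k x‖]
  exact integral_norm_le_of_lintegral_le hX hk h

lemma eLpNorm_conv₂_le {f : Heis n → ℂ} {k : ℝ → ℂ} {X : ℝ} (hX : 0 ≤ X) (hf : MemLp f 2)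
    (hk : Integrable k) (h : ∫⁻ x, ‖k x‖ₑ ≤ ENNReal.ofReal X) :
    eLpNorm (conv₂ f k) 2 volume ≤ ENNReal.ofReal X * eLpNorm f 2 volume := by
  rw [conv₂_eq_aconv]
  refine (centralAction n).eLpNorm_aconv_le_of_norm_opr_le hk.comp_neg hf
    (((centralAction n).rep.norm_opr_le _).trans ?_)
  rw [integral_neg_eq_self fun x => ‖k x‖]
  exact integral_norm_le_of_lintegral_le hX hk h

/-- A sum of nonnegative bounds serves as the common constant. The operator bounds are those of the
reflected functions `φ(-x)`, since convolution integrates translations against the reflected kernel;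
reflection preserves smoothness, support in the unit ball and mean zero. -/
theorem exists_flagBounds {φ₁ : Heis n → ℂ} {φ₂ : ℝ → ℂ} (h₁ : IsBump (heisGroup n) φ₁)
    (h₂ : IsBump lineGroup φ₂) (hm₁ : ∫ g, φ₁ g = 0) (hm₂ : ∫ v, φ₂ v = 0) :
    ∃ K, FlagBounds φ₁ φ₂ K := by
  have hn₁ := h₁.comp_neg
  have hn₂ := h₂.comp_neg_line
  obtain ⟨K₁, hK₁, hop₁⟩ := (heisAction n).rep.exists_norm_opr_kerInt_le hn₁.contDiff
    hn₁.hasCompactSupport (by rw [integral_neg_eq_self φ₁, hm₁]) hn₁.eq_zero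
  obtain ⟨K₂, hK₂, hop₂⟩ := (centralAction n).rep.exists_norm_opr_kerInt_le hn₂.contDiff
    hn₂.hasCompactSupport (by rw [integral_neg_eq_self φ₂, hm₂]) hn₂.eq_zero
  choose M hM using fun i => (h₁.horDeriv i).exists_bound
  have hi := fun i => (h₁.horDeriv i).integrable
  have hi₂ := h₂.deriv.integrable
  set S₁ := ∑ i, |M i| with hS₁
  set S₂ := ∑ i, ∫ x, ‖horDeriv i φ₁ x‖ with hS₂
  set S₃ := ∫ x, ‖deriv φ₂ x‖
  have hS₁0 : 0 ≤ S₁ := Finset.sum_nonneg fun i _ => abs_nonneg _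
  have hS₂0 : 0 ≤ S₂ := Finset.sum_nonneg fun i _ => integral_nonneg fun _ => norm_nonneg _
  have hS₃0 : 0 ≤ S₃ := integral_nonneg fun _ => norm_nonneg _
  refine ⟨K₁ + K₂ + S₁ + S₂ + S₃, by positivity, h₁, h₂, fun ε N hε f hf => ?_,
    fun ε N hε f hf => ?_, fun i x => ?_, fun i => ?_, ?_⟩
  · rw [conv₁_kerInt]
    exact (heisAction n).eLpNorm_aconv_le_of_norm_opr_le ((heisGroup n).integrable_kerInt
      hn₁.continuous hn₁.integrable 0 measurableSet_Ioc hε (subset_refl _)) hf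
      ((hop₁ ε N hε).trans (by linarith))
  · rw [conv₂_kerInt]
    exact (centralAction n).eLpNorm_aconv_le_of_norm_opr_le (lineGroup.integrable_kerInt
      hn₂.continuous hn₂.integrable 0 measurableSet_Ioc hε (subset_refl _)) hf
      ((hop₂ ε N hε).trans (by linarith))
  · have := Finset.single_le_sum (f := fun i => |M i|) (fun i _ => abs_nonneg _)
      (Finset.mem_univ i)
    linarith [hM i x, le_abs_self (M i)]
  · rw [← ofReal_integral_norm_eq_lintegral_enorm (hi i)]
    refine ENNReal.ofReal_le_ofReal ?_
    have := Finset.single_le_sum (f := fun i => ∫ x, ‖horDeriv i φ₁ x‖)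
      (fun i _ => integral_nonneg fun _ => norm_nonneg _) (Finset.mem_univ i)
    linarith
  · rw [← ofReal_integral_norm_eq_lintegral_enorm hi₂]
    exact ENNReal.ofReal_le_ofReal (by linarith)

section Convergence

variable {φ₁ : Heis n → ℂ} {φ₂ : ℝ → ℂ} {K : ℝ} (hF : FlagBounds φ₁ φ₂ K)
  (hm₁ : ∫ g, φ₁ g = 0) (hm₂ : ∫ v, φ₂ v = 0)
  {c : Heis n} {r h C : ℝ} {N : ℝ≥0∞} {A V : Fin n ⊕ Fin n → Heis n → ℂ} {D a : Heis n → ℂ}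
  (hP : Precursor c r h C N A V D a) (hN : N < ⊤) (hr : 0 < r) (hh : 0 < h) (hC : 0 ≤ C)

include hF hP hr hC in
-- The decay `1/M` obtained from `a = ∇₍₁₎ · V` is the input that makes the limit at large
-- Heisenberg scales exist for a particle.
lemma Precursor.eLpNorm_conv₁_large_le {M L : ℝ} (hM : 0 < M) :
    eLpNorm (conv₁ a ((heisGroup n).kerInt φ₁ 0 (Set.Ioc M L))) 2 volume ≤
      ENNReal.ofReal (2 * n * (M⁻¹ * K * (C * r))) * N := by
  have hK := hF.nonneg
  have hb := hF.bump₁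
  rw [hP.V_hor φ₁ hb _ _ _ measurableSet_Ioc hM (subset_refl (Set.Ioc M L)), ← sum_ofReal_mul]
  have : (fun g => ∑ i, conv₁ (V i) ((heisGroup n).kerInt (horDeriv i φ₁) 1 (Set.Ioc M L)) g) =
      ∑ i, conv₁ (V i) ((heisGroup n).kerInt (horDeriv i φ₁) 1 (Set.Ioc M L)) := by
    ext g; simp
  rw [this]
  refine (eLpNorm_sum_le (fun i _ => aestronglyMeasurable_conv₁ (hP.V_mem i).memLp.1
    ((heisGroup n).measurable_kerInt (hb.horDeriv i).continuous 1 _)) (by norm_num)).trans ?_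
  refine Finset.sum_le_sum fun i _ => ?_
  rw [ENNReal.ofReal_mul (by positivity), mul_assoc]
  refine (eLpNorm_conv₁_le (by positivity) (hP.V_mem i).memLp ((heisGroup n).integrable_kerInt
    (hb.horDeriv i).continuous (hb.horDeriv i).integrable 1 measurableSet_Ioc hM (subset_refl _))
    ((hb.horDeriv i).lintegral_kerInt_one_le measurableSet_Ioc hM (hF.hor i) fun x hx => hx.1)).trans
    (mul_le_mul_right (hP.V_le i) _)

include hF hP hr hh hC in
-- The central derivative in `a = ∂_t D` gives `1/M`, while the Heisenberg kernel acts on `D` with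
-- its uniform operator norm; the bound therefore does not depend on ε and `L`.
lemma Precursor.eLpNorm_conv₂_large_le {ε L : ℝ} (hε : 0 < ε) {M M' : ℝ} (hM : 0 < M) :
    eLpNorm (conv₂ (conv₁ a ((heisGroup n).kerInt φ₁ 0 (Set.Ioc ε L)))
      (lineGroup.kerInt φ₂ 0 (Set.Ioc M M'))) 2 volume ≤
      ENNReal.ofReal (M⁻¹ * K * (K * (C * h))) * N := by
  have hK := hF.nonneg
  have hb := hF.bump₂.deriv
  have hBm := (isClosed_box c r h).measurableSet
  have hBv := volume_box_lt_top c hr h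
  rw [funext (conv₂_conv₁_kerInt hF.bump₁ 0 measurableSet_Ioc hε (subset_refl _) hF.bump₂
    measurableSet_Ioc hM (subset_refl _) (hP.D_mem.integrable hBm hBv)
    (hP.a_mem.integrable hBm hBv) hP.D_vert)]
  refine (eLpNorm_conv₂_le (by positivity) (memLp_conv₁ hP.D_mem.memLp
    ((heisGroup n).integrable_kerInt hF.bump₁.continuous hF.bump₁.integrable 0 measurableSet_Ioc hε
    (subset_refl _))) (lineGroup.integrable_kerInt hb.continuous hb.integrable 1 measurableSet_Ioc
    hM (subset_refl _)) (hb.lintegral_kerInt_one_le measurableSet_Ioc hM hF.vert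
    fun x hx => hx.1)).trans ?_
  rw [ENNReal.ofReal_mul (p := M⁻¹ * K) (q := K * (C * h)) (by positivity), ENNReal.ofReal_mul hK,
    mul_assoc, mul_assoc]
  exact mul_le_mul_right ((hF.op₁ ε L hε D hP.D_mem.memLp).trans (mul_le_mul_right hP.D_le _)) _

include hF hm₁ hm₂ hP hN hr hh hC in
/-- The truncated flag convolutions of a particle converge in `L²`. -/
theorem Precursor.exists_isFlagConv : ∃ F, IsFlagConv φ₁ φ₂ a F := by
  have hK := hF.nonneg
  have hn₁ := hF.bump₁.comp_neg
  have hn₂ := hF.bump₂.comp_neg_line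
  have ha := hP.a_mem.memLp
  have hk₁ : ∀ {ε L : ℝ}, 0 < ε →
      Integrable ((heisGroup n).kerInt (fun x => φ₁ (-x)) 0 (Set.Ioc ε L)) := fun hε =>
    (heisGroup n).integrable_kerInt hn₁.continuous hn₁.integrable 0 measurableSet_Ioc hε
      (subset_refl _)
  have hk₂ : ∀ {ε L : ℝ}, 0 < ε →
      Integrable (lineGroup.kerInt (fun x => φ₂ (-x)) 0 (Set.Ioc ε L)) := fun hε =>
    lineGroup.integrable_kerInt hn₂.continuous hn₂.integrable 0 measurableSet_Ioc hε
      (subset_refl _)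
  have hof : ∀ {x : ℝ}, 0 ≤ x → (ENNReal.ofReal x * N).toReal = x * N.toReal := fun hx => by
    rw [ENNReal.toReal_mul, ENNReal.toReal_ofReal hx]
  obtain ⟨b, hb⟩ := (heisAction n).rep.exists_tendsto_opr_kerInt_of_le hn₁
    (by rw [integral_neg_eq_self φ₁, hm₁]) (x := ha.toLp a)
    (B := 2 * n * (K * (C * r)) * N.toReal) (by positivity) fun M L hM _ => by
      have hM0 := zero_lt_one.trans_le hM
      rw [← (heisAction n).toLp_aconv (hk₁ hM0) ha, Lp.norm_toLp]
      have h1 := hP.eLpNorm_conv₁_large_le hF hr hC hM0 (L := L)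
      rw [conv₁_kerInt] at h1
      refine (ENNReal.toReal_mono (ENNReal.mul_lt_top ENNReal.ofReal_lt_top hN).ne h1).trans
        (le_of_eq ?_)
      rw [hof (by positivity)]
      ring
  have hR : ∃ C', ∀ ε L : ℝ, 0 < ε → ‖(centralAction n).rep.opr
      (lineGroup.kerInt (fun x => φ₂ (-x)) 0 (Set.Ioc ε L))‖ ≤ C' := by
    obtain ⟨C', -, h⟩ := (centralAction n).rep.exists_norm_opr_kerInt_le hn₂.contDiff
      hn₂.hasCompactSupport (by rw [integral_neg_eq_self φ₂, hm₂]) hn₂.eq_zero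
    exact ⟨C', h⟩
  obtain ⟨C', hC'⟩ := hR
  have hpos : ∀ᶠ p : ℝ × ℝ in 𝓝[>] 0 ×ˢ atTop, 0 < p.1 :=
    tendsto_fst.eventually self_mem_nhdsWithin
  have hcomp : ∀ {ε L : ℝ}, 0 < ε → ∀ {δ M : ℝ}, 0 < δ →
      (centralAction n).rep.opr (lineGroup.kerInt (fun x => φ₂ (-x)) 0 (Set.Ioc δ M))
        ((heisAction n).rep.opr ((heisGroup n).kerInt (fun x => φ₁ (-x)) 0 (Set.Ioc ε L))
          (ha.toLp a)) =ᵐ[volume]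
      conv₂ (conv₁ a ((heisGroup n).kerInt φ₁ 0 (Set.Ioc ε L)))
        (lineGroup.kerInt φ₂ 0 (Set.Ioc δ M)) := by
    intro ε L hε δ M hδ
    rw [← (heisAction n).toLp_aconv (hk₁ hε) ha, conv₂_kerInt, conv₁_kerInt]
    exact (centralAction n).opr_toLp_ae_eq (hk₂ hδ) _
  -- The Heisenberg truncations of `a` converge to `b`, and the central operators converge at each
  -- of these truncations; uniform boundedness upgrades this to a limit along the product filter.
  obtain ⟨z, hz⟩ := tendsto_comp_of_tendsto (l' := 𝓝[>] (0 : ℝ) ×ˢ (atTop : Filter ℝ))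
    (R := fun p : ℝ × ℝ => (centralAction n).rep.opr
      (lineGroup.kerInt (fun x => φ₂ (-x)) 0 (Set.Ioc p.1 p.2)))
    (hpos.mono fun p hp => hC' p.1 p.2 hp) hb (hpos.mono fun p hp => by
      refine (centralAction n).rep.exists_tendsto_opr_kerInt_of_le hn₂
        (by rw [integral_neg_eq_self φ₂, hm₂]) (B := K * (K * (C * h)) * N.toReal) (by positivity)
        fun M M' hM _ => ?_
      have hM0 := zero_lt_one.trans_le hM
      rw [Lp.norm_def, eLpNorm_congr_ae (hcomp hp hM0)]
      refine (ENNReal.toReal_mono (ENNReal.mul_lt_top ENNReal.ofReal_lt_top hN).ne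
        (hP.eLpNorm_conv₂_large_le hF hr hh hC hp hM0)).trans (le_of_eq ?_)
      rw [hof (by positivity)]
      ring)
  refine ⟨z, Lp.memLp z, ?_⟩
  rw [tendsto_iff_edist_tendsto_0] at hz
  refine hz.congr' ?_
  filter_upwards [hpos.prod_mk hpos] with p hp
  rw [Lp.edist_def]
  refine eLpNorm_congr_ae ?_
  filter_upwards [hcomp hp.1 hp.2] with g hg
  obtain ⟨M, hM⟩ := hF.bump₁.exists_kerInt_bound measurableSet_Ioc hp.1
    (subset_refl (Set.Ioc p.1.1 p.1.2)) 0
  rw [Pi.sub_apply, hg, truncKernel_eq hF.bump₁ hF.bump₂ hp.1 hp.2,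
    conv₁_conv₂ (hP.a_mem.integrable (isClosed_box c r h).measurableSet (volume_box_lt_top c hr h))
    ((heisGroup n).measurable_kerInt hF.bump₁.continuous _ _) hM
    (lineGroup.integrable_kerInt hF.bump₂.continuous hF.bump₂.integrable 0 measurableSet_Ioc hp.2
      (subset_refl _))]

end Convergence

end FlagHeisenberg

end

/-! ### Passage to the limit and the estimates for tubes. -/

noncomputable section

namespace FlagHeisenberg

variable {n : ℕ}

lemma isBump_heis {φ : Heis n → ℂ} (hφ : ContDiff ℝ ∞ φ) (hs : tsupport φ ⊆ ball₁ n 1) :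
    IsBump (heisGroup n) φ := by
  refine ⟨hφ, ?_, hs⟩
  refine Metric.isCompact_of_isClosed_isBounded (isClosed_tsupport _)
    ((Metric.isBounded_closedBall (x := (0 : Heis n)) (r := 1)).subset fun g hg => ?_)
  have h1 : koranyi g < 1 := hs hg
  rw [mem_closedBall_zero_iff, Prod.norm_def, max_le_iff]
  exact ⟨(norm_le_znorm _).trans ((znorm_le_koranyi g).trans h1.le),
    (abs_snd_le_koranyi_sq g).trans (pow_le_one₀ (koranyi_nonneg g) h1.le)⟩

lemma isBump_line {φ : ℝ → ℂ} (hφ : ContDiff ℝ ∞ φ) (hs : tsupport φ ⊆ ball₂ 1) :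
    IsBump lineGroup φ := by
  refine ⟨hφ, ?_, hs⟩
  refine Metric.isCompact_of_isClosed_isBounded (isClosed_tsupport _)
    ((Metric.isBounded_closedBall (x := (0 : ℝ)) (r := 1)).subset fun v hv => ?_)
  have h1 : |v| < 1 := hs hv
  rw [mem_closedBall_zero_iff]
  exact h1.le

lemma Tube.ofReal_boxSize_le (T : Tube n) :
    ENNReal.ofReal (boxSize n T.r T.height) ≤
      ENNReal.ofReal ((4 / 3) ^ n) * volume T.carrier ^ (1 / 2 : ℝ) := by
  have hw := unitVol_pos (n := n)
  have hr := T.r_pos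
  have hh := T.height_pos
  have h1 := ENNReal.rpow_le_rpow T.ofReal_le_volume_carrier (by norm_num : (0 : ℝ) ≤ 1 / 2)
  rw [ENNReal.mul_rpow_of_nonneg _ _ (by norm_num),
    ENNReal.ofReal_rpow_of_nonneg (by positivity) (by norm_num), ← Real.sqrt_eq_rpow,
    ENNReal.ofReal_rpow_of_nonneg (by positivity) (by norm_num), ← Real.sqrt_eq_rpow, show
      ((4 / 3 : ℝ)) ^ (2 * n) = ((4 / 3) ^ n) ^ 2 by rw [← pow_mul, mul_comm],
    Real.sqrt_sq (by positivity)] at h1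
  exact h1

section Limit

variable {φ₁ : Heis n → ℂ} {φ₂ : ℝ → ℂ} {K : ℝ} (hF : FlagBounds φ₁ φ₂ K)
  {c : Heis n} {r h C : ℝ} {N : ℝ≥0∞} {A V : Fin n ⊕ Fin n → Heis n → ℂ} {D a : Heis n → ℂ}
  (hP : Precursor c r h C N A V D a) (hr : 0 < r)

include hF hP hr in
/-- Fatou's lemma for the truncated flag convolutions. -/
lemma Precursor.setLIntegral_le_of_isFlagConv {F : Heis n → ℂ} (hFl : IsFlagConv φ₁ φ₂ a F)
    {W : Set (Heis n)} {ρ η : ℝ} (hρ : 0 < ρ) (hη : 0 < η) {X : ℝ≥0∞}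
    (hX : ∀ ε L δ M, 0 < ε → ε ≤ ρ → ρ ≤ L → 0 < δ → δ ≤ η → η ≤ M →
      ∫⁻ g in W, ‖conv₂ (conv₁ a ((heisGroup n).kerInt φ₁ 0 (Set.Ioc ε L)))
        (lineGroup.kerInt φ₂ 0 (Set.Ioc δ M)) g‖ₑ ≤ X) :
    ∫⁻ g in W, ‖F g‖ₑ ≤ X := by
  set ε : ℕ → ℝ := fun k => 1 / ((k : ℝ) + 1) with hε
  set L : ℕ → ℝ := fun k => (k : ℝ) with hL
  have hε0 : ∀ k, 0 < ε k := fun k => Nat.one_div_pos_of_nat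
  have hεt : Tendsto ε atTop (𝓝 0) := tendsto_one_div_add_atTop_nhds_zero_nat
  have hεt' : Tendsto ε atTop (𝓝[>] 0) :=
    tendsto_nhdsWithin_iff.2 ⟨hεt, Eventually.of_forall hε0⟩
  have hLt : Tendsto L atTop atTop := tendsto_natCast_atTop_atTop
  have hseq : Tendsto (fun k => ((ε k, L k), (ε k, L k))) atTop
      ((𝓝[>] 0 ×ˢ atTop) ×ˢ (𝓝[>] 0 ×ˢ atTop)) :=
    (hεt'.prodMk hLt).prodMk (hεt'.prodMk hLt)
  set G : ℕ → Heis n → ℂ := fun k => conv₂ (conv₁ a ((heisGroup n).kerInt φ₁ 0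
    (Set.Ioc (ε k) (L k)))) (lineGroup.kerInt φ₂ 0 (Set.Ioc (ε k) (L k))) with hG
  have hGm : ∀ k, AEStronglyMeasurable (G k) := fun k => hP.aestronglyMeasurable_flag hF hr _ _
  have hconv : Tendsto (fun k => eLpNorm (G k - F) 2 volume) atTop (𝓝 0) := by
    refine (hFl.2.comp hseq).congr fun k => ?_
    refine congrArg (fun u : Heis n → ℂ => eLpNorm u 2 volume) (funext fun g => ?_)
    obtain ⟨M, hM⟩ := hF.bump₁.exists_kerInt_bound measurableSet_Ioc (hε0 k)
      (subset_refl (Set.Ioc (ε k) (L k))) 0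
    rw [Pi.sub_apply]
    simp only
    rw [truncKernel_eq hF.bump₁ hF.bump₂ (hε0 k) (hε0 k),
      conv₁_conv₂ (hP.a_mem.integrable (isClosed_box c r h).measurableSet
        (volume_box_lt_top c hr h))
      ((heisGroup n).measurable_kerInt hF.bump₁.continuous _ _) hM
      (lineGroup.integrable_kerInt hF.bump₂.continuous hF.bump₂.integrable 0 measurableSet_Ioc
        (hε0 k) (subset_refl _))]
  -- Convergence in `L²` along one sequence of truncations gives convergence almost everywhere along
  -- a subsequence, as Fatou's lemma requires.
  obtain ⟨ns, hns, hae⟩ := (tendstoInMeasure_of_tendsto_eLpNorm (by norm_num) hGm hFl.1.1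
    hconv).exists_seq_tendsto_ae'
  have h1 : ∫⁻ g in W, ‖F g‖ₑ = ∫⁻ g in W, liminf (fun k => ‖G (ns k) g‖ₑ) atTop := by
    refine lintegral_congr_ae (ae_restrict_of_ae ?_)
    filter_upwards [hae] with g hg
    exact hg.enorm.liminf_eq.symm
  rw [h1]
  refine (lintegral_liminf_le' fun k => (hGm (ns k)).enorm.restrict).trans ?_
  suffices hev : ∀ᶠ k in atTop, ∫⁻ g in W, ‖G k g‖ₑ ≤ X from
    liminf_le_of_frequently_le' (hns.eventually hev).frequently
  filter_upwards [hεt.eventually (Iic_mem_nhds hρ), hεt.eventually (Iic_mem_nhds hη),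
    hLt.eventually_ge_atTop ρ, hLt.eventually_ge_atTop η] with k h2 h3 h4 h5
  exact hX _ _ _ _ (hε0 k) h2 h4 (hε0 k) h3 h5

end Limit

/-- The constant in the estimate of a flag singular integral of a particle. -/
def flagConst (n : ℕ) (K C : ℝ) : ℝ :=
  16 * (2 * horConst n K C + (3 * 2 ^ n + 4 * n) * K ^ 2 * C) * (4 / 3) ^ n

lemma flagConst_nonneg (n : ℕ) (K : ℝ) {C : ℝ} (hC : 0 ≤ C) : 0 ≤ flagConst n K C := by
  have := horConst_nonneg n K hC
  unfold flagConst
  positivity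

section Tubes

variable {φ₁ : Heis n → ℂ} {φ₂ : ℝ → ℂ} {K : ℝ} (hF : FlagBounds φ₁ φ₂ K)
  {T S : Tube n} {C : ℝ} {N : ℝ≥0∞} {A V : Fin n ⊕ Fin n → Heis n → ℂ} {D a : Heis n → ℂ}
  (hP : Precursor T.center T.r T.height C N A V D a) (hC : 0 ≤ C)

include hF hP hC in
-- Common form of the two estimates; they differ only in the box about which the support is
-- enlarged. The thresholds `S.r / 16` and `S.height / 16` turn the gains `r/ρ` and `h/η` into 16
-- times the two terms of `T.rho S`, and `8 · S.r / 16 = S.r / 2 ≥ T.r` meets the requirement of the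
-- dyadic estimate.
theorem Precursor.setLIntegral_compl_tube_le (hTS : 2 * T.r ≤ S.r) {F : Heis n → ℂ}
    (hFl : IsFlagConv φ₁ φ₂ a F) {c' : Heis n} {R H : ℝ}
    (hbox : box T.center T.r T.height ⊆ box c' R H) {S' : Set (Heis n)}
    (hS' : box c' (R + S.r / 16) (H + (S.r / 16) ^ 2 + R * (S.r / 16) / 2 + S.height / 16) ⊆ S') :
    ∫⁻ g in S'ᶜ, ‖F g‖ₑ ≤
      ENNReal.ofReal (flagConst n K C * T.rho S) * volume T.carrier ^ (1 / 2 : ℝ) * N := by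
  have hR := S.r_pos
  have hH := S.height_pos
  have hr := T.r_pos
  have hh := T.height_pos
  have hB := horConst_nonneg n K hC
  have hτ := boxSize_nonneg n T.r T.height
  have hrho : 0 ≤ T.rho S := add_nonneg (div_nonneg hr.le hR.le) (div_nonneg hh.le hH.le)
  refine hP.setLIntegral_le_of_isFlagConv hF hr hFl (ρ := S.r / 16) (η := S.height / 16)
    (by positivity) (by positivity) fun ε L δ M hε hερ hρL hδ hδη hηM => ?_
  refine (lintegral_mono_set (Set.compl_subset_compl.2 hS')).trans
    ((hP.setLIntegral_flag_le hF hr hh hC T.sq_r_le_height hbox hε hερ hρL (by linarith) hδ hδη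
      hηM).trans ?_)
  refine mul_le_mul_left ?_ _
  set B' := (3 * 2 ^ n + 4 * n) * K ^ 2 * C with hB'
  have hB'0 : 0 ≤ B' := by positivity
  have h1 : 2 * horConst n K C * (T.r / (S.r / 16)) + B' * (T.height / (S.height / 16)) ≤
      16 * (2 * horConst n K C + B') * T.rho S := by
    have e1 : T.r / (S.r / 16) = 16 * (T.width / S.width) := by
      rw [div_div_eq_mul_div]; simp only [Tube.width]; ring
    have e2 : T.height / (S.height / 16) = 16 * (T.height / S.height) := by
      rw [div_div_eq_mul_div]; ring
    have h2 : 0 ≤ T.width / S.width := div_nonneg hr.le hR.le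
    have h3 : 0 ≤ T.height / S.height := div_nonneg hh.le hH.le
    rw [e1, e2, Tube.rho]
    nlinarith [mul_nonneg hB h3, mul_nonneg hB'0 h2]
  calc ENNReal.ofReal ((2 * horConst n K C * (T.r / (S.r / 16)) +
        B' * (T.height / (S.height / 16))) * boxSize n T.r T.height)
      ≤ ENNReal.ofReal (16 * (2 * horConst n K C + B') * T.rho S * boxSize n T.r T.height) :=
        ENNReal.ofReal_le_ofReal (mul_le_mul_of_nonneg_right h1 hτ)
    _ = ENNReal.ofReal (16 * (2 * horConst n K C + B') * T.rho S) *
        ENNReal.ofReal (boxSize n T.r T.height) := ENNReal.ofReal_mul (by positivity)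
    _ ≤ ENNReal.ofReal (16 * (2 * horConst n K C + B') * T.rho S) *
        (ENNReal.ofReal ((4 / 3) ^ n) * volume T.carrier ^ (1 / 2 : ℝ)) :=
        mul_le_mul_right T.ofReal_boxSize_le _
    _ = ENNReal.ofReal (flagConst n K C * T.rho S) * volume T.carrier ^ (1 / 2 : ℝ) := by
        rw [← mul_assoc, ← ENNReal.ofReal_mul (by positivity), flagConst]
        congr 2
        ring

include hF hP hC in
-- The box of `T` itself is enlarged. Its width is at most half and its height at most a quarter of
-- those of `S`, so the result fits into the box with factor 3/4 inside `S`: `1/2 + 1/16` and `1/4 +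
-- 1/256 + 1/64 + 1/16` are both below 3/4.
theorem Precursor.setLIntegral_compl_le_of_center_eq (hn : 1 ≤ n)
    (hTS : T.double.carrier ⊆ S.carrier) (hc : S.center = T.center) {F : Heis n → ℂ}
    (hFl : IsFlagConv φ₁ φ₂ a F) :
    ∫⁻ g in S.carrierᶜ, ‖F g‖ₑ ≤
      ENNReal.ofReal (flagConst n K C * T.rho S) * volume T.carrier ^ (1 / 2 : ℝ) * N := by
  have h1 := Tube.two_mul_r_le hn hTS
  have h2 := Tube.four_mul_height_le hTS hc
  have h3 := S.sq_r_le_height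
  have hR := S.r_pos
  refine hP.setLIntegral_compl_tube_le hF hC h1 hFl (subset_refl _) ?_
  rw [← hc]
  refine (box_subset_box _ (by linarith) ?_).trans S.box_subset_carrier
  nlinarith [T.height_pos]

include hF hP hC in
-- With no relation between the centres, the whole box of `S` is enlarged. The relative size becomes
-- `1 + 1/16` in width and at most `1 + 1/256 + 1/32 + 1/16` in height, against the room `3/2` and
-- `3` available inside `2S`.
theorem Precursor.setLIntegral_compl_double_le (hn : 1 ≤ n)
    (hTS : T.double.carrier ⊆ S.carrier) {F : Heis n → ℂ} (hFl : IsFlagConv φ₁ φ₂ a F) :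
    ∫⁻ g in S.double.carrierᶜ, ‖F g‖ₑ ≤
      ENNReal.ofReal (flagConst n K C * T.rho S) * volume T.carrier ^ (1 / 2 : ℝ) * N := by
  have h1 := Tube.two_mul_r_le hn hTS
  have h3 := S.sq_r_le_height
  have hR := S.r_pos
  refine hP.setLIntegral_compl_tube_le hF hC h1 hFl
    ((T.box_subset_double.trans hTS).trans S.carrier_subset_box) ?_
  refine (box_subset_box _ ?_ ?_).trans S.double.box_subset_carrier
  · simp only [Tube.double]; linarith
  · rw [Tube.height_double]
    nlinarith [S.height_pos]

end Tubes

end FlagHeisenberg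

end

theorem mainTheorem1 (n : ℕ) (hn : 1 ≤ n)
    (φ₁ : Heis n → ℂ) (φ₂ : ℝ → ℂ)
    (hφ₁ : ContDiff ℝ ∞ φ₁) (hφ₂ : ContDiff ℝ ∞ φ₂)
    (hsupp₁ : tsupport φ₁ ⊆ ball₁ n 1) (hsupp₂ : tsupport φ₂ ⊆ ball₂ 1)
    (hmean₁ : ∫ g, φ₁ g = 0) (hmean₂ : ∫ v, φ₂ v = 0)
    (C₀ : ℝ) :
    ∃ C : ℝ, 0 < C ∧ ∀ (T : Tube n) (a : Heis n → ℂ), IsParticle C₀ T a →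
      ∃ F : Heis n → ℂ, IsFlagConv φ₁ φ₂ a F ∧
        ∀ S : Tube n, T.double.carrier ⊆ S.carrier →
          (S.center = T.center →
            ∫⁻ g in S.carrierᶜ, ‖F g‖ₑ ≤
              ENNReal.ofReal (C * T.rho S) * volume T.carrier ^ (1 / 2 : ℝ) *
                eLpNorm a 2 volume) ∧
          ∫⁻ g in S.double.carrierᶜ, ‖F g‖ₑ ≤
            ENNReal.ofReal (C * T.rho S) * volume T.carrier ^ (1 / 2 : ℝ) *
              eLpNorm a 2 volume := by
  have hb₁ := isBump_heis hφ₁ hsupp₁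
  have hb₂ := isBump_line hφ₂ hsupp₂
  obtain ⟨K, hF⟩ := exists_flagBounds hb₁ hb₂ hmean₁ hmean₂
  have hC := flagConst_nonneg n K (abs_nonneg C₀)
  -- `flagConst` may vanish, and the added 1 makes the constant positive. It was fixed before `T`
  -- and `a`, as uniformity demands.
  refine ⟨flagConst n K |C₀| + 1, by linarith, fun T a ha => ?_⟩
  obtain ⟨A, V, D, hP⟩ := ha.exists_precursor
  obtain ⟨F, hFl⟩ := hP.exists_isFlagConv hF hmean₁ hmean₂ ha.1.2 T.r_pos T.height_pos
    (abs_nonneg C₀)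
  refine ⟨F, hFl, fun S hTS => ?_⟩
  have hrho : 0 ≤ T.rho S := add_nonneg (div_nonneg T.r_pos.le S.r_pos.le)
    (div_nonneg T.height_pos.le S.height_pos.le)
  have hle : ENNReal.ofReal (flagConst n K |C₀| * T.rho S) * volume T.carrier ^ (1 / 2 : ℝ) *
      eLpNorm a 2 volume ≤ ENNReal.ofReal ((flagConst n K |C₀| + 1) * T.rho S) *
        volume T.carrier ^ (1 / 2 : ℝ) * eLpNorm a 2 volume :=
    mul_le_mul_left (mul_le_mul_left (ENNReal.ofReal_le_ofReal
      (mul_le_mul_of_nonneg_right (by linarith) hrho)) _) _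
  exact ⟨fun hc => (hP.setLIntegral_compl_le_of_center_eq hF (abs_nonneg C₀) hn hTS hc hFl).trans
      hle, (hP.setLIntegral_compl_double_le hF (abs_nonneg C₀) hn hTS hFl).trans hle⟩
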